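/- **Syntax.** Let $\tau$ be a purely relational vocabulary. Formulas of SCL and of BndSCL (the syntax is the same) are built from the first-order atoms over $\tau$ (including equality and $\bot$) and from *claim symbols* $C_{L_i}$ ($i\in\mathbb N$) by $\neg,\wedge,\vee,\exists x,\forall x$ and by the rule: if $\varphi$ is a formula and $L_i$ a *label symbol*, then $L_i\varphi$ is a formula. The free variables are defined as in first-order logic, where $C_L$ has none and $L\psi$ has those of $\psi$. The *reference formula* of an occurrence of $C_L$ is the closest subformula occurrence of the form $L\psi$ above it, if there is one; otherwise the occurrence is *free*. **Unbounded semantics (SCL).** For a structure $\mathfrak A$ with nonempty domain $A$ and an assignment $s$, the game $\mathcal G_\infty(\mathfrak A,s,\varphi)$ of Eloise and Abelard has positions $(\psi,t,\#)$ with $\psi$ a subformula occurrence of $\varphi$, $t$ an assignment and $\#\in\{+,-\}$; it starts at $(\varphi,s,+)$. At $(\neg\psi,t,\#)$ the play moves to $\psi$ with the opposite sign. At $\vee$ and $\exists$ with sign $+$, and at $\wedge$ and $\forall$ with sign $-$, Eloise chooses the disjunct/conjunct, respectively the new value in $A$ of the quantified variable; in the dual cases Abelard chooses. At $(L\psi,t,\#)$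 the play moves to $(\psi,t,\#)$, and at $(C_L,t,\#)$ it moves to $(L\psi,t,\#)$, where $L\psi$ is the reference formula; if there is none, the play ends and nobody wins. At a first-order atom the play ends, and Eloise wins if the atom is true and the sign is $+$ or the atom is false and the sign is $-$; otherwise Abelard wins. Infinite plays are won by nobody. $\varphi$ is true in $\mathfrak A$ under $s$ if Eloise has a winning strategy, and *valid* (in SCL) if it is true in all $\mathfrak A$ under all $s$. **Bounded semantics (BndSCL).** In $\mathcal G_n(\mathfrak A,s,\varphi)$ the positions carry in addition a clock value, initially $n$; every move from a claim symbol to its reference formula lowers it by one, and a play that reaches a claim symbol with clock value $0$ ends and is won by nobody. In $\mathcal G_\omega(\mathfrak A,s,\varphi)$ Abelard first picks $n'\in\mathbb N$, then Eloise picks $n\ge n'$, and then $\mathcal G_n(\mathfrak A,s,\varphi)$ is played. $\varphi$ is valid in BndSCL if Eloise has a winning strategy in $\mathcal G_\omega(\mathfrak A,s,\varphi)$ for all $\mathfrak A$ and $s$. **Approximants.** A formula is *regular* if no label symbol occurs twice in it and no label symbol $L$ occurs in it if $C_L$ occurs free in it. Let $\varphi'=\varphi$ if $\varphi$ is regular;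 otherwise let $\varphi'$ be the regular formula obtained by renaming the label symbol occurrences, each together with the claim symbols that refer to it, to pairwise distinct fresh label symbols. Put $\Psi^0_\varphi=\varphi'$, and let $\Psi^{k+1}_\varphi$ be obtained from $\Psi^k_\varphi$ by replacing every non-free claim symbol occurrence by its reference formula in $\Psi^k_\varphi$. The *$n$-th approximant* $\Phi^n_\varphi$ is the first-order formula obtained from $\Psi^n_\varphi$ by removing all label symbols and replacing every claim symbol occurrence by $\bot$ if it is positive (in the scope of an even number of negations) and by $\top$ if it is negative. **Theorem.** 1. A formula $\varphi$ is valid in SCL if and only if for some $n\in\mathbb N$ the first-order formula $\Phi^n_\varphi$ is valid. 2. A formula is valid in BndSCL if and only if it is valid in SCL. 3. Over the vocabulary with countably many relation symbols of each arity, the set of (Gödel numbers of) valid formulas of SCL and the set of (Gödel numbers of) valid sentences of SCL are recursively enumerable. -/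

import Mathlib

universe u v w

namespace SCL

/-! ### Two-player games -/

/-- The two players: Eloise (player 0) and Abelard (player 1). -/
inductive Player where
  | eloise : Player
  | abelard : Player

/-- A two-player game in which only finite plays are won: `turn p` is the player who moves at
position `p`, `move` is the edge relation of the arena, and `winner p` is the winner (if any) of
the finite plays whose last position is the dead end `p`. Infinite plays are won by nobody. -/
structure Game where
  Pos : Type u
  init : Pos
  turn : Pos → Player
  move : Pos → Pos → Prop
  winner : Pos → Option Player

namespace Game

variable (G : Game.{u})

/-- A finite walk of the arena that begins at the initial position. -/
def IsWalk (h : List G.Pos) : Prop :=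
  h.head? = some G.init ∧ h.IsChain G.move

/-- A dead end: a position from which there is no move. -/
def IsDeadEnd (p : G.Pos) : Prop := ∀ q, ¬ G.move p q

/-- A finite sequence or an `ω`-sequence of positions. -/
inductive Play (G : Game.{u}) where
  | finite : List G.Pos → Play G
  | infinite : (ℕ → G.Pos) → Play G

/-- The plays are the maximal walks from the initial position: those that are infinite or end in
a dead end. -/
def IsPlay : Play G → Prop
  | .finite h => G.IsWalk h ∧ ∀ p ∈ h.getLast?, G.IsDeadEnd p
  | .infinite f => f 0 = G.init ∧ ∀ n, G.move (f n) (f (n + 1))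

/-- The finite prefixes of a play. -/
def IsPrefixOf (h : List G.Pos) : Play G → Prop
  | .finite h' => h <+: h'
  | .infinite f => h = (List.range h.length).map f

/-- The plays won by player `i`. -/
def Wins (i : Player) : Play G → Prop
  | .finite h => ∃ p ∈ h.getLast?, G.winner p = some i
  | .infinite _ => False

/-- `f` is a strategy of player `i`: at every finite walk that ends in a position of `i` which is
not a dead end, `f` chooses a legal move. (Other values of `f` are irrelevant.) -/
def IsStrategy (i : Player) (f : List G.Pos → G.Pos) : Prop :=
  ∀ (h : List G.Pos) (p : G.Pos), G.IsWalk (h ++ [p]) → G.turn p = i → ¬ G.IsDeadEnd p →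
    G.move p (f (h ++ [p]))

/-- The strategy `f` of player `i` is followed in a play. -/
def Follows (i : Player) (f : List G.Pos → G.Pos) (P : Play G) : Prop :=
  ∀ (h : List G.Pos) (p q : G.Pos), G.IsPrefixOf (h ++ [p, q]) P → G.turn p = i →
    q = f (h ++ [p])

/-- `f` is a winning strategy of player `i`: every play in which it is followed is won by `i`. -/
def IsWinningStrategy (i : Player) (f : List G.Pos → G.Pos) : Prop :=
  G.IsStrategy i f ∧ ∀ P : Play G, G.IsPlay P → G.Follows i f P → G.Wins i P

/-- Player `i` has a winning strategy. -/
def HasWinningStrategy (i : Player) : Prop :=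
  ∃ f : List G.Pos → G.Pos, G.IsWinningStrategy i f

end Game

/-! ### Formulas -/

/-- Formulas of first-order logic with self-reference over a relational vocabulary: variables and
label symbols are indexed by natural numbers, `label l φ` is `L_l φ` and `claim l` is the claim
symbol `C_{L_l}`. -/
inductive Formula (L : FirstOrder.Language.{u, v}) : Type v where
  | bot : Formula L
  | eq : ℕ → ℕ → Formula L
  | rel : {k : ℕ} → L.Relations k → (Fin k → ℕ) → Formula L
  | neg : Formula L → Formula L
  | and : Formula L → Formula L → Formula L
  | or : Formula L → Formula L → Formula L
  | all : ℕ → Formula L → Formula L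
  | ex : ℕ → Formula L → Formula L
  | label : ℕ → Formula L → Formula L
  | claim : ℕ → Formula L

variable {L : FirstOrder.Language.{u, v}}

namespace Formula

/-- The free variables of a formula. -/
def freeVars : Formula L → Finset ℕ
  | bot => ∅
  | eq x y => {x, y}
  | rel _ t => Finset.univ.image t
  | neg φ => φ.freeVars
  | and φ ψ => φ.freeVars ∪ ψ.freeVars
  | or φ ψ => φ.freeVars ∪ ψ.freeVars
  | all x φ => φ.freeVars.erase x
  | ex x φ => φ.freeVars.erase x
  | label _ φ => φ.freeVars
  | claim _ => ∅

/-- Sentences are the formulas without free variables. -/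
def IsSentence (φ : Formula L) : Prop := φ.freeVars = ∅

/-- The list of all label symbol occurrences. -/
def labels : Formula L → List ℕ
  | bot => []
  | eq _ _ => []
  | rel _ _ => []
  | neg φ => φ.labels
  | and φ ψ => φ.labels ++ ψ.labels
  | or φ ψ => φ.labels ++ ψ.labels
  | all _ φ => φ.labels
  | ex _ φ => φ.labels
  | label l φ => l :: φ.labels
  | claim _ => []

/-- The claim symbols that have a free occurrence. -/
def freeClaims : Formula L → Finset ℕ
  | bot => ∅
  | eq _ _ => ∅
  | rel _ _ => ∅
  | neg φ => φ.freeClaims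
  | and φ ψ => φ.freeClaims ∪ ψ.freeClaims
  | or φ ψ => φ.freeClaims ∪ ψ.freeClaims
  | all _ φ => φ.freeClaims
  | ex _ φ => φ.freeClaims
  | label l φ => φ.freeClaims.erase l
  | claim l => {l}

/-- Regular formulas: no label symbol occurs twice, and a label symbol whose claim symbol occurs
free does not occur at all. -/
def IsRegular (φ : Formula L) : Prop :=
  φ.labels.Nodup ∧ ∀ l ∈ φ.freeClaims, l ∉ φ.labels

instance (φ : Formula L) : Decidable φ.IsRegular :=
  inferInstanceAs (Decidable (_ ∧ _))

/-- A strict upper bound on the indices of the label and claim symbols of a formula. -/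
def bound : Formula L → ℕ
  | bot => 0
  | eq _ _ => 0
  | rel _ _ => 0
  | neg φ => φ.bound
  | and φ ψ => max φ.bound ψ.bound
  | or φ ψ => max φ.bound ψ.bound
  | all _ φ => φ.bound
  | ex _ φ => φ.bound
  | label l φ => max (l + 1) φ.bound
  | claim l => l + 1

/-- `φ.rename ρ n` renames the label symbol occurrences of `φ`, from left to right, to
`n, n + 1, …`, renames every claim symbol occurrence together with the label symbol occurrence in
whose strict scope it is, and renames the free claim symbols by `ρ`. The second component of the
result is the next unused index. -/
def rename : Formula L → (ℕ → ℕ) → ℕ → Formula L × ℕ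
  | bot, _, n => (bot, n)
  | eq x y, _, n => (eq x y, n)
  | rel R t, _, n => (rel R t, n)
  | neg φ, ρ, n => (neg (φ.rename ρ n).1, (φ.rename ρ n).2)
  | and φ ψ, ρ, n =>
      (and (φ.rename ρ n).1 (ψ.rename ρ (φ.rename ρ n).2).1, (ψ.rename ρ (φ.rename ρ n).2).2)
  | or φ ψ, ρ, n =>
      (or (φ.rename ρ n).1 (ψ.rename ρ (φ.rename ρ n).2).1, (ψ.rename ρ (φ.rename ρ n).2).2)
  | all x φ, ρ, n => (all x (φ.rename ρ n).1, (φ.rename ρ n).2)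
  | ex x φ, ρ, n => (ex x (φ.rename ρ n).1, (φ.rename ρ n).2)
  | label l φ, ρ, n =>
      (label n (φ.rename (Function.update ρ l n) (n + 1)).1,
        (φ.rename (Function.update ρ l n) (n + 1)).2)
  | claim l, ρ, n => (claim (ρ l), n)

/-- The regularisation of a formula: the formula itself if it is regular; otherwise all label
symbol occurrences are safely renamed to pairwise distinct fresh label symbols, and the free claim
symbols are left as they are. -/
def regularise (φ : Formula L) : Formula L :=
  if φ.IsRegular then φ else (φ.rename id φ.bound).1

/-- Replace every claim symbol occurrence by its reference formula, where `ρ` gives the reference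
formulas that come from outside. -/
def replaceClaims (ρ : ℕ → Option (Formula L)) : Formula L → Formula L
  | bot => bot
  | eq x y => eq x y
  | rel R t => rel R t
  | neg φ => neg (φ.replaceClaims ρ)
  | and φ ψ => and (φ.replaceClaims ρ) (ψ.replaceClaims ρ)
  | or φ ψ => or (φ.replaceClaims ρ) (ψ.replaceClaims ρ)
  | all x φ => all x (φ.replaceClaims ρ)
  | ex x φ => ex x (φ.replaceClaims ρ)
  | label l φ => label l (φ.replaceClaims (Function.update ρ l (some (label l φ))))
  | claim l => (ρ l).getD (claim l)

/-- The `n`-th unfolding: the 0-th unfolding is the regularisation, and each further unfolding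
replaces every claim symbol that is not free in the previous unfolding by its reference formula
in the previous unfolding. -/
def unfolding (φ : Formula L) : ℕ → Formula L
  | 0 => φ.regularise
  | n + 1 => (φ.unfolding n).replaceClaims fun _ => none

end Formula

/-! ### Approximants -/

open FirstOrder FirstOrder.Language in
/-- The universal quantification of a named variable in a first-order formula. -/
def allVar (x : ℕ) (ψ : L.Formula ℕ) : L.Formula ℕ :=
  BoundedFormula.all (n := 0) <|
    BoundedFormula.relabel (n := 1) (k := 0)
      (fun y : ℕ => if y = x then Sum.inr (0 : Fin 1) else Sum.inl y) ψ

open FirstOrder FirstOrder.Language in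
/-- The existential quantification of a named variable in a first-order formula. -/
def exVar (x : ℕ) (ψ : L.Formula ℕ) : L.Formula ℕ :=
  BoundedFormula.ex (n := 0) <|
    BoundedFormula.relabel (n := 1) (k := 0)
      (fun y : ℕ => if y = x then Sum.inr (0 : Fin 1) else Sum.inl y) ψ

open FirstOrder FirstOrder.Language in
/-- Remove all label symbols and replace every claim symbol occurrence by `⊥` if it is positive and
by `⊤` if it is negative; the Boolean tells whether the formula itself occurs positively. -/
def Formula.toFO : Formula L → Bool → L.Formula ℕ
  | .bot, _ => ⊥
  | .eq x y, _ => Term.equal (Term.var x) (Term.var y)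
  | .rel R t, _ => Relations.formula R fun i => Term.var (t i)
  | .neg φ, b => (φ.toFO (!b)).not
  | .and φ ψ, b => φ.toFO b ⊓ ψ.toFO b
  | .or φ ψ, b => φ.toFO b ⊔ ψ.toFO b
  | .all x φ, b => allVar x (φ.toFO b)
  | .ex x φ, b => exVar x (φ.toFO b)
  | .label _ φ, b => φ.toFO b
  | .claim _, b => if b then ⊥ else ⊤

/-- The `n`-th approximant, a first-order formula. -/
def approximant (φ : Formula L) (n : ℕ) : L.Formula ℕ :=
  (φ.unfolding n).toFO true

/-- A first-order formula is valid if it is true in all nonempty structures under all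
assignments. -/
def FOValid (ψ : L.Formula ℕ) : Prop :=
  ∀ (A : Type w) [Nonempty A] [L.Structure A] (s : ℕ → A), ψ.Realize s

theorem realize_allVar {A : Type w} [L.Structure A] (x : ℕ) (ψ : L.Formula ℕ) (s : ℕ → A) :
    (allVar x ψ).Realize s ↔ ∀ a, ψ.Realize (Function.update s x a) := by
  unfold allVar FirstOrder.Language.Formula.Realize
  rw [FirstOrder.Language.BoundedFormula.realize_all]
  refine forall_congr' fun a => ?_
  rw [FirstOrder.Language.BoundedFormula.realize_relabel]
  refine iff_of_eq ?_
  congr 1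
  · funext y
    by_cases h : y = x
    · subst h; simp [Fin.snoc]
    · simp [h]
  · exact Subsingleton.elim _ _

theorem realize_exVar {A : Type w} [L.Structure A] (x : ℕ) (ψ : L.Formula ℕ) (s : ℕ → A) :
    (exVar x ψ).Realize s ↔ ∃ a, ψ.Realize (Function.update s x a) := by
  unfold exVar FirstOrder.Language.Formula.Realize
  rw [FirstOrder.Language.BoundedFormula.realize_ex]
  refine exists_congr fun a => ?_
  rw [FirstOrder.Language.BoundedFormula.realize_relabel]
  refine iff_of_eq ?_
  congr 1
  · funext y
    by_cases h : y = x
    · subst h; simp [Fin.snoc]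
    · simp [h]
  · exact Subsingleton.elim _ _

/-! ### Occurrences and reference formulas -/

/-- `Occ φ ψ` is the type of the occurrences of `ψ` as a subformula of `φ`, given as the paths
from the root `φ` of the syntax tree. -/
inductive Occ (φ : Formula L) : Formula L → Type v where
  | root : Occ φ φ
  | neg {ψ : Formula L} : Occ φ (.neg ψ) → Occ φ ψ
  | andLeft {ψ χ : Formula L} : Occ φ (.and ψ χ) → Occ φ ψ
  | andRight {ψ χ : Formula L} : Occ φ (.and ψ χ) → Occ φ χ
  | orLeft {ψ χ : Formula L} : Occ φ (.or ψ χ) → Occ φ ψ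
  | orRight {ψ χ : Formula L} : Occ φ (.or ψ χ) → Occ φ χ
  | all {x : ℕ} {ψ : Formula L} : Occ φ (.all x ψ) → Occ φ ψ
  | ex {x : ℕ} {ψ : Formula L} : Occ φ (.ex x ψ) → Occ φ ψ
  | label {l : ℕ} {ψ : Formula L} : Occ φ (.label l ψ) → Occ φ ψ

/-- The closest occurrence strictly above a given occurrence of a subformula of the form
`label l χ`, if there is one. -/
def Occ.ref {φ : Formula L} (l : ℕ) :
    {ψ : Formula L} → Occ φ ψ → Option (Σ χ : Formula L, Occ φ (.label l χ))
  | _, .root => none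
  | _, .neg o => o.ref l
  | _, .andLeft o => o.ref l
  | _, .andRight o => o.ref l
  | _, .orLeft o => o.ref l
  | _, .orRight o => o.ref l
  | _, .all o => o.ref l
  | _, .ex o => o.ref l
  | _, .label (l := l') (ψ := χ) o => if h : l' = l then some ⟨χ, h ▸ o⟩ else o.ref l

/-! ### The unbounded evaluation game -/

/-- The signs `+` and `-`. -/
inductive Sign where
  | plus : Sign
  | minus : Sign

/-- The opposite sign. -/
def Sign.flip : Sign → Sign
  | .plus => .minus
  | .minus => .plus

/-- Positions of the evaluation game for `φ` over the domain `A`. -/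
structure EvalPos (φ : Formula L) (A : Type w) where
  sub : Formula L
  occ : Occ φ sub
  assign : ℕ → A
  sign : Sign

/-- The moves of the evaluation game (of either player). -/
inductive EvalMove {φ : Formula L} {A : Type w} : EvalPos φ A → EvalPos φ A → Prop where
  | neg {ψ : Formula L} (o : Occ φ (.neg ψ)) (s : ℕ → A) (σ : Sign) :
      EvalMove ⟨_, o, s, σ⟩ ⟨_, o.neg, s, σ.flip⟩
  | andLeft {ψ χ : Formula L} (o : Occ φ (.and ψ χ)) (s : ℕ → A) (σ : Sign) :
      EvalMove ⟨_, o, s, σ⟩ ⟨_, o.andLeft, s, σ⟩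
  | andRight {ψ χ : Formula L} (o : Occ φ (.and ψ χ)) (s : ℕ → A) (σ : Sign) :
      EvalMove ⟨_, o, s, σ⟩ ⟨_, o.andRight, s, σ⟩
  | orLeft {ψ χ : Formula L} (o : Occ φ (.or ψ χ)) (s : ℕ → A) (σ : Sign) :
      EvalMove ⟨_, o, s, σ⟩ ⟨_, o.orLeft, s, σ⟩
  | orRight {ψ χ : Formula L} (o : Occ φ (.or ψ χ)) (s : ℕ → A) (σ : Sign) :
      EvalMove ⟨_, o, s, σ⟩ ⟨_, o.orRight, s, σ⟩
  | all {x : ℕ} {ψ : Formula L} (o : Occ φ (.all x ψ)) (s : ℕ → A) (σ : Sign) (a : A) :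
      EvalMove ⟨_, o, s, σ⟩ ⟨_, o.all, Function.update s x a, σ⟩
  | ex {x : ℕ} {ψ : Formula L} (o : Occ φ (.ex x ψ)) (s : ℕ → A) (σ : Sign) (a : A) :
      EvalMove ⟨_, o, s, σ⟩ ⟨_, o.ex, Function.update s x a, σ⟩
  | label {l : ℕ} {ψ : Formula L} (o : Occ φ (.label l ψ)) (s : ℕ → A) (σ : Sign) :
      EvalMove ⟨_, o, s, σ⟩ ⟨_, o.label, s, σ⟩
  | claim {l : ℕ} {χ : Formula L} (o : Occ φ (.claim l)) (r : Occ φ (.label l χ)) (s : ℕ → A)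
      (σ : Sign) (h : o.ref l = some ⟨χ, r⟩) :
      EvalMove ⟨_, o, s, σ⟩ ⟨_, r, s, σ⟩

/-- The player who moves when the current formula is `ψ` and the current sign is `σ`. Where there
is at most one move, it does not matter whose turn it is. -/
def turnAt : Formula L → Sign → Player
  | .and _ _, .plus => .abelard
  | .and _ _, .minus => .eloise
  | .or _ _, .plus => .eloise
  | .or _ _, .minus => .abelard
  | .all _ _, .plus => .abelard
  | .all _ _, .minus => .eloise
  | .ex _ _, .plus => .eloise
  | .ex _ _, .minus => .abelard
  | _, _ => .eloise

open Classical in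
/-- The winner of a play that ends in a first-order atom, where `t` says that the atom is true. -/
noncomputable def atomWinner (t : Prop) : Sign → Player
  | .plus => if t then .eloise else .abelard
  | .minus => if t then .abelard else .eloise

/-- The winner of a play that ends with the formula `ψ`, the assignment `s` and the sign `σ`: plays
are won only at first-order atoms. -/
noncomputable def winnerAt {A : Type w} [L.Structure A] :
    Formula L → (ℕ → A) → Sign → Option Player
  | .bot, _, σ => some (atomWinner False σ)
  | .eq x y, s, σ => some (atomWinner (s x = s y) σ)
  | .rel R t, s, σ =>
      some (atomWinner (FirstOrder.Language.Structure.RelMap R fun i => s (t i)) σ)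
  | _, _, _ => none

/-- The unbounded evaluation game. -/
noncomputable def evalGame (A : Type w) [L.Structure A] (s : ℕ → A) (φ : Formula L) : Game where
  Pos := EvalPos φ A
  init := ⟨φ, .root, s, .plus⟩
  turn p := turnAt p.sub p.sign
  move := EvalMove
  winner p := winnerAt p.sub p.assign p.sign

/-- Truth of a formula in a structure under an assignment in the unbounded semantics. -/
def Truth (A : Type w) [L.Structure A] (s : ℕ → A) (φ : Formula L) : Prop :=
  (evalGame A s φ).HasWinningStrategy .eloise

/-- Validity in the unbounded semantics. -/
def Valid (φ : Formula L) : Prop :=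
  ∀ (A : Type w) [Nonempty A] [L.Structure A] (s : ℕ → A), Truth A s φ

/-! ### The bounded evaluation games -/

/-- The moves of the clocked evaluation game: the second component is the clock value. -/
inductive ClockMove {φ : Formula L} {A : Type w} : EvalPos φ A × ℕ → EvalPos φ A × ℕ → Prop where
  | step {p q : EvalPos φ A} (m : ℕ) (hp : ∀ l, p.sub ≠ .claim l) (h : EvalMove p q) :
      ClockMove (p, m) (q, m)
  | jump {p q : EvalPos φ A} (m l : ℕ) (hp : p.sub = .claim l) (h : EvalMove p q) :
      ClockMove (p, m + 1) (q, m)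

/-- The `n`-bounded evaluation game. -/
noncomputable def clockGame (A : Type w) [L.Structure A] (s : ℕ → A) (φ : Formula L) (n : ℕ) :
    Game where
  Pos := EvalPos φ A × ℕ
  init := (⟨φ, .root, s, .plus⟩, n)
  turn p := turnAt p.1.sub p.1.sign
  move := ClockMove
  winner p := winnerAt p.1.sub p.1.assign p.1.sign

/-- Positions of the bounded evaluation game: the beginning, the position where Abelard has picked
a number, and the positions of the clocked games. -/
inductive BndPos (φ : Formula L) (A : Type w) where
  | start : BndPos φ A
  | picked : ℕ → BndPos φ A
  | clock : EvalPos φ A × ℕ → BndPos φ A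

/-- The moves of the bounded evaluation game: Abelard picks `n'`, then Eloise picks `n ≥ n'`, and
then the `n`-bounded evaluation game is played. -/
inductive BndMove {φ : Formula L} {A : Type w} (s : ℕ → A) : BndPos φ A → BndPos φ A → Prop where
  | abelard (n' : ℕ) : BndMove s .start (.picked n')
  | eloise (n' n : ℕ) (h : n' ≤ n) :
      BndMove s (.picked n') (.clock (⟨φ, .root, s, .plus⟩, n))
  | clock (p q : EvalPos φ A × ℕ) (h : ClockMove p q) : BndMove s (.clock p) (.clock q)

/-- The bounded evaluation game. -/
noncomputable def bndGame (A : Type w) [L.Structure A] (s : ℕ → A) (φ : Formula L) : Game where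
  Pos := BndPos φ A
  init := .start
  turn
    | .start => .abelard
    | .picked _ => .eloise
    | .clock p => turnAt p.1.sub p.1.sign
  move := BndMove s
  winner
    | .start => none
    | .picked _ => none
    | .clock p => winnerAt p.1.sub p.1.assign p.1.sign

/-- Truth of a formula in a structure under an assignment in the bounded semantics. -/
def BndTruth (A : Type w) [L.Structure A] (s : ℕ → A) (φ : Formula L) : Prop :=
  (bndGame A s φ).HasWinningStrategy .eloise

/-- Validity in the bounded semantics. -/
def BndValid (φ : Formula L) : Prop :=
  ∀ (A : Type w) [Nonempty A] [L.Structure A] (s : ℕ → A), BndTruth A s φ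

/-! ### Gödel numbers -/

/-- The relational vocabulary that has, for every arity, the relation symbols `R_0, R_1, …`. -/
def natVocabulary : FirstOrder.Language.{0, 0} := ⟨fun _ => Empty, fun _ => ℕ⟩

/-- The Gödel number of a formula over `natVocabulary`. -/
def Formula.code : Formula natVocabulary → ℕ
  | .bot => Nat.pair 0 0
  | .eq x y => Nat.pair 1 (Nat.pair x y)
  | .rel (k := k) R t =>
      Nat.pair 2 (Nat.pair k (Nat.pair R (Encodable.encode (List.ofFn t))))
  | .neg φ => Nat.pair 3 φ.code
  | .and φ ψ => Nat.pair 4 (Nat.pair φ.code ψ.code)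
  | .or φ ψ => Nat.pair 5 (Nat.pair φ.code ψ.code)
  | .all x φ => Nat.pair 6 (Nat.pair x φ.code)
  | .ex x φ => Nat.pair 7 (Nat.pair x φ.code)
  | .label l φ => Nat.pair 8 (Nat.pair l φ.code)
  | .claim l => Nat.pair 9 l

theorem Formula.code_injective : Function.Injective Formula.code := by
  intro φ
  induction φ with
  | bot | eq x y | claim l =>
    intro ψ h
    cases ψ <;> simp_all [Formula.code, Nat.pair_eq_pair]
  | @rel k R t =>
    intro ψ h
    cases ψ with
    | @rel k' R' t' =>
      simp only [Formula.code, Nat.pair_eq_pair, true_and] at h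
      obtain ⟨rfl, h⟩ := h
      obtain ⟨h1, h2⟩ := Nat.pair_eq_pair.mp h
      have h3 := List.ofFn_injective (Encodable.encode_injective h2)
      subst h3
      exact congrArg (fun r : natVocabulary.Relations k => Formula.rel r t) h1
    | _ => simp_all [Formula.code, Nat.pair_eq_pair]
  | neg φ ih | all x φ ih | ex x φ ih | label l φ ih =>
    intro ψ h
    cases ψ <;> simp_all [Formula.code, Nat.pair_eq_pair]
    exact ih (by tauto)
  | and φ ψ ih1 ih2 | or φ ψ ih1 ih2 =>
    intro χ h
    cases χ with
    | and χ1 χ2 | or χ1 χ2 =>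
      simp only [Formula.code, Nat.pair_eq_pair] at h
      first
        | (exact congrArg₂ _ (ih1 h.2.1) (ih2 h.2.2))
        | (exact absurd h.1 (by norm_num))
    | _ => simp_all [Formula.code, Nat.pair_eq_pair]

end SCL

/-! ### Winning regions, simulations and traps -/

namespace SCL

/-! Only finite plays are won, so Eloise's winning positions form a least fixed point, the inductive
predicate `EWin`. Having a winning strategy amounts to the initial position lying in it
(`Game.hasWinningStrategy_eloise_iff`). Replacing an occurrence by its formula together with the
stack of labels above it turns both evaluation games into one predicate `SWin`, which obeys
compositional clauses and differs between the two semantics only in the clock relation.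

The core is a systematic search for a countermodel. A tableau node is a finite set of claims "Eloise
does not win from here" about elements named by parameters, and `expandItem` unfolds one claim by
one move of the game. Four implications close a cycle. (a) If `φ` is valid, its tableau closes at
some finite depth `n`. Otherwise König's lemma gives an infinite branch (`exists_open_branch`), and
the branch describes a structure in which its positions form a trap: Eloise cannot leave the set and
Abelard can stay in it, so she does not win even without a clock (`exists_structure_of_branch`). (b)
If the tableau closes at depth `n`, Eloise wins the `n`-clocked game in every nonempty structure. A
position lost with clock `n` would satisfy the claims of the root, and one expansion costs at most
one tick, so some node at depth `n` would survive (`Refutes.exists_expand`, `sWin_of_expandAll`).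
(c) A win with clock `n` makes the `n`-th approximant true, since every branch of the unfolding has
resolved at least `n` claims (`Unf.realize`). (d) Truth of an approximant yields a win without a
clock, since the constants put in place of claims never help Eloise (`Unf.sWin`). The depth `n` is
the same for all structures; this replaces a compactness argument and gives the first statement.

For the bounded semantics, (a) and (b) supply one clock value that suffices everywhere, and larger
values only help (`SWin.mono_clock`); conversely, forgetting the clock preserves wins
(`BndTruth.truth`). Finally, validity says that some depth of the tableau is empty. On Gödel numbers
the expansion is primitive recursive, so validity is recursively enumerable. -/

/-- The winning region of Eloise in an arena. -/
inductive EWin {P : Type*} (turn : P → Player) (move : P → P → Prop)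
    (winner : P → Option Player) : P → Prop where
  | dead {p : P} (hd : ∀ q, ¬ move p q) (hw : winner p = some .eloise) : EWin turn move winner p
  | eloise {p q : P} (ht : turn p = .eloise) (hm : move p q) (hq : EWin turn move winner q) :
      EWin turn move winner p
  -- A move has to exist: Abelard being stuck is not a win for Eloise, as dead ends are judged by
  -- `winner` alone.
  | abelard {p q : P} (ht : turn p = .abelard) (hm : move p q)
      (hq : ∀ q, move p q → EWin turn move winner q) : EWin turn move winner p

/-- Winning positions are preserved by simulations. -/
theorem EWin.sim {P P' : Type*} {turn : P → Player} {move : P → P → Prop}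
    {winner : P → Option Player} {turn' : P' → Player} {move' : P' → P' → Prop}
    {winner' : P' → Option Player} (Z : P → P' → Prop)
    (hturn : ∀ p p', Z p p' → turn p = turn' p')
    (hwin : ∀ p p', Z p p' → (∀ q, ¬ move p q) → winner p = some .eloise →
      (∀ q, ¬ move' p' q) ∧ winner' p' = some .eloise)
    (hforth : ∀ p p', Z p p' → ∀ q, move p q → ∃ q', move' p' q' ∧ Z q q')
    (hback : ∀ p p', Z p p' → (∃ q, move p q) → ∀ q', move' p' q' → ∃ q, move p q ∧ Z q q')
    {p : P} (h : EWin turn move winner p) :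
    ∀ p', Z p p' → EWin turn' move' winner' p' := by
  induction h with
  | dead hd hw => exact fun p' hz => .dead (hwin _ _ hz hd hw).1 (hwin _ _ hz hd hw).2
  | eloise ht hm _ ih =>
    intro p' hz
    obtain ⟨q', hm', hz'⟩ := hforth _ _ hz _ hm
    exact .eloise ((hturn _ _ hz).symm.trans ht) hm' (ih _ hz')
  | abelard ht hm _ ih =>
    intro p' hz
    obtain ⟨q', hm', -⟩ := hforth _ _ hz _ hm
    refine .abelard ((hturn _ _ hz).symm.trans ht) hm' fun r' hr' => ?_
    obtain ⟨r, hr, hz'⟩ := hback _ _ hz ⟨_, hm⟩ _ hr'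
    exact ih r hr _ hz'

/-- A set of positions in which Abelard can stay, or get stuck without losing, is disjoint from
the winning region of Eloise. -/
theorem EWin.notMem_of_trap {P : Type*} {turn : P → Player} {move : P → P → Prop}
    {winner : P → Option Player} (X : P → Prop)
    (hw : ∀ p, X p → (∀ q, ¬ move p q) → winner p ≠ some .eloise)
    (he : ∀ p, X p → turn p = .eloise → ∀ q, move p q → X q)
    (ha : ∀ p, X p → turn p = .abelard → (∃ q, move p q) → ∃ q, move p q ∧ X q)
    {p : P} (h : EWin turn move winner p) : ¬ X p := by
  induction h with
  | dead hd hw' => exact fun hx => hw _ hx hd hw'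
  | eloise ht hm _ ih => exact fun hx => ih (he _ hx ht _ hm)
  | abelard ht hm _ ih =>
    intro hx
    obtain ⟨q, hq, hx'⟩ := ha _ hx ht ⟨_, hm⟩
    exact ih q hq hx'

/-! ### Winning strategies and the winning region -/

namespace Game

/-- The winning region of Eloise in a game. -/
def EWin (G : Game.{u}) : G.Pos → Prop := SCL.EWin G.turn G.move G.winner

/-- The game with another initial position. -/
abbrev startAt (G : Game.{u}) (p : G.Pos) : Game.{u} := { G with init := p }

variable {G : Game.{u}}

theorem IsWalk.ne_nil {h : List G.Pos} (hw : G.IsWalk h) : h ≠ [] := by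
  rintro rfl
  simp [IsWalk] at hw

theorem IsWalk.head_eq {p a : G.Pos} {t : List G.Pos} (hw : (G.startAt p).IsWalk (a :: t)) :
    a = p := Option.some.inj hw.1

theorem isWalk_startAt_cons {p q : G.Pos} {h : List G.Pos} :
    (G.startAt p).IsWalk (p :: q :: h) ↔ G.move p q ∧ (G.startAt q).IsWalk (q :: h) := by
  simp only [IsWalk, startAt, List.head?_cons, List.isChain_cons_cons, true_and]

/-- The rest of a play after its first move. -/
def Play.tail {p : G.Pos} (q : G.Pos) : Play (G.startAt p) → Play (G.startAt q)
  | .finite h => .finite h.tail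
  | .infinite f => .infinite fun n => f (n + 1)

/-- The second position of a play, if there is one. -/
def Play.second {p : G.Pos} : Play (G.startAt p) → Option G.Pos
  | .finite h => h.tail.head?
  | .infinite f => some (f 1)

theorem isPlay_tail {p q : G.Pos} {P : Play (G.startAt p)} (hP : (G.startAt p).IsPlay P)
    (h2 : P.second = some q) : G.move p q ∧ (G.startAt q).IsPlay (P.tail q) := by
  cases P with
  | finite h =>
    obtain ⟨hw, hd⟩ := hP
    match h, hw, hd, h2 with
    | [], hw, _, _ => exact absurd rfl hw.ne_nil
    | [_], _, _, h2 => simp [Play.second] at h2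
    | a :: b :: t, hw, hd, h2 =>
      have hb : b = q := Option.some.inj h2
      have ha : (a : G.Pos) = p := IsWalk.head_eq hw
      subst a b
      have := isWalk_startAt_cons.1 hw
      exact ⟨this.1, this.2, fun r hr => hd r (by rwa [List.getLast?_cons_cons])⟩
  | infinite f =>
    obtain ⟨h0, hm⟩ := hP
    have hb : f 1 = q := Option.some.inj h2
    refine ⟨?_, hb, fun n => hm (n + 1)⟩
    have h0 : f 0 = p := h0
    have : G.move (f 0) (f 1) := hm 0
    rwa [h0, hb] at this

theorem isPrefixOf_cons {p q : G.Pos} {P : Play (G.startAt p)} (hP : (G.startAt p).IsPlay P)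
    {h : List G.Pos} (hh : (G.startAt q).IsPrefixOf h (P.tail q)) :
    (G.startAt p).IsPrefixOf (p :: h) P := by
  cases P with
  | finite l =>
    match l, hP with
    | [], hP => exact absurd rfl hP.1.ne_nil
    | a :: t, hP =>
      have ha : (a : G.Pos) = p := IsWalk.head_eq hP.1
      subst a
      exact List.cons_prefix_cons.2 ⟨rfl, hh⟩
  | infinite f =>
    obtain ⟨h0, -⟩ := hP
    have h0 : f 0 = p := h0
    change h = (List.range h.length).map fun n => f (n + 1) at hh
    change p :: h = (List.range (h.length + 1)).map f
    rw [List.range_succ_eq_map, List.map_cons, h0, List.map_map]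
    exact congrArg _ hh

theorem wins_of_tail {i : Player} {p q : G.Pos} {P : Play (G.startAt p)} (h2 : P.second = some q)
    (hw : (G.startAt q).Wins i (P.tail q)) : (G.startAt p).Wins i P := by
  cases P with
  | finite l =>
    match l, h2 with
    | a :: b :: t, _ => exact hw
  | infinite f => exact hw.elim

theorem second_of_move {p r : G.Pos} {P : Play (G.startAt p)} (hP : (G.startAt p).IsPlay P)
    (hm : G.move p r) : ∃ q, P.second = some q ∧ (G.startAt p).IsPrefixOf [p, q] P := by
  cases P with
  | finite l =>
    match l, hP with
    | [], hP => exact absurd rfl hP.1.ne_nil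
    | [a], hP =>
      have ha : (a : G.Pos) = p := IsWalk.head_eq hP.1
      subst a
      exact absurd hm (hP.2 p (by simp) r)
    | a :: b :: t, hP =>
      have ha : (a : G.Pos) = p := IsWalk.head_eq hP.1
      subst a
      exact ⟨b, rfl, List.prefix_append [p, b] t⟩
  | infinite f =>
    have h0 : f 0 = p := hP.1
    refine ⟨f 1, rfl, ?_⟩
    change [p, f 1] = [f 0, f 1]
    rw [h0]

/-- Strategies for the positions after the first move are combined to a strategy. -/
theorem hasWinningStrategy_of_next {i : Player} {p r : G.Pos} (hm : G.move p r)
    (g : List G.Pos → G.Pos) (hg : G.turn p = i → G.move p (g [p]))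
    (F : G.Pos → List G.Pos → G.Pos)
    (hF : ∀ q, G.move p q → (G.turn p = i → q = g [p]) →
      (G.startAt q).IsWinningStrategy i (F q)) :
    (G.startAt p).HasWinningStrategy i := by
  classical
  -- After the first move to `b` the strategy plays `F b` on the rest of the history. If `i` has
  -- deviated from `g` at the first move, `F b` need not be a strategy, yet `f` must still be legal
  -- there, so any legal move is taken.
  let f : List G.Pos → G.Pos := fun h => match h with
    | a :: b :: t => if G.turn p = i ∧ b ≠ g [p] then
          Classical.epsilon (h := ⟨p⟩) (G.move ((b :: t).getLast (by simp)))
        else F b (b :: t)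
    | _ => g [p]
  refine ⟨f, ?_, fun P hP hfol => ?_⟩
  · intro h q hw ht hd
    match h, hw with
    | [], hw =>
      have hq : q = p := IsWalk.head_eq hw
      subst q
      exact hg ht
    | [a], hw =>
      have ha : (a : G.Pos) = p := IsWalk.head_eq hw
      subst a
      have := isWalk_startAt_cons.1 hw
      by_cases hc : G.turn p = i ∧ q ≠ g [p]
      · change G.move q (if _ then _ else _)
        rw [if_pos hc]
        obtain ⟨s, hs⟩ := not_forall_not.1 hd
        exact Classical.epsilon_spec (p := G.move q) ⟨s, hs⟩
      · change G.move q (if _ then _ else _)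
        rw [if_neg hc]
        exact (hF q this.1 fun h1 => by_contra fun h2 => hc ⟨h1, h2⟩).1 [] q this.2 ht hd
    | a :: b :: t, hw =>
      have ha : (a : G.Pos) = p := IsWalk.head_eq hw
      subst a
      have := isWalk_startAt_cons.1 hw
      by_cases hc : G.turn p = i ∧ b ≠ g [p]
      · change G.move q (if _ then _ else _)
        rw [if_pos hc]
        obtain ⟨s, hs⟩ := not_forall_not.1 hd
        have := Classical.epsilon_spec (p := G.move q) ⟨s, hs⟩
        convert this using 3
        simp
      · change G.move q (if _ then _ else _)
        rw [if_neg hc]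
        exact (hF b this.1 fun h1 => by_contra fun h2 => hc ⟨h1, h2⟩).1 (b :: t) q this.2 ht hd
  · obtain ⟨q, h2, hpre⟩ := second_of_move hP hm
    have hq := isPlay_tail hP h2
    have hfq : G.turn p = i → q = g [p] := fun ht => hfol [] p q hpre ht
    refine wins_of_tail h2 ((hF q hq.1 hfq).2 _ hq.2 fun h a b hpre' ht => ?_)
    have := hfol (p :: h) a b (isPrefixOf_cons hP hpre') ht
    rw [this]
    have hhead : (h ++ [a]).head? = some q := by
      cases P with
      | finite l =>
        have h1 : h ++ [a, b] <+: l.tail := hpre'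
        have h3 : l.tail.head? = some q := h2
        obtain ⟨t, h1⟩ := h1
        rw [← h1] at h3
        cases h <;> exact h3
      | infinite k =>
        have h1 : h ++ [a, b] = (List.range (h ++ [a, b]).length).map fun n => k (n + 1) := hpre'
        have h3 : k 1 = q := Option.some.inj h2
        have h4 := congrArg List.head? h1
        rw [← h3]
        cases h with
        | nil => exact h4.trans (by simp [List.range_succ_eq_map])
        | cons => exact h4.trans (by simp [List.range_succ_eq_map])
    match hl : h ++ [a], hhead with
    | c :: t, hhead =>
      have hc : c = q := Option.some.inj hhead
      subst c
      have hn : ¬ (G.turn p = i ∧ q ≠ g [p]) := fun hh => hh.2 (hfq hh.1)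
      change f (p :: (h ++ [a])) = _
      rw [hl]
      change (if _ then _ else _) = _
      rw [if_neg hn]

/-- Membership in the region has a well-founded derivation, so a strategy that descends in it
reaches a won dead end after finitely many moves. The induction builds it one first move at a time,
which is why the initial position varies. -/
theorem hasWinningStrategy_of_eWin {p : G.Pos} (h : G.EWin p) :
    (G.startAt p).HasWinningStrategy .eloise := by
  classical
  induction h with
  | @dead p hd hw =>
    refine ⟨fun _ => p, ?_, ?_⟩
    · intro h q hwalk _ hnd
      match h, hwalk with
      | [], hwalk =>
        have hq : q = p := IsWalk.head_eq hwalk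
        exact absurd (hq ▸ hd) hnd
      | a :: t, hwalk =>
        have ha : (a : G.Pos) = p := IsWalk.head_eq hwalk
        subst a
        cases t <;> exact absurd (isWalk_startAt_cons.1 hwalk).1 (hd _)
    · intro P hP _
      cases P with
      | finite l =>
        match l, hP with
        | [], hP => exact absurd rfl hP.1.ne_nil
        | [a], hP =>
          have ha : (a : G.Pos) = p := IsWalk.head_eq hP.1
          exact ⟨a, by simp, ha ▸ hw⟩
        | a :: b :: t, hP =>
          have ha : (a : G.Pos) = p := IsWalk.head_eq hP.1
          subst a
          exact absurd (isWalk_startAt_cons.1 hP.1).1 (hd _)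
      | infinite f =>
        have h0 : f 0 = p := hP.1
        exact absurd (h0 ▸ hP.2 0) (hd _)
  | @eloise p q ht hm _ ih =>
    obtain ⟨f, hf⟩ := ih
    exact hasWinningStrategy_of_next hm (fun _ => q) (fun _ => hm) (fun _ => f)
      fun r _ hr => hr ht ▸ hf
  | @abelard p q ht hm _ ih =>
    have : ∀ r, ∃ f, G.move p r → (G.startAt r).IsWinningStrategy .eloise f := fun r => by
      by_cases hr : G.move p r
      · obtain ⟨f, hf⟩ := ih r hr
        exact ⟨f, fun _ => hf⟩
      · exact ⟨fun _ => p, fun h => absurd h hr⟩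
    choose F hF using this
    exact hasWinningStrategy_of_next hm (fun _ => q) (fun _ => hm) F fun r hr _ => hF r hr

/-- If Eloise follows a winning strategy, then the winning region is not left. -/
theorem eWin_of_hasWinningStrategy (h : G.HasWinningStrategy .eloise) : G.EWin G.init := by
  classical
  obtain ⟨f, hf, hwin⟩ := h
  by_contra hn
  -- Eloise plays `f`, and Abelard moves to a position outside the winning region. The fallback `p`
  -- is never needed outside the region unless `p` is a dead end.
  let next : List G.Pos → G.Pos → G.Pos := fun h p =>
    if G.turn p = .eloise then f h
    else if hq : ∃ q, G.move p q ∧ ¬ G.EWin q then hq.choose else p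
  let H : ℕ → List G.Pos × G.Pos := fun k =>
    Nat.rec ([], G.init) (fun _ x => (x.1 ++ [x.2], next (x.1 ++ [x.2]) x.2)) k
  let p : ℕ → G.Pos := fun k => (H k).2
  have hH : ∀ k, (H k).1 = (List.range k).map p := fun k => by
    induction k with
    | zero => rfl
    | succ k ih =>
      change (H k).1 ++ [(H k).2] = _
      rw [ih, List.range_succ, List.map_append]
      rfl
  have hpsucc : ∀ k, p (k + 1) = next ((List.range (k + 1)).map p) (p k) := fun k => by
    change next ((H k).1 ++ [(H k).2]) (H k).2 = _
    rw [hH, List.range_succ, List.map_append]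
    rfl
  have hwalk : ∀ k, (∀ i < k, G.move (p i) (p (i + 1))) →
      G.IsWalk ((List.range (k + 1)).map p) := fun k hk => by
    refine ⟨by simp [List.range_succ_eq_map]; rfl, ?_⟩
    rw [List.isChain_map, List.isChain_range]
    exact fun m hm => hk m (by omega)
  have key : ∀ k, (∀ i < k, ¬ G.IsDeadEnd (p i)) →
      (∀ i < k, G.move (p i) (p (i + 1))) ∧ ¬ G.EWin (p k) := fun k => by
    induction k with
    | zero => exact fun _ => ⟨by simp, hn⟩
    | succ k ih =>
      intro hk
      obtain ⟨h1, h2⟩ := ih fun i hi => hk i (by omega)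
      have hd := hk k (by omega)
      have : G.move (p k) (p (k + 1)) ∧ ¬ G.EWin (p (k + 1)) := by
        rw [hpsucc]
        by_cases ht : G.turn (p k) = .eloise
        · have hm : G.move (p k) (f ((List.range (k + 1)).map p)) := by
            have := hf ((List.range k).map p) (p k)
            rw [show (List.range k).map p ++ [p k] = (List.range (k + 1)).map p by
              simp [List.range_succ]] at this
            exact this (hwalk k h1) ht hd
          simp only [next, if_pos ht]
          exact ⟨hm, fun hw => h2 (.eloise ht hm hw)⟩
        · have hq : ∃ q, G.move (p k) q ∧ ¬ G.EWin q := by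
            by_contra hq
            push Not at hq
            obtain ⟨r, hr⟩ := not_forall_not.1 hd
            have ht' : G.turn (p k) = .abelard := by
              cases h : G.turn (p k) <;> simp_all
            exact h2 (.abelard ht' hr hq)
          simp only [next, if_neg ht, dif_pos hq]
          exact hq.choose_spec
      refine ⟨fun i hi => ?_, this.2⟩
      rcases Nat.lt_succ_iff_lt_or_eq.1 hi with hi | rfl
      · exact h1 i hi
      · exact this.1
  have hfol : ∀ k, G.turn (p k) = .eloise → p (k + 1) = f ((List.range (k + 1)).map p) :=
    fun k ht => by rw [hpsucc]; simp only [next, if_pos ht]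
  have hpre : ∀ (h : List G.Pos) (a b : G.Pos) (n : ℕ),
      h ++ [a, b] = (List.range n).map p → G.turn a = .eloise → b = f (h ++ [a]) := by
    intro h a b n hn ht
    have hlen : h.length + 2 = n := by simpa using congrArg List.length hn
    subst hlen
    rw [List.range_succ, List.range_succ] at hn
    simp only [List.map_append, List.map_cons, List.map_nil, List.append_assoc] at hn
    obtain ⟨h1, h2⟩ := List.append_inj hn (by simp)
    have h3 : a = p h.length ∧ b = p (h.length + 1) := by simpa using h2
    rw [h3.2, hfol _ (h3.1 ▸ ht)]
    conv_rhs => rw [h1, h3.1]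
    simp [List.range_succ]
  -- Up to its first dead end, `p` is a play in which `f` is followed. A dead end won by Eloise
  -- would lie in the region, and an infinite play is not won at all.
  by_cases hex : ∃ k, G.IsDeadEnd (p k)
  · have hk := Nat.find_spec hex
    have hmin := fun i hi => Nat.find_min hex (m := i) hi
    set k := Nat.find hex
    obtain ⟨h1, h2⟩ := key k hmin
    have hlast : ((List.range (k + 1)).map p).getLast? = some (p k) := by simp [List.range_succ]
    have hP : G.IsPlay (.finite ((List.range (k + 1)).map p)) := by
      refine ⟨hwalk k h1, fun q hq => ?_⟩
      rw [hlast] at hq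
      cases hq
      exact hk
    have hw := hwin _ hP fun h a b hpref ht => by
      have hpref : h ++ [a, b] <+: (List.range (k + 1)).map p := hpref
      refine hpre h a b (h ++ [a, b]).length ?_ ht
      rw [List.prefix_iff_eq_take, ← List.map_take, List.take_range] at hpref
      have hle : (h ++ [a, b]).length ≤ k + 1 := by
        have := congrArg List.length hpref
        simp only [List.length_map, List.length_range] at this
        omega
      rwa [min_eq_left hle] at hpref
    obtain ⟨q, hq, hwq⟩ := hw
    rw [hlast] at hq
    cases hq
    exact h2 (.dead hk hwq)
  · push Not at hex
    have hP : G.IsPlay (.infinite p) := ⟨rfl, fun n => (key (n + 1) fun i _ => hex i).1 n (by omega)⟩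
    exact hwin _ hP fun h a b hpref ht => hpre h a b _ hpref ht

theorem hasWinningStrategy_eloise_iff : G.HasWinningStrategy .eloise ↔ G.EWin G.init :=
  ⟨eWin_of_hasWinningStrategy, hasWinningStrategy_of_eWin⟩

end Game

end SCL

namespace SCL

variable {L : FirstOrder.Language.{u, v}}

/-! ### Evaluation with explicit label stacks -/

/-- The label symbols above an occurrence, from the closest one on, each with the formula in its
scope. -/
abbrev Stack (L : FirstOrder.Language.{u, v}) := List (ℕ × Formula L)

/-- The formula in the scope of the closest label symbol `l`, and the label symbols above it. -/
def Stack.ref (l : ℕ) : Stack L → Option (Formula L × Stack L)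
  | [] => none
  | (l', χ) :: st => if l' = l then some (χ, st) else Stack.ref l st

/-- The labels above an occurrence. -/
def Occ.stack {φ : Formula L} : {ψ : Formula L} → Occ φ ψ → Stack L
  | _, .root => []
  | _, .neg o => o.stack
  | _, .andLeft o => o.stack
  | _, .andRight o => o.stack
  | _, .orLeft o => o.stack
  | _, .orRight o => o.stack
  | _, .all o => o.stack
  | _, .ex o => o.stack
  | ψ, .label (l := l) o => (l, ψ) :: o.stack

/-- A jump depends on an occurrence only through its stack; hence positions need not mention the
ambient formula. -/
theorem Occ.ref_stack {φ : Formula L} (l : ℕ) {ψ : Formula L} (o : Occ φ ψ) :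
    Stack.ref l o.stack = (o.ref l).map fun r => (r.1, r.2.stack) := by
  induction o with
  | root => rfl
  | label o ih =>
    rename_i l' χ
    by_cases h : l' = l
    · subst h
      simp [Occ.stack, Occ.ref, Stack.ref]
    · simp [Occ.stack, Occ.ref, Stack.ref, h, ih]
  | _ o ih => simpa [Occ.stack, Occ.ref] using ih

/-- The sign of a Boolean. -/
def signOf : Bool → Sign
  | true => .plus
  | false => .minus

/-- The Boolean of a sign. -/
def Sign.toBool : Sign → Bool
  | .plus => true
  | .minus => false

@[simp] theorem signOf_toBool (σ : Sign) : signOf σ.toBool = σ := by cases σ <;> rfl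

@[simp] theorem toBool_flip (σ : Sign) : σ.flip.toBool = !σ.toBool := by cases σ <;> rfl

/-- Positions with explicit label stacks and a clock value. -/
structure SPos (L : FirstOrder.Language.{u, v}) (A : Type w) (C : Type) where
  sub : Formula L
  stack : Stack L
  assign : ℕ → A
  sign : Bool
  clock : C

/-- The moves between positions with label stacks; `J` relates the clock values before and after a
move from a claim symbol. -/
def SMove {A : Type w} {C : Type} (J : C → C → Prop) : SPos L A C → SPos L A C → Prop
  | ⟨.neg ψ, st, s, b, c⟩, q => q = ⟨ψ, st, s, !b, c⟩
  | ⟨.and ψ χ, st, s, b, c⟩, q => q = ⟨ψ, st, s, b, c⟩ ∨ q = ⟨χ, st, s, b, c⟩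
  | ⟨.or ψ χ, st, s, b, c⟩, q => q = ⟨ψ, st, s, b, c⟩ ∨ q = ⟨χ, st, s, b, c⟩
  | ⟨.all x ψ, st, s, b, c⟩, q => ∃ a, q = ⟨ψ, st, Function.update s x a, b, c⟩
  | ⟨.ex x ψ, st, s, b, c⟩, q => ∃ a, q = ⟨ψ, st, Function.update s x a, b, c⟩
  | ⟨.label l ψ, st, s, b, c⟩, q => q = ⟨ψ, (l, ψ) :: st, s, b, c⟩
  | ⟨.claim l, st, s, b, c⟩, q => ∃ χ st', Stack.ref l st = some (χ, st') ∧ ∃ c', J c c' ∧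
      q = ⟨.label l χ, st', s, b, c'⟩
  | ⟨_, _, _, _, _⟩, _ => False

/-- Eloise wins the evaluation from the given position. -/
def SWin {A : Type w} {C : Type} [L.Structure A] (J : C → C → Prop) : SPos L A C → Prop :=
  EWin (fun p => turnAt p.sub (signOf p.sign)) (SMove J)
    (fun p => winnerAt p.sub p.assign (signOf p.sign))

/-- The clock of the unbounded semantics. -/
def NoClock : Unit → Unit → Prop := fun _ _ => True

/-- The clock of the bounded semantics. -/
def Countdown : ℕ → ℕ → Prop := fun m n => m = n + 1

/-- The position of the evaluation game, with the labels above the occurrence. -/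
def EvalPos.toSPos {φ : Formula L} {A : Type w} {C : Type} (p : EvalPos φ A) (c : C) :
    SPos L A C := ⟨p.sub, p.occ.stack, p.assign, p.sign.toBool, c⟩

/-- Together with `exists_evalMove` this makes `EvalPos.toSPos` a bisimulation. The clock values are
left open so that both the unbounded and the clocked game are covered. -/
theorem EvalMove.sMove {φ : Formula L} {A : Type w} {p q : EvalPos φ A} (h : EvalMove p q)
    {C : Type} {J : C → C → Prop} {c c' : C}
    (h1 : (∀ l, p.sub ≠ .claim l) → c = c') (h2 : ∀ l, p.sub = .claim l → J c c') :
    SMove J (p.toSPos c) (q.toSPos c') := by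
  cases h with
  | claim o r s σ h =>
    refine ⟨_, r.stack, ?_, c', h2 _ rfl, rfl⟩
    change Stack.ref _ o.stack = _
    rw [Occ.ref_stack, h]
    rfl
  | neg =>
    obtain rfl := h1 (by simp)
    simp [EvalPos.toSPos, SMove, Occ.stack]
  | andLeft => obtain rfl := h1 (by simp); exact Or.inl rfl
  | andRight => obtain rfl := h1 (by simp); exact Or.inr rfl
  | orLeft => obtain rfl := h1 (by simp); exact Or.inl rfl
  | orRight => obtain rfl := h1 (by simp); exact Or.inr rfl
  | all _ _ _ a => obtain rfl := h1 (by simp); exact ⟨a, rfl⟩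
  | ex _ _ _ a => obtain rfl := h1 (by simp); exact ⟨a, rfl⟩
  | label => obtain rfl := h1 (by simp); exact rfl

theorem exists_evalMove {φ : Formula L} {A : Type w} {p : EvalPos φ A} {C : Type}
    {J : C → C → Prop} {c : C} {q' : SPos L A C} (h : SMove J (p.toSPos c) q') :
    ∃ q c', EvalMove p q ∧ q' = q.toSPos c' ∧ ((∀ l, p.sub ≠ .claim l) → c = c') ∧
      ∀ l, p.sub = .claim l → J c c' := by
  obtain ⟨ψ, o, s, σ⟩ := p
  cases ψ with
  | bot | eq | rel => exact h.elim
  | neg ψ =>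
    obtain rfl := h
    exact ⟨_, c, .neg o s σ, by simp [EvalPos.toSPos, Occ.stack], fun _ => rfl, by simp⟩
  | and ψ χ =>
    obtain rfl | rfl := h
    · exact ⟨_, c, .andLeft o s σ, rfl, fun _ => rfl, by simp⟩
    · exact ⟨_, c, .andRight o s σ, rfl, fun _ => rfl, by simp⟩
  | or ψ χ =>
    obtain rfl | rfl := h
    · exact ⟨_, c, .orLeft o s σ, rfl, fun _ => rfl, by simp⟩
    · exact ⟨_, c, .orRight o s σ, rfl, fun _ => rfl, by simp⟩
  | all x ψ =>
    obtain ⟨a, rfl⟩ := h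
    exact ⟨_, c, .all o s σ a, rfl, fun _ => rfl, by simp⟩
  | ex x ψ =>
    obtain ⟨a, rfl⟩ := h
    exact ⟨_, c, .ex o s σ a, rfl, fun _ => rfl, by simp⟩
  | label l ψ =>
    obtain rfl := h
    exact ⟨_, c, .label o s σ, rfl, fun _ => rfl, by simp⟩
  | claim l =>
    obtain ⟨χ, st', href, c', hJ, rfl⟩ := h
    change Stack.ref l o.stack = _ at href
    rw [Occ.ref_stack, Option.map_eq_some_iff] at href
    obtain ⟨⟨χ', r⟩, hr, he⟩ := href
    cases he
    exact ⟨_, c', .claim o r s σ hr, rfl, fun hn => absurd rfl (hn l), fun _ _ => hJ⟩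

theorem truth_iff {A : Type w} [L.Structure A] {s : ℕ → A} {φ : Formula L} :
    Truth A s φ ↔ SWin NoClock ⟨φ, [], s, true, ()⟩ := by
  have hmove : ∀ {p q : EvalPos φ A}, EvalMove p q → SMove NoClock (p.toSPos ()) (q.toSPos ()) :=
    fun h => h.sMove (fun _ => rfl) fun _ _ => trivial
  rw [Truth, Game.hasWinningStrategy_eloise_iff]
  constructor
  · refine fun h => EWin.sim (fun p p' => p' = p.toSPos ()) ?_ ?_ ?_ ?_ h _ rfl
    · rintro p _ rfl
      simp [evalGame, EvalPos.toSPos]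
    · rintro p _ rfl hd hw
      refine ⟨fun q' hq' => ?_, by simpa [evalGame, EvalPos.toSPos] using hw⟩
      obtain ⟨q, -, hq, -⟩ := exists_evalMove hq'
      exact hd q hq
    · rintro p _ rfl q hq
      exact ⟨_, hmove hq, rfl⟩
    · rintro p _ rfl - q' hq'
      obtain ⟨q, -, hq, rfl, -⟩ := exists_evalMove hq'
      exact ⟨q, hq, rfl⟩
  · refine fun h => EWin.sim (fun p' p => p' = p.toSPos ()) ?_ ?_ ?_ ?_ h _ rfl
    · rintro _ p rfl
      simp [evalGame, EvalPos.toSPos]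
    · rintro _ p rfl hd hw
      exact ⟨fun q hq => hd _ (hmove hq), by simpa [evalGame, EvalPos.toSPos] using hw⟩
    · rintro _ p rfl q' hq'
      obtain ⟨q, -, hq, rfl, -⟩ := exists_evalMove hq'
      exact ⟨q, hq, rfl⟩
    · rintro _ p rfl - q hq
      exact ⟨_, hmove hq, rfl⟩

/-- Eloise wins the bounded game if she wins all clocked games with large clock values. -/
theorem bndTruth_of_forall {A : Type w} [L.Structure A] {s : ℕ → A} {φ : Formula L} (N : ℕ)
    (h : ∀ n, N ≤ n → SWin Countdown ⟨φ, [], s, true, n⟩) : BndTruth A s φ := by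
  rw [BndTruth, Game.hasWinningStrategy_eloise_iff]
  refine .abelard rfl (.abelard 0) fun q hq => ?_
  obtain ⟨n'⟩ := hq
  refine .eloise rfl (.eloise n' (max n' N) (le_max_left _ _)) ?_
  have hmove : ∀ {p q : EvalPos φ A × ℕ}, ClockMove p q →
      SMove Countdown (p.1.toSPos p.2) (q.1.toSPos q.2) := by
    rintro _ _ (⟨m, hp, h⟩ | ⟨m, l, hp, h⟩)
    · exact h.sMove (fun _ => rfl) fun l hl => absurd hl (hp l)
    · exact h.sMove (fun hn => absurd hp (hn l)) fun _ _ => rfl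
  refine EWin.sim (fun p' p => ∃ q : EvalPos φ A × ℕ, p = .clock q ∧ p' = q.1.toSPos q.2)
    ?_ ?_ ?_ ?_ (h _ (le_max_right n' N)) _ ⟨_, rfl, rfl⟩
  · rintro _ _ ⟨q, rfl, rfl⟩
    simp [bndGame, EvalPos.toSPos]
  · rintro _ _ ⟨p, rfl, rfl⟩ hd hw
    refine ⟨?_, by simpa [bndGame, EvalPos.toSPos] using hw⟩
    intro q hq
    cases hq with
    | clock _ _ hq => exact hd _ (hmove hq)
  · rintro _ _ ⟨⟨p, n⟩, rfl, rfl⟩ q' hq'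
    obtain ⟨q, c', hq, rfl, h1, h2⟩ := exists_evalMove hq'
    refine ⟨.clock (q, c'), .clock _ _ ?_, _, rfl, rfl⟩
    by_cases hc : ∃ l, p.sub = .claim l
    · obtain ⟨l, hl⟩ := hc
      have : n = c' + 1 := h2 l hl
      exact this ▸ .jump c' l hl hq
    · have hc' : ∀ l, p.sub ≠ .claim l := fun l hl => hc ⟨l, hl⟩
      obtain rfl : n = c' := h1 hc'
      exact .step n hc' hq
  · rintro _ _ ⟨p, rfl, rfl⟩ - q hq
    cases hq with
    | clock _ q hq => exact ⟨_, hmove hq, q, rfl, rfl⟩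

/-- Truth in the bounded semantics implies truth in the unbounded semantics. -/
theorem BndTruth.truth {A : Type w} [L.Structure A] {s : ℕ → A} {φ : Formula L}
    (h : BndTruth A s φ) : Truth A s φ := by
  rw [BndTruth, Game.hasWinningStrategy_eloise_iff] at h
  rw [Truth, Game.hasWinningStrategy_eloise_iff]
  have hlast : ∀ n, (bndGame A s φ).EWin (.clock (⟨φ, .root, s, .plus⟩, n)) →
      (evalGame A s φ).EWin (evalGame A s φ).init := by
    intro n hn
    refine EWin.sim (fun p p' => ∃ n, p = .clock (p', n)) ?_ ?_ ?_ ?_ hn _ ⟨n, rfl⟩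
    · rintro _ p ⟨n, rfl⟩
      rfl
    · rintro _ p ⟨n, rfl⟩ hd hw
      refine ⟨fun q hq => ?_, hw⟩
      -- A claim at clock value 0 is dead in the clocked game only, but nobody wins there, so it is
      -- not the dead end at hand.
      by_cases hc : ∃ l, p.sub = .claim l
      · obtain ⟨l, hl⟩ := hc
        have hw : winnerAt p.sub p.assign p.sign = some .eloise := hw
        rw [hl] at hw
        simp [winnerAt] at hw
      · exact hd (.clock (q, n)) (.clock _ _ (.step n (fun l hl => hc ⟨l, hl⟩) hq))
    · rintro _ p ⟨n, rfl⟩ q hq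
      cases hq with
      | clock _ _ hq =>
        cases hq with
        | step _ _ h => exact ⟨_, h, _, rfl⟩
        | jump _ _ _ h => exact ⟨_, h, _, rfl⟩
    -- The existing move `hq0` shows that the clock has not run out at a claim, so every unclocked
    -- move can be copied.
    · rintro _ p ⟨n, rfl⟩ ⟨_, hq0⟩ q hq
      cases hq0 with
      | clock _ _ hq0 =>
        cases hq0 with
        | step _ hp h => exact ⟨.clock (q, n), .clock _ _ (.step n hp hq), n, rfl⟩
        | jump m l hp h => exact ⟨.clock (q, m), .clock _ _ (.jump m l hp hq), m, rfl⟩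
  cases h with
  | dead hd _ => exact absurd (BndMove.abelard 0) (hd _)
  | eloise ht => cases ht
  | abelard _ _ hq =>
    cases hq _ (.abelard 0) with
    | dead hd _ => exact absurd (BndMove.eloise 0 0 le_rfl) (hd _)
    | abelard ht => cases ht
    | eloise _ hm hq =>
      cases hm
      exact hlast _ hq

/-! ### The clauses of the semantics -/

section Clauses

variable {A : Type w} {C : Type} [L.Structure A] {J : C → C → Prop}

theorem sWin_iff {p : SPos L A C} : SWin J p ↔
    ((∀ q, ¬ SMove J p q) ∧ winnerAt p.sub p.assign (signOf p.sign) = some .eloise) ∨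
    (turnAt p.sub (signOf p.sign) = .eloise ∧ ∃ q, SMove J p q ∧ SWin J q) ∨
    (turnAt p.sub (signOf p.sign) = .abelard ∧ (∃ q, SMove J p q) ∧ ∀ q, SMove J p q → SWin J q) := by
  constructor
  · rintro (⟨hd, hw⟩ | ⟨ht, hm, hq⟩ | ⟨ht, hm, hq⟩)
    · exact .inl ⟨hd, hw⟩
    · exact .inr (.inl ⟨ht, _, hm, hq⟩)
    · exact .inr (.inr ⟨ht, ⟨_, hm⟩, hq⟩)
  · rintro (⟨hd, hw⟩ | ⟨ht, q, hm, hq⟩ | ⟨ht, ⟨q, hm⟩, hq⟩)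
    · exact .dead hd hw
    · exact .eloise ht hm hq
    · exact .abelard ht hm hq

variable {st : Stack L} {s : ℕ → A} {b : Bool} {c : C}

theorem sWin_bot : SWin J (L := L) ⟨.bot, st, s, b, c⟩ ↔ b = false := by
  rw [sWin_iff]; cases b <;> simp [SMove, winnerAt, atomWinner, signOf]

theorem sWin_eq {x y : ℕ} : SWin J (L := L) ⟨.eq x y, st, s, b, c⟩ ↔ (s x = s y ↔ b = true) := by
  rw [sWin_iff]
  cases b <;> by_cases h : s x = s y <;> simp [SMove, winnerAt, atomWinner, signOf, h]

theorem sWin_rel {k : ℕ} {R : L.Relations k} {t : Fin k → ℕ} :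
    SWin J ⟨.rel R t, st, s, b, c⟩ ↔
      (FirstOrder.Language.Structure.RelMap R (fun i => s (t i)) ↔ b = true) := by
  rw [sWin_iff]
  cases b <;> by_cases h : FirstOrder.Language.Structure.RelMap R (fun i => s (t i)) <;>
    simp [SMove, winnerAt, atomWinner, signOf, h]

theorem sWin_neg {ψ : Formula L} :
    SWin J ⟨.neg ψ, st, s, b, c⟩ ↔ SWin J ⟨ψ, st, s, !b, c⟩ := by
  rw [sWin_iff]; cases b <;> simp [SMove, winnerAt, turnAt]

theorem sWin_and {ψ χ : Formula L} : SWin J ⟨.and ψ χ, st, s, b, c⟩ ↔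
    if b then SWin J ⟨ψ, st, s, b, c⟩ ∧ SWin J ⟨χ, st, s, b, c⟩
    else SWin J ⟨ψ, st, s, b, c⟩ ∨ SWin J ⟨χ, st, s, b, c⟩ := by
  rw [sWin_iff]; cases b <;> simp [SMove, winnerAt, turnAt, signOf]

theorem sWin_or {ψ χ : Formula L} : SWin J ⟨.or ψ χ, st, s, b, c⟩ ↔
    if b then SWin J ⟨ψ, st, s, b, c⟩ ∨ SWin J ⟨χ, st, s, b, c⟩
    else SWin J ⟨ψ, st, s, b, c⟩ ∧ SWin J ⟨χ, st, s, b, c⟩ := by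
  rw [sWin_iff]; cases b <;> simp [SMove, winnerAt, turnAt, signOf]

/-- Over an empty domain the position would be a dead end won by nobody, and the universal clause
would fail. -/
theorem sWin_all [Nonempty A] {x : ℕ} {ψ : Formula L} : SWin J ⟨.all x ψ, st, s, b, c⟩ ↔
    if b then ∀ a, SWin J ⟨ψ, st, Function.update s x a, b, c⟩
    else ∃ a, SWin J ⟨ψ, st, Function.update s x a, b, c⟩ := by
  rw [sWin_iff]; cases b <;> simp [SMove, winnerAt, turnAt, signOf]

theorem sWin_ex [Nonempty A] {x : ℕ} {ψ : Formula L} : SWin J ⟨.ex x ψ, st, s, b, c⟩ ↔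
    if b then ∃ a, SWin J ⟨ψ, st, Function.update s x a, b, c⟩
    else ∀ a, SWin J ⟨ψ, st, Function.update s x a, b, c⟩ := by
  rw [sWin_iff]; cases b <;> simp [SMove, winnerAt, turnAt, signOf]

theorem sWin_label {l : ℕ} {ψ : Formula L} :
    SWin J ⟨.label l ψ, st, s, b, c⟩ ↔ SWin J ⟨ψ, (l, ψ) :: st, s, b, c⟩ := by
  rw [sWin_iff]; cases b <;> simp [SMove, winnerAt, turnAt]

theorem sWin_claim {l : ℕ} : SWin J ⟨.claim l, st, s, b, c⟩ ↔
    ∃ χ st', Stack.ref l st = some (χ, st') ∧ ∃ c', J c c' ∧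
      SWin J ⟨.label l χ, st', s, b, c'⟩ := by
  rw [sWin_iff]
  simp only [SMove, winnerAt, turnAt]
  constructor
  · rintro (⟨_, h⟩ | ⟨_, q, ⟨χ, st', h, c', hJ, rfl⟩, hq⟩ | ⟨h, _⟩)
    · simp at h
    · exact ⟨χ, st', h, c', hJ, hq⟩
    · cases h
  · rintro ⟨χ, st', h, c', hJ, hq⟩
    exact .inr (.inl ⟨trivial, _, ⟨χ, st', h, c', hJ, rfl⟩, hq⟩)

end Clauses

/-- Eloise profits from a larger clock value. -/
theorem SWin.mono_clock {A : Type w} [L.Structure A] {ψ : Formula L} {st : Stack L} {s : ℕ → A}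
    {b : Bool} {m n : ℕ} (hmn : m ≤ n) (h : SWin Countdown ⟨ψ, st, s, b, m⟩) :
    SWin Countdown ⟨ψ, st, s, b, n⟩ := by
  refine EWin.sim (fun p p' => ∃ n, p.clock ≤ n ∧ p' = ⟨p.sub, p.stack, p.assign, p.sign, n⟩)
    ?_ ?_ ?_ ?_ h _ ⟨n, hmn, rfl⟩
  · rintro p _ ⟨n, -, rfl⟩
    rfl
  · rintro ⟨ψ, st, s, b, m⟩ _ ⟨n, -, rfl⟩ hd hw
    refine ⟨fun q hq => ?_, hw⟩
    cases ψ with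
    | bot | eq | rel => exact hq
    | _ => simp [winnerAt] at hw
  · rintro ⟨ψ, st, s, b, m⟩ _ ⟨n, hle, rfl⟩ q hq
    cases ψ with
    | bot | eq | rel => exact hq.elim
    | neg | label => obtain rfl := hq; exact ⟨_, rfl, n, hle, rfl⟩
    | and | or =>
      obtain rfl | rfl := hq
      · exact ⟨_, .inl rfl, n, hle, rfl⟩
      · exact ⟨_, .inr rfl, n, hle, rfl⟩
    | all | ex => obtain ⟨a, rfl⟩ := hq; exact ⟨_, ⟨a, rfl⟩, n, hle, rfl⟩
    | claim l =>
      obtain ⟨χ, st', hr, c', hJ, rfl⟩ := hq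
      have hJ : m = c' + 1 := hJ
      have hle : m ≤ n := hle
      -- The subtraction is not truncated, as `n` is at least `m`, which is positive.
      exact ⟨_, ⟨χ, st', hr, n - 1, by change n = n - 1 + 1; omega, rfl⟩, n - 1,
        by change c' ≤ n - 1; omega, rfl⟩
  · rintro ⟨ψ, st, s, b, m⟩ _ ⟨n, hle, rfl⟩ hex q hq
    cases ψ with
    | bot | eq | rel => exact hq.elim
    | neg | label => obtain rfl := hq; exact ⟨_, rfl, n, hle, rfl⟩
    | and | or =>
      obtain rfl | rfl := hq
      · exact ⟨_, .inl rfl, n, hle, rfl⟩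
      · exact ⟨_, .inr rfl, n, hle, rfl⟩
    | all | ex => obtain ⟨a, rfl⟩ := hq; exact ⟨_, ⟨a, rfl⟩, n, hle, rfl⟩
    | claim l =>
      obtain ⟨χ, st', hr, c', hJ, rfl⟩ := hq
      -- The smaller clock must be positive for the jump to be matched; this is where the existence
      -- of some move on that side enters.
      obtain ⟨_, _, _, _, c0, hJ0, _⟩ := hex
      have hJ : n = c' + 1 := hJ
      have hJ0 : m = c0 + 1 := hJ0
      have hle : m ≤ n := hle
      exact ⟨_, ⟨χ, st', hr, c0, hJ0, rfl⟩, c', by change c0 ≤ c'; omega, rfl⟩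

/-! ### Approximants and the clocked semantics -/

/-- Let `B` give, for the label symbols of a regularised formula, the label symbol occurrences of
the original formula from which they stem. `Unf B n st ψ ψ'` says that `ψ'` is obtained from the
regularisation of the occurrence of `ψ` below the labels `st` by unfolding claim symbols at least
`n` times along each branch. -/
inductive Unf (B : ℕ → Option (ℕ × Formula L × Stack L)) :
    ℕ → Stack L → Formula L → Formula L → Prop where
  | bot (n : ℕ) (st : Stack L) : Unf B n st .bot .bot
  | eq (n : ℕ) (st : Stack L) (x y : ℕ) : Unf B n st (.eq x y) (.eq x y)
  | rel (n : ℕ) (st : Stack L) {k : ℕ} (R : L.Relations k) (t : Fin k → ℕ) :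
      Unf B n st (.rel R t) (.rel R t)
  | neg {n : ℕ} {st : Stack L} {ψ ψ' : Formula L} (h : Unf B n st ψ ψ') :
      Unf B n st (.neg ψ) (.neg ψ')
  | and {n : ℕ} {st : Stack L} {ψ ψ' χ χ' : Formula L} (h₁ : Unf B n st ψ ψ')
      (h₂ : Unf B n st χ χ') : Unf B n st (.and ψ χ) (.and ψ' χ')
  | or {n : ℕ} {st : Stack L} {ψ ψ' χ χ' : Formula L} (h₁ : Unf B n st ψ ψ')
      (h₂ : Unf B n st χ χ') : Unf B n st (.or ψ χ) (.or ψ' χ')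
  | all {n : ℕ} {st : Stack L} {ψ ψ' : Formula L} (x : ℕ) (h : Unf B n st ψ ψ') :
      Unf B n st (.all x ψ) (.all x ψ')
  | ex {n : ℕ} {st : Stack L} {ψ ψ' : Formula L} (x : ℕ) (h : Unf B n st ψ ψ') :
      Unf B n st (.ex x ψ) (.ex x ψ')
  | label {n l l' : ℕ} {st : Stack L} {χ χ' : Formula L} (hB : B l' = some (l, χ, st))
      (h : Unf B n ((l, χ) :: st) χ χ') : Unf B n st (.label l χ) (.label l' χ')
  | stay {n l l' : ℕ} {st : Stack L} (hB : B l' = (st.ref l).map fun r => (l, r))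
      (h : n = 0 ∨ st.ref l = none) : Unf B n st (.claim l) (.claim l')
  | unfold {n l l' : ℕ} {st st' : Stack L} {χ χ' : Formula L} (hr : st.ref l = some (χ, st'))
      (hB : B l' = some (l, χ, st')) (h : Unf B (n - 1) ((l, χ) :: st') χ χ') :
      Unf B n st (.claim l) (.label l' χ')

variable {B : ℕ → Option (ℕ × Formula L × Stack L)}

theorem Unf.mono {n : ℕ} {st : Stack L} {ψ ψ' : Formula L} (h : Unf B n st ψ ψ') :
    ∀ {m : ℕ}, m ≤ n → Unf B m st ψ ψ' := by
  induction h with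
  | bot | eq | rel => intros; constructor
  | neg _ ih => exact fun hm => .neg (ih hm)
  | and _ _ ih₁ ih₂ => exact fun hm => .and (ih₁ hm) (ih₂ hm)
  | or _ _ ih₁ ih₂ => exact fun hm => .or (ih₁ hm) (ih₂ hm)
  | all x _ ih => exact fun hm => .all x (ih hm)
  | ex x _ ih => exact fun hm => .ex x (ih hm)
  | label hB _ ih => exact fun hm => .label hB (ih hm)
  | stay hB h => exact fun hm => .stay hB (h.imp_left fun h => by omega)
  | unfold hr hB _ ih => exact fun hm => .unfold hr hB (ih (by omega))

/-- Replacing all claim symbols by their reference formulas is a further unfolding. -/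
theorem Unf.replaceClaims {n : ℕ} {st : Stack L} {ψ ψ' : Formula L} (h : Unf B n st ψ ψ') :
    ∀ ρ : ℕ → Option (Formula L),
      (∀ l' ∈ ψ'.freeClaims, (B l' = none ∧ ρ l' = none) ∨
        ∃ l χ st' χ', B l' = some (l, χ, st') ∧ ρ l' = some (.label l' χ') ∧
          Unf B n ((l, χ) :: st') χ χ') →
      Unf B (n + 1) st ψ (ψ'.replaceClaims ρ) := by
  induction h with
  | bot | eq | rel => intros; constructor
  | neg _ ih => exact fun ρ hρ => .neg (ih ρ hρ)
  | and _ _ ih₁ ih₂ =>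
    exact fun ρ hρ => .and (ih₁ ρ fun l hl => hρ l (Finset.mem_union_left _ hl))
      (ih₂ ρ fun l hl => hρ l (Finset.mem_union_right _ hl))
  | or _ _ ih₁ ih₂ =>
    exact fun ρ hρ => .or (ih₁ ρ fun l hl => hρ l (Finset.mem_union_left _ hl))
      (ih₂ ρ fun l hl => hρ l (Finset.mem_union_right _ hl))
  | all x _ ih => exact fun ρ hρ => .all x (ih ρ hρ)
  | ex x _ ih => exact fun ρ hρ => .ex x (ih ρ hρ)
  | @label n l l' st χ χ' hB h ih =>
    refine fun ρ hρ => .label hB (ih _ fun l'' hl'' => ?_)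
    by_cases he : l'' = l'
    · subst he
      exact .inr ⟨l, χ, st, χ', hB, by simp, h⟩
    · rw [Function.update_of_ne he]
      exact hρ l'' (Finset.mem_erase.2 ⟨he, hl''⟩)
  | @stay n l l' st hB h =>
    intro ρ hρ
    rcases hρ l' (Finset.mem_singleton_self _) with ⟨h1, h2⟩ | ⟨l₀, χ, st', χ', h1, h2, h3⟩
    · rw [Formula.replaceClaims, h2]
      exact .stay hB (.inr (by simpa [h1] using hB.symm))
    -- The claim is bound, so it can have stayed only because no unfolding was required so far, and
    -- the jump made now is the first one.
    · rw [h1] at hB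
      obtain ⟨⟨_, _⟩, hr, he⟩ := Option.map_eq_some_iff.1 hB.symm
      cases he
      obtain rfl : n = 0 := h.resolve_right (by simp [hr])
      rw [Formula.replaceClaims, h2]
      exact .unfold hr h1 h3
  | @unfold n l l' st st' χ χ' hr hB h ih =>
    intro ρ hρ
    -- Below a former claim only `n - 1` unfoldings are guaranteed; the available reference formulas
    -- have `n`, which is more than needed.
    refine .unfold hr hB ((ih _ fun l'' hl'' => ?_).mono (by omega))
    by_cases he : l'' = l'
    · subst he
      exact .inr ⟨l, χ, st', χ', hB, by simp, h⟩
    · rw [Function.update_of_ne he]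
      refine (hρ l'' (Finset.mem_erase.2 ⟨he, hl''⟩)).imp_right ?_
      rintro ⟨l₀, χ₀, st₀, χ₀', h1, h2, h3⟩
      exact ⟨l₀, χ₀, st₀, χ₀', h1, h2, h3.mono (by omega)⟩

/-- The property `P` has to be arbitrary for the induction: under a label `k` it is weakened to
"equal to `k`, or `P`". The use is that unfolding creates no new free claims. -/
theorem Formula.freeClaims_replaceClaims (ψ : Formula L) :
    ∀ (ρ : ℕ → Option (Formula L)) (P : ℕ → Prop), (∀ l ∈ ψ.freeClaims, P l) →
      (∀ l ∈ ψ.freeClaims, ∀ χ, ρ l = some χ → ∀ l' ∈ χ.freeClaims, P l') →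
      ∀ l ∈ (ψ.replaceClaims ρ).freeClaims, P l := by
  induction ψ with
  | bot | eq | rel => intro ρ P _ _ l hl; simp [replaceClaims, freeClaims] at hl
  | neg ψ ih | all _ ψ ih | ex _ ψ ih => exact ih
  | and ψ χ ih₁ ih₂ | or ψ χ ih₁ ih₂ =>
    intro ρ P h1 h2 l hl
    rcases Finset.mem_union.1 hl with hl | hl
    · exact ih₁ ρ P (fun l hl => h1 l (Finset.mem_union_left _ hl))
        (fun l hl => h2 l (Finset.mem_union_left _ hl)) l hl
    · exact ih₂ ρ P (fun l hl => h1 l (Finset.mem_union_right _ hl))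
        (fun l hl => h2 l (Finset.mem_union_right _ hl)) l hl
  | label k ψ ih =>
    intro ρ P h1 h2 l hl
    obtain ⟨hlk, hl⟩ := Finset.mem_erase.1 hl
    refine (ih _ (fun l => l = k ∨ P l) (fun l hl => ?_) (fun l hl χ hχ l' hl' => ?_) l
      hl).resolve_left hlk
    · by_cases he : l = k
      · exact .inl he
      · exact .inr (h1 l (Finset.mem_erase.2 ⟨he, hl⟩))
    · by_cases he : l = k
      · subst he
        rw [Function.update_self] at hχ
        cases hχ
        exact .inr (h1 l' hl')
      · rw [Function.update_of_ne he] at hχ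
        exact .inr (h2 l (Finset.mem_erase.2 ⟨he, hl⟩) χ hχ l' hl')
  | claim k =>
    intro ρ P h1 h2 l hl
    cases hk : ρ k with
    | none =>
      simp only [replaceClaims, hk, Option.getD_none] at hl
      exact h1 l hl
    | some χ =>
      simp only [replaceClaims, hk, Option.getD_some] at hl
      exact h2 k (Finset.mem_singleton_self _) χ hk l hl

/-! ### Label occurrences and the origin of regularised labels -/

/-- The label symbol occurrences from left to right, each with the formula in its scope and the
labels above it. -/
def Formula.labelOccs : Formula L → Stack L → List (ℕ × Formula L × Stack L)
  | bot, _ => []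
  | eq _ _, _ => []
  | rel _ _, _ => []
  | neg ψ, st => ψ.labelOccs st
  | and ψ χ, st => ψ.labelOccs st ++ χ.labelOccs st
  | or ψ χ, st => ψ.labelOccs st ++ χ.labelOccs st
  | all _ ψ, st => ψ.labelOccs st
  | ex _ ψ, st => ψ.labelOccs st
  | label l ψ, st => (l, ψ, st) :: ψ.labelOccs ((l, ψ) :: st)
  | claim _, _ => []

theorem Formula.map_labelOccs (ψ : Formula L) :
    ∀ st, (ψ.labelOccs st).map Prod.fst = ψ.labels := by
  induction ψ with
  | label l ψ ih => intro st; simp [labelOccs, labels, ih]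
  | _ => simp_all [labelOccs, labels]

theorem Formula.rename_snd (ψ : Formula L) :
    ∀ (ρ : ℕ → ℕ) (n : ℕ) (st : Stack L), (ψ.rename ρ n).2 = n + (ψ.labelOccs st).length := by
  induction ψ with
  | and ψ χ ih₁ ih₂ | or ψ χ ih₁ ih₂ =>
    intro ρ n st
    simp only [rename, labelOccs, List.length_append]
    rw [ih₂ _ _ st, ih₁ _ _ st, Nat.add_assoc]
  | label l ψ ih =>
    intro ρ n st
    simp only [rename, labelOccs, List.length_cons]
    rw [ih _ _ ((l, ψ) :: st)]
    omega
  | neg ψ ih | all _ ψ ih | ex _ ψ ih => exact ih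
  | _ => intros; rfl

/-- Renaming numbers the label occurrences consecutively from `n`, in the order of
`Formula.labelOccs`, so `B` can be read off from the position in that list. -/
theorem Formula.unf_rename (ψ : Formula L) : ∀ (ρ : ℕ → ℕ) (n : ℕ) (st : Stack L),
    (∀ i e, (ψ.labelOccs st)[i]? = some e → B (n + i) = some e) →
    (∀ l ∈ ψ.freeClaims, B (ρ l) = (st.ref l).map fun r => (l, r)) →
    Unf B 0 st ψ (ψ.rename ρ n).1 := by
  have happ : ∀ (l₁ l₂ : List (ℕ × Formula L × Stack L)) (n : ℕ),
      (∀ i e, (l₁ ++ l₂)[i]? = some e → B (n + i) = some e) →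
      (∀ i e, l₁[i]? = some e → B (n + i) = some e) ∧
      (∀ i e, l₂[i]? = some e → B (n + l₁.length + i) = some e) := by
    refine fun l₁ l₂ n h => ⟨fun i e he => h i e ?_, fun i e he => ?_⟩
    · rw [List.getElem?_append_left (List.getElem?_eq_some_iff.1 he).1, he]
    · rw [Nat.add_assoc]
      refine h _ e ?_
      rw [List.getElem?_append_right (by omega), Nat.add_sub_cancel_left, he]
  induction ψ with
  | bot | eq | rel => intros; constructor
  | neg ψ ih => exact fun ρ n st h1 h2 => .neg (ih ρ n st h1 h2)
  | all x ψ ih => exact fun ρ n st h1 h2 => .all x (ih ρ n st h1 h2)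
  | ex x ψ ih => exact fun ρ n st h1 h2 => .ex x (ih ρ n st h1 h2)
  | and ψ χ ih₁ ih₂ =>
    intro ρ n st h1 h2
    obtain ⟨h3, h4⟩ := happ _ _ n h1
    refine .and (ih₁ ρ n st h3 fun l hl => h2 l (Finset.mem_union_left _ hl))
      (ih₂ ρ _ st ?_ fun l hl => h2 l (Finset.mem_union_right _ hl))
    rwa [ψ.rename_snd ρ n st]
  | or ψ χ ih₁ ih₂ =>
    intro ρ n st h1 h2
    obtain ⟨h3, h4⟩ := happ _ _ n h1
    refine .or (ih₁ ρ n st h3 fun l hl => h2 l (Finset.mem_union_left _ hl))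
      (ih₂ ρ _ st ?_ fun l hl => h2 l (Finset.mem_union_right _ hl))
    rwa [ψ.rename_snd ρ n st]
  | label l ψ ih =>
    intro ρ n st h1 h2
    have h0 : B n = some (l, ψ, st) := h1 0 _ rfl
    refine .label h0 (ih _ _ _ (fun i e he => ?_) fun l' hl' => ?_)
    · have := h1 (i + 1) e he
      rwa [show n + 1 + i = n + (i + 1) by omega]
    · by_cases he : l' = l
      · subst he
        simp [Stack.ref, h0]
      · rw [Function.update_of_ne he, h2 l' (Finset.mem_erase.2 ⟨he, hl'⟩)]
        simp [Stack.ref, Ne.symm he]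
  | claim l => exact fun ρ n st _ h2 => .stay (h2 l (Finset.mem_singleton_self _)) (.inl rfl)

theorem Formula.freeClaims_rename (ψ : Formula L) : ∀ (ρ : ℕ → ℕ) (n : ℕ),
    ∀ l' ∈ (ψ.rename ρ n).1.freeClaims, ∃ l ∈ ψ.freeClaims, l' = ρ l := by
  induction ψ with
  | bot | eq | rel => intro ρ n l hl; simp [rename, freeClaims] at hl
  | neg ψ ih | all _ ψ ih | ex _ ψ ih => exact ih
  | and ψ χ ih₁ ih₂ | or ψ χ ih₁ ih₂ =>
    intro ρ n l' hl'
    rcases Finset.mem_union.1 hl' with hl' | hl'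
    · obtain ⟨l, hl, he⟩ := ih₁ _ _ l' hl'
      exact ⟨l, Finset.mem_union_left _ hl, he⟩
    · obtain ⟨l, hl, he⟩ := ih₂ _ _ l' hl'
      exact ⟨l, Finset.mem_union_right _ hl, he⟩
  | label k ψ ih =>
    intro ρ n l' hl'
    obtain ⟨hn, hl'⟩ := Finset.mem_erase.1 hl'
    obtain ⟨l, hl, he⟩ := ih _ _ l' hl'
    by_cases hk : l = k
    · subst hk
      rw [Function.update_self] at he
      exact absurd he hn
    · rw [Function.update_of_ne hk] at he
      exact ⟨l, Finset.mem_erase.2 ⟨hk, hl⟩, he⟩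
  | claim k =>
    intro ρ n l' hl'
    exact ⟨k, Finset.mem_singleton_self _, Finset.mem_singleton.1 hl'⟩

theorem Formula.lt_bound_of_mem_freeClaims (ψ : Formula L) : ∀ l ∈ ψ.freeClaims, l < ψ.bound := by
  induction ψ with
  | bot | eq | rel => intro l hl; simp [freeClaims] at hl
  | neg ψ ih | all _ ψ ih | ex _ ψ ih => exact ih
  | and ψ χ ih₁ ih₂ | or ψ χ ih₁ ih₂ =>
    intro l hl
    rcases Finset.mem_union.1 hl with hl | hl
    · exact lt_max_of_lt_left (ih₁ l hl)
    · exact lt_max_of_lt_right (ih₂ l hl)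
  | label k ψ ih => exact fun l hl => lt_max_of_lt_right (ih l (Finset.mem_erase.1 hl).2)
  | claim k =>
    intro l hl
    rw [Finset.mem_singleton.1 hl]
    exact Nat.lt_succ_self k

theorem Formula.unf_self (ψ : Formula L) : ∀ st : Stack L,
    (∀ e ∈ ψ.labelOccs st, B e.1 = some e) →
    (∀ l ∈ ψ.freeClaims, B l = (st.ref l).map fun r => (l, r)) → Unf B 0 st ψ ψ := by
  induction ψ with
  | bot | eq | rel => intros; constructor
  | neg ψ ih => exact fun st h1 h2 => .neg (ih st h1 h2)
  | all x ψ ih => exact fun st h1 h2 => .all x (ih st h1 h2)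
  | ex x ψ ih => exact fun st h1 h2 => .ex x (ih st h1 h2)
  | and ψ χ ih₁ ih₂ =>
    exact fun st h1 h2 => .and
      (ih₁ st (fun e he => h1 e (List.mem_append_left _ he))
        fun l hl => h2 l (Finset.mem_union_left _ hl))
      (ih₂ st (fun e he => h1 e (List.mem_append_right _ he))
        fun l hl => h2 l (Finset.mem_union_right _ hl))
  | or ψ χ ih₁ ih₂ =>
    exact fun st h1 h2 => .or
      (ih₁ st (fun e he => h1 e (List.mem_append_left _ he))
        fun l hl => h2 l (Finset.mem_union_left _ hl))
      (ih₂ st (fun e he => h1 e (List.mem_append_right _ he))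
        fun l hl => h2 l (Finset.mem_union_right _ hl))
  | label l ψ ih =>
    intro st h1 h2
    have h0 : B l = some (l, ψ, st) := h1 _ List.mem_cons_self
    refine .label h0 (ih _ (fun e he => h1 e (List.mem_cons_of_mem _ he)) fun l' hl' => ?_)
    by_cases he : l' = l
    · subst he
      simp [Stack.ref, h0]
    · rw [h2 l' (Finset.mem_erase.2 ⟨he, hl'⟩)]
      simp [Stack.ref, Ne.symm he]
  | claim l => exact fun st _ h2 => .stay (h2 l (Finset.mem_singleton_self _)) (.inl rfl)

/-- In a regular formula the name of a label determines its occurrence. Otherwise the fresh names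
start at `φ.bound`, above all free claims, so that the latter get no origin. -/
theorem exists_unf_regularise (φ : Formula L) :
    ∃ B : ℕ → Option (ℕ × Formula L × Stack L), Unf B 0 [] φ φ.regularise ∧
      ∀ l ∈ φ.regularise.freeClaims, B l = none := by
  classical
  by_cases hreg : φ.IsRegular
  · rw [Formula.regularise, if_pos hreg]
    let B : ℕ → Option (ℕ × Formula L × Stack L) := fun l =>
      if h : ∃ e ∈ φ.labelOccs [], e.1 = l then some h.choose else none
    have hmap := φ.map_labelOccs []
    have hB : ∀ e ∈ φ.labelOccs [], B e.1 = some e := by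
      intro e he
      have hex : ∃ e' ∈ φ.labelOccs [], e'.1 = e.1 := ⟨e, he, rfl⟩
      have hsp := hex.choose_spec
      simp only [B, dif_pos hex]
      exact congrArg some (List.inj_on_of_nodup_map (f := Prod.fst) (hmap ▸ hreg.1) hsp.1 he hsp.2)
    have hn : ∀ l ∈ φ.freeClaims, B l = none := by
      intro l hl
      simp only [B]
      rw [dif_neg]
      rintro ⟨e, he, rfl⟩
      refine hreg.2 _ hl ?_
      rw [← hmap]
      exact List.mem_map_of_mem he
    exact ⟨B, φ.unf_self [] hB fun l hl => hn l hl, hn⟩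
  · rw [Formula.regularise, if_neg hreg]
    let B : ℕ → Option (ℕ × Formula L × Stack L) := fun l =>
      if l < φ.bound then none else (φ.labelOccs [])[l - φ.bound]?
    have hn : ∀ l ∈ φ.freeClaims, B l = none := fun l hl =>
      if_pos (φ.lt_bound_of_mem_freeClaims l hl)
    refine ⟨B, φ.unf_rename id _ [] (fun i e he => ?_) fun l hl => hn l hl, fun l hl => ?_⟩
    · simp only [B]
      rw [if_neg (by omega), Nat.add_sub_cancel_left, he]
    · obtain ⟨l, hl', rfl⟩ := φ.freeClaims_rename _ _ l hl
      exact hn l hl'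

/-- Unfolding duplicates label symbols, but all copies of a name stem from the same original
occurrence; hence one `B` serves every `n`. The induction also carries that free claims have no
origin, since nothing is substituted for them at the top. -/
theorem exists_unf_unfolding (φ : Formula L) :
    ∃ B : ℕ → Option (ℕ × Formula L × Stack L), ∀ n, Unf B n [] φ (φ.unfolding n) := by
  obtain ⟨B, h1, h2⟩ := exists_unf_regularise φ
  have : ∀ n, Unf B n [] φ (φ.unfolding n) ∧ ∀ l ∈ (φ.unfolding n).freeClaims, B l = none := by
    intro n
    induction n with
    | zero => exact ⟨h1, h2⟩
    | succ n ih =>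
      exact ⟨ih.1.replaceClaims _ fun l hl => .inl ⟨ih.2 l hl, rfl⟩,
        Formula.freeClaims_replaceClaims _ _ _ ih.2 (by simp)⟩
  exact ⟨B, fun n => (this n).1⟩

/-! ### Approximants against the clocked and the unbounded game -/

section Realize

variable {A : Type w} [Nonempty A] [L.Structure A]

/-- Each unfolded claim pays for one tick of the clock, so Eloise's clocked win never reaches a
claim that has been replaced by a constant. -/
theorem Unf.realize {n : ℕ} {st : Stack L} {ψ ψ' : Formula L} (h : Unf B n st ψ ψ') :
    ∀ (s : ℕ → A) (b : Bool), SWin Countdown ⟨ψ, st, s, b, n⟩ →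
      ((ψ'.toFO b).Realize s ↔ b = true) := by
  induction h with
  | bot => intro s b; rw [sWin_bot]; cases b <;> simp [Formula.toFO]
  | eq =>
    intro s b
    rw [sWin_eq]
    cases b <;> simp [Formula.toFO, FirstOrder.Language.Formula.realize_equal]
  | rel =>
    intro s b
    rw [sWin_rel]
    cases b <;> simp [Formula.toFO, FirstOrder.Language.Formula.realize_rel]
  | neg _ ih =>
    intro s b hw
    have := ih s _ (sWin_neg.1 hw)
    cases b <;> simpa [Formula.toFO] using this
  | and _ _ ih₁ ih₂ =>
    intro s b hw
    rw [sWin_and] at hw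
    specialize ih₁ s b
    specialize ih₂ s b
    cases b <;> simp_all [Formula.toFO]
    tauto
  | or _ _ ih₁ ih₂ =>
    intro s b hw
    rw [sWin_or] at hw
    specialize ih₁ s b
    specialize ih₂ s b
    cases b <;> simp_all [Formula.toFO]
    tauto
  | all x _ ih =>
    intro s b hw
    rw [sWin_all] at hw
    have h := fun a => ih (Function.update s x a) b
    cases b
    · obtain ⟨a, ha⟩ := hw
      simpa [Formula.toFO, realize_allVar] using ⟨a, by simpa using h a ha⟩
    · simpa [Formula.toFO, realize_allVar] using fun a => by simpa using h a (hw a)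
  | ex x _ ih =>
    intro s b hw
    rw [sWin_ex] at hw
    have h := fun a => ih (Function.update s x a) b
    cases b
    · simpa [Formula.toFO, realize_exVar] using fun a => by simpa using h a (hw a)
    · obtain ⟨a, ha⟩ := hw
      simpa [Formula.toFO, realize_exVar] using ⟨a, by simpa using h a ha⟩
  | label hB _ ih => exact fun s b hw => ih s b (sWin_label.1 hw)
  | stay hB h =>
    intro s b hw
    obtain ⟨χ, st', hr, c', hJ, -⟩ := sWin_claim.1 hw
    -- A claim left in place is either reached with an exhausted clock or free; Eloise wins in
    -- neither case.
    rcases h with rfl | h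
    · cases hJ
    · simp [hr] at h
  | @unfold n l l' st st' χ χ' hr hB _ ih =>
    intro s b hw
    obtain ⟨χ₁, st₁, hr', c', hJ, hw⟩ := sWin_claim.1 hw
    rw [hr] at hr'
    cases hr'
    have hJ : n = c' + 1 := hJ
    exact ih s b (SWin.mono_clock (by omega) (sWin_label.1 hw))

/-- Positive claims become `⊥` and negative ones `⊤`, so a claim left in place never has the truth
value that favours Eloise. All other steps copy into the game, with an unfolded claim read as a
jump. -/
theorem Unf.sWin {n : ℕ} {st : Stack L} {ψ ψ' : Formula L} (h : Unf B n st ψ ψ') :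
    ∀ (s : ℕ → A) (b : Bool), ((ψ'.toFO b).Realize s ↔ b = true) →
      SWin NoClock ⟨ψ, st, s, b, ()⟩ := by
  induction h with
  | bot => intro s b; rw [sWin_bot]; cases b <;> simp [Formula.toFO]
  | eq =>
    intro s b
    rw [sWin_eq]
    cases b <;> simp [Formula.toFO, FirstOrder.Language.Formula.realize_equal]
  | rel =>
    intro s b
    rw [sWin_rel]
    cases b <;> simp [Formula.toFO, FirstOrder.Language.Formula.realize_rel]
  | neg _ ih =>
    intro s b hw
    refine sWin_neg.2 (ih s _ ?_)
    cases b <;> simpa [Formula.toFO] using hw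
  | and _ _ ih₁ ih₂ =>
    intro s b hw
    rw [sWin_and]
    specialize ih₁ s b
    specialize ih₂ s b
    cases b <;> simp_all [Formula.toFO]
    tauto
  | or _ _ ih₁ ih₂ =>
    intro s b hw
    rw [sWin_or]
    specialize ih₁ s b
    specialize ih₂ s b
    cases b <;> simp_all [Formula.toFO]
    tauto
  | all x _ ih =>
    intro s b hw
    rw [sWin_all]
    have h := fun a => ih (Function.update s x a) b
    cases b
    · simp only [Formula.toFO, realize_allVar, Bool.false_eq_true, iff_false, not_forall] at hw
      obtain ⟨a, ha⟩ := hw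
      exact ⟨a, h a (by simpa using ha)⟩
    · simp only [Formula.toFO, realize_allVar, iff_true] at hw
      exact fun a => h a (by simpa using hw a)
  | ex x _ ih =>
    intro s b hw
    rw [sWin_ex]
    have h := fun a => ih (Function.update s x a) b
    cases b
    · simp only [Formula.toFO, realize_exVar, Bool.false_eq_true, iff_false, not_exists] at hw
      exact fun a => h a (by simpa using hw a)
    · simp only [Formula.toFO, realize_exVar, iff_true] at hw
      obtain ⟨a, ha⟩ := hw
      exact ⟨a, h a (by simpa using ha)⟩
  | label hB _ ih => exact fun s b hw => sWin_label.2 (ih s b hw)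
  | stay hB h => intro s b hw; cases b <;> simp [Formula.toFO] at hw
  | unfold hr hB _ ih =>
    exact fun s b hw => sWin_claim.2 ⟨_, _, hr, (), trivial, sWin_label.2 (ih s b hw)⟩

theorem realize_approximant {φ : Formula L} {s : ℕ → A} {n : ℕ}
    (h : SWin Countdown ⟨φ, [], s, true, n⟩) : (approximant φ n).Realize s := by
  obtain ⟨B, hB⟩ := exists_unf_unfolding φ
  exact ((hB n).realize s true h).2 rfl

theorem truth_of_realize_approximant {φ : Formula L} {s : ℕ → A} {n : ℕ}
    (h : (approximant φ n).Realize s) : Truth A s φ := by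
  obtain ⟨B, hB⟩ := exists_unf_unfolding φ
  exact truth_iff.2 ((hB n).sWin s true ⟨fun _ => rfl, fun _ => h⟩)

end Realize

/-! ### Universal closures -/

/-- All variables of the formula, free or bound, are below `N`. -/
def Formula.VarsLT (N : ℕ) : Formula L → Prop
  | bot => True
  | eq x y => x < N ∧ y < N
  | rel _ t => ∀ i, t i < N
  | neg φ => φ.VarsLT N
  | and φ ψ => φ.VarsLT N ∧ ψ.VarsLT N
  | or φ ψ => φ.VarsLT N ∧ ψ.VarsLT N
  | all x φ => x < N ∧ φ.VarsLT N
  | ex x φ => x < N ∧ φ.VarsLT N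
  | label _ φ => φ.VarsLT N
  | claim _ => True

theorem Formula.VarsLT.mono {M N : ℕ} (h : M ≤ N) : ∀ {φ : Formula L}, φ.VarsLT M → φ.VarsLT N
  | bot, _ => trivial
  | eq _ _, hφ => ⟨hφ.1.trans_le h, hφ.2.trans_le h⟩
  | rel _ _, hφ => fun i => (hφ i).trans_le h
  | neg φ, hφ => VarsLT.mono (φ := φ) h hφ
  | and _ _, hφ => ⟨hφ.1.mono h, hφ.2.mono h⟩
  | or _ _, hφ => ⟨hφ.1.mono h, hφ.2.mono h⟩
  | all _ _, hφ => ⟨hφ.1.trans_le h, hφ.2.mono h⟩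
  | ex _ _, hφ => ⟨hφ.1.trans_le h, hφ.2.mono h⟩
  | label _ φ, hφ => VarsLT.mono (φ := φ) h hφ
  | claim _, _ => trivial

theorem Formula.exists_varsLT (φ : Formula L) : ∃ N, φ.VarsLT N := by
  induction φ with
  | bot | claim => exact ⟨0, trivial⟩
  | eq x y => exact ⟨x + y + 1, by simp only [VarsLT]; omega⟩
  | rel R t =>
    exact ⟨(Finset.univ.sup t) + 1, fun i => Nat.lt_succ_of_le (Finset.le_sup (Finset.mem_univ i))⟩
  | neg φ ih | label _ φ ih => exact ih
  | and φ ψ ih₁ ih₂ | or φ ψ ih₁ ih₂ =>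
    obtain ⟨M, hM⟩ := ih₁
    obtain ⟨N, hN⟩ := ih₂
    exact ⟨max M N, hM.mono (le_max_left _ _), hN.mono (le_max_right _ _)⟩
  | all x φ ih | ex x φ ih =>
    obtain ⟨N, hN⟩ := ih
    exact ⟨max (x + 1) N, lt_max_of_lt_left x.lt_succ_self, hN.mono (le_max_right _ _)⟩

theorem Stack.mem_of_ref {l : ℕ} {χ : Formula L} {st' : Stack L} :
    ∀ {st : Stack L}, st.ref l = some (χ, st') → (l, χ) ∈ st ∧ st' ⊆ st
  | [], h => by simp [Stack.ref] at h
  | (l', ψ) :: st, h => by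
    by_cases he : l' = l
    · simp only [Stack.ref, if_pos he, Option.some.injEq, Prod.mk.injEq] at h
      obtain ⟨rfl, rfl⟩ := h
      exact ⟨he ▸ List.mem_cons_self, List.subset_cons_self _ _⟩
    · simp only [Stack.ref, if_neg he] at h
      obtain ⟨h1, h2⟩ := mem_of_ref h
      exact ⟨List.mem_cons_of_mem _ h1, List.subset_cons_of_subset _ h2⟩

section

variable {A : Type w} {C : Type} [L.Structure A] {J : C → C → Prop}

/-- Only the values of the variables that occur in a formula matter. -/
theorem SWin.congr_assign {N : ℕ} {φ : Formula L} (hφ : φ.VarsLT N) {s s' : ℕ → A}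
    (hs : ∀ x < N, s x = s' x) {b : Bool} {c : C} (h : SWin J ⟨φ, [], s, b, c⟩) :
    SWin J ⟨φ, [], s', b, c⟩ := by
  refine EWin.sim (fun p p' => (p.sub.VarsLT N ∧ ∀ e ∈ p.stack, e.2.VarsLT N) ∧
    ∃ s', (∀ x < N, p.assign x = s' x) ∧ p' = ⟨p.sub, p.stack, s', p.sign, p.clock⟩)
    ?_ ?_ ?_ ?_ h _ ⟨⟨hφ, by simp⟩, s', hs, rfl⟩
  · rintro p _ ⟨-, s', -, rfl⟩
    rfl
  · rintro ⟨ψ, st, s, b, c⟩ _ ⟨⟨hψ, -⟩, s', hs, rfl⟩ hd hw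
    cases ψ with
    | bot => exact ⟨fun q hq => hq.elim, hw⟩
    | eq x y =>
      refine ⟨fun q hq => hq.elim, ?_⟩
      simp only [winnerAt] at hw ⊢
      rw [← hs x hψ.1, ← hs y hψ.2, hw]
    | rel R t =>
      refine ⟨fun q hq => hq.elim, ?_⟩
      simp only [winnerAt] at hw ⊢
      simp only [← hs _ (hψ _), hw]
    | _ => simp [winnerAt] at hw
  · rintro ⟨ψ, st, s, b, c⟩ _ ⟨⟨hψ, hst⟩, s', hs, rfl⟩ q hq
    have hupd : ∀ x a, ∀ y < N, Function.update s x a y = Function.update s' x a y := by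
      intro x a y hy
      by_cases he : y = x
      · subst he; simp
      · simpa [he] using hs y hy
    cases ψ with
    | bot | eq | rel => exact hq.elim
    | neg ψ => obtain rfl := hq; exact ⟨_, rfl, ⟨hψ, hst⟩, s', hs, rfl⟩
    | and ψ χ | or ψ χ =>
      obtain rfl | rfl := hq
      · exact ⟨_, .inl rfl, ⟨hψ.1, hst⟩, s', hs, rfl⟩
      · exact ⟨_, .inr rfl, ⟨hψ.2, hst⟩, s', hs, rfl⟩
    | all x ψ | ex x ψ =>
      obtain ⟨a, rfl⟩ := hq
      exact ⟨_, ⟨a, rfl⟩, ⟨hψ.2, hst⟩, _, hupd x a, rfl⟩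
    | label l ψ =>
      obtain rfl := hq
      exact ⟨_, rfl, ⟨hψ, List.forall_mem_cons.2 ⟨hψ, hst⟩⟩, s', hs, rfl⟩
    | claim l =>
      obtain ⟨χ, st', hr, c', hJ, rfl⟩ := hq
      obtain ⟨h1, h2⟩ := Stack.mem_of_ref hr
      exact ⟨_, ⟨χ, st', hr, c', hJ, rfl⟩, ⟨hst _ h1, fun e he => hst e (h2 he)⟩, s', hs, rfl⟩
  · rintro ⟨ψ, st, s, b, c⟩ _ ⟨⟨hψ, hst⟩, s', hs, rfl⟩ - q hq
    have hupd : ∀ x a, ∀ y < N, Function.update s x a y = Function.update s' x a y := by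
      intro x a y hy
      by_cases he : y = x
      · subst he; simp
      · simpa [he] using hs y hy
    cases ψ with
    | bot | eq | rel => exact hq.elim
    | neg ψ => obtain rfl := hq; exact ⟨_, rfl, ⟨hψ, hst⟩, s', hs, rfl⟩
    | and ψ χ | or ψ χ =>
      obtain rfl | rfl := hq
      · exact ⟨_, .inl rfl, ⟨hψ.1, hst⟩, s', hs, rfl⟩
      · exact ⟨_, .inr rfl, ⟨hψ.2, hst⟩, s', hs, rfl⟩
    | all x ψ | ex x ψ =>
      obtain ⟨a, rfl⟩ := hq
      exact ⟨_, ⟨a, rfl⟩, ⟨hψ.2, hst⟩, _, hupd x a, rfl⟩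
    | label l ψ =>
      obtain rfl := hq
      exact ⟨_, rfl, ⟨hψ, List.forall_mem_cons.2 ⟨hψ, hst⟩⟩, s', hs, rfl⟩
    | claim l =>
      obtain ⟨χ, st', hr, c', hJ, rfl⟩ := hq
      obtain ⟨h1, h2⟩ := Stack.mem_of_ref hr
      exact ⟨_, ⟨χ, st', hr, c', hJ, rfl⟩, ⟨hst _ h1, fun e he => hst e (h2 he)⟩, s', hs, rfl⟩

/-- The universal quantification of all variables below `N`. -/
def Formula.closeVars (φ : Formula L) : ℕ → Formula L
  | 0 => φ
  | N + 1 => .all N (φ.closeVars N)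

/-- The quantifiers are peeled off from the outermost one, so the base assignment `s₀` changes along
the induction. -/
theorem SWin.of_closeVars [Nonempty A] {φ : Formula L} {c : C} {s : ℕ → A} (N : ℕ) :
    ∀ s₀ : ℕ → A, SWin J ⟨φ.closeVars N, [], s₀, true, c⟩ →
      SWin J ⟨φ, [], fun x => if x < N then s x else s₀ x, true, c⟩ := by
  induction N with
  | zero => intro s₀ h; simpa [Formula.closeVars] using h
  | succ N ih =>
    intro s₀ h
    have := ih _ ((sWin_all.1 h) (s N))
    convert this using 2
    funext x
    by_cases h1 : x < N
    · simp [h1, h1.trans N.lt_succ_self]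
    · by_cases h2 : x = N
      · subst h2; simp
      · simp [h1, h2, show ¬ x < N + 1 by omega]

theorem SWin.closeVars [Nonempty A] {φ : Formula L} {c : C}
    (h : ∀ s : ℕ → A, SWin J ⟨φ, [], s, true, c⟩) (N : ℕ) :
    ∀ s : ℕ → A, SWin J ⟨φ.closeVars N, [], s, true, c⟩ := by
  induction N with
  | zero => exact h
  | succ N ih => exact fun s => sWin_all.2 fun a => ih _

end

/-! ### The tableau -/

/-- The value of a variable in an environment. -/
def envVal (e : List (ℕ × ℕ)) (x : ℕ) : ℕ := (e.lookup x).getD 0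

theorem envVal_cons (x j : ℕ) (e : List (ℕ × ℕ)) :
    envVal ((x, j) :: e) = Function.update (envVal e) x j := by
  funext y
  by_cases h : y = x
  · subst h; simp [envVal]
  · have : (y == x) = false := by simpa using h
    simp [envVal, List.lookup_cons, this, h]

/-- Variables missing from the environment get parameter 0, which is in use because `0 < m`; the
root node therefore starts with one parameter. -/
theorem envVal_lt {e : List (ℕ × ℕ)} {m : ℕ} (hm : 0 < m) (he : ∀ p ∈ e, p.2 < m) (x : ℕ) :
    envVal e x < m := by
  induction e with
  | nil => exact hm
  | cons p e ih =>
    rw [envVal_cons]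
    by_cases h : x = p.1
    · subst h
      simpa using he p List.mem_cons_self
    · rw [Function.update_of_ne h]
      exact ih fun q hq => he q (List.mem_cons_of_mem _ hq)

/-- The claim that Eloise does not win from a position; the values of the variables are parameters,
and distinct parameters stand for distinct elements. -/
abbrev Item (L : FirstOrder.Language.{u, v}) := Formula L × Stack L × List (ℕ × ℕ) × Bool

/-- The claim that an atom is false (for `true`) or true (for `false`). -/
abbrev Atom (L : FirstOrder.Language.{u, v}) := ((Σ k, L.Relations k) × List ℕ) × Bool

/-- A node of the tableau: the number of parameters in use, the items to be processed, and the
atoms. -/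
abbrev Node (L : FirstOrder.Language.{u, v}) := ℕ × List (Item L) × List (Atom L)

open Classical in
/-- The nodes obtained by processing the first item of a node. -/
noncomputable def expandItem (m : ℕ) (q : List (Item L)) (at' : List (Atom L)) :
    Item L → List (Node L)
  | (.bot, _, _, b) => if b then [(m, q, at')] else []
  -- Distinct parameters name distinct elements, so equality is decided syntactically and no
  -- congruence rules are needed.
  | (.eq x y, _, e, b) => if (envVal e x = envVal e y ↔ b = true) then [] else [(m, q, at')]
  | (.rel (k := k) R t, _, e, b) =>
      if (((⟨k, R⟩, List.ofFn fun i => envVal e (t i)), !b) : Atom L) ∈ at' then []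
      else [(m, q, ((⟨k, R⟩, List.ofFn fun i => envVal e (t i)), b) :: at')]
  | (.neg ψ, st, e, b) => [(m, q ++ [(ψ, st, e, !b)], at')]
  | (.and ψ χ, st, e, b) =>
      if b then [(m, q ++ [(ψ, st, e, b)], at'), (m, q ++ [(χ, st, e, b)], at')]
      else [(m, q ++ [(ψ, st, e, b), (χ, st, e, b)], at')]
  | (.or ψ χ, st, e, b) =>
      if b then [(m, q ++ [(ψ, st, e, b), (χ, st, e, b)], at')]
      else [(m, q ++ [(ψ, st, e, b)], at'), (m, q ++ [(χ, st, e, b)], at')]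
  -- If Abelard chooses, one bad element suffices: it is named by an old parameter or by the fresh
  -- one `m`. If Eloise chooses, all elements are bad, so every present parameter is instantiated
  -- and the item rejoins the queue to meet later ones.
  | (.all x ψ, st, e, b) =>
      if b then (List.range (m + 1)).map fun j =>
        (max m (j + 1), q ++ [(ψ, st, (x, j) :: e, b)], at')
      else [(m, q ++ ((.all x ψ, st, e, b) ::
        (List.range m).map fun j => (ψ, st, (x, j) :: e, b)), at')]
  | (.ex x ψ, st, e, b) =>
      if b then [(m, q ++ ((.ex x ψ, st, e, b) ::
        (List.range m).map fun j => (ψ, st, (x, j) :: e, b)), at')]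
      else (List.range (m + 1)).map fun j =>
        (max m (j + 1), q ++ [(ψ, st, (x, j) :: e, b)], at')
  | (.label l ψ, st, e, b) => [(m, q ++ [(ψ, (l, ψ) :: st, e, b)], at')]
  -- A free claim is won by nobody, so its item carries no information and is dropped.
  | (.claim l, st, e, b) =>
      [(m, q ++ ((st.ref l).map fun r => (.label l r.1, r.2, e, b)).toList, at')]

/-- The successors of a node. -/
noncomputable def expand : Node L → List (Node L)
  -- A finished node repeats itself, so that an open branch is always infinite and never counts as
  -- closed.
  | (m, [], at') => [(m, [], at')]
  | (m, i :: q, at') => expandItem m q at' i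

/-- The nodes at depth `n` above the given nodes. -/
noncomputable def expandAll (n : ℕ) (l : List (Node L)) : List (Node L) :=
  (fun l => List.flatMap expand l)^[n] l

/-- The root of the tableau for a formula whose variables are below `N`. -/
def rootNode (N : ℕ) (φ : Formula L) : Node L := (1, [(φ.closeVars N, [], [], true)], [])

theorem expandAll_succ (n : ℕ) (l : List (Node L)) :
    expandAll (n + 1) l = expandAll n (l.flatMap expand) := rfl

theorem expandAll_nil (n : ℕ) : expandAll n ([] : List (Node L)) = [] := by
  induction n with
  | zero => rfl
  | succ n ih => exact ih

theorem expandAll_eq_nil {n : ℕ} : ∀ {l : List (Node L)},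
    (∀ S ∈ l, expandAll n [S] = []) → expandAll n l = [] := by
  have happ : ∀ n (l₁ l₂ : List (Node L)),
      expandAll n (l₁ ++ l₂) = expandAll n l₁ ++ expandAll n l₂ := by
    intro n
    induction n with
    | zero => exact fun _ _ => rfl
    | succ n ih =>
      intro l₁ l₂
      rw [expandAll_succ, List.flatMap_append, ih]
      rfl
  intro l h
  induction l with
  | nil => exact expandAll_nil n
  | cons S l ih =>
    rw [← List.singleton_append, happ, h S List.mem_cons_self,
      ih fun S hS => h S (List.mem_cons_of_mem _ hS), List.append_nil]

theorem expandAll_eq_nil_mono {m n : ℕ} (h : m ≤ n) {l : List (Node L)}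
    (hl : expandAll m l = []) : expandAll n l = [] := by
  obtain ⟨k, rfl⟩ := Nat.exists_eq_add_of_le' h
  rw [expandAll, Function.iterate_add_apply]
  exact (congrArg (expandAll k) hl).trans (expandAll_nil k)

/-! ### Soundness of the tableau -/

/-- The position that an item is about. -/
def itemPos {A : Type w} {C : Type} (v : ℕ → A) (i : Item L) (c : C) : SPos L A C :=
  ⟨i.1, i.2.1, fun x => v (envVal i.2.2.1 x), i.2.2.2, c⟩

theorem itemPos_congr {A : Type w} {C : Type} {m : ℕ} (hm : 0 < m) {v v' : ℕ → A} (hv : ∀ j < m, v' j = v j)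
    {i : Item L} (hi : ∀ p ∈ i.2.2.1, p.2 < m) (c : C) : itemPos v' i c = itemPos v i c := by
  unfold itemPos
  congr 1
  funext x
  exact hv _ (envVal_lt hm hi x)

theorem itemPos_cons {A : Type w} {C : Type} (v : ℕ → A) (ψ : Formula L) (st : Stack L) (e : List (ℕ × ℕ))
    (x j : ℕ) (b : Bool) (c : C) : itemPos v (ψ, st, (x, j) :: e, b) c =
      ⟨ψ, st, Function.update (fun y => v (envVal e y)) x (v j), b, c⟩ := by
  unfold itemPos
  congr 1
  funext y
  simp only [envVal_cons]
  by_cases h : y = x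
  · subst h; simp
  · simp [h]

section Soundness

variable {A : Type w} [L.Structure A]

/-- The claims of the node are true if the parameters are interpreted by `v` and the clock value
is `n`. -/
structure Refutes (n : ℕ) (v : ℕ → A) (S : Node L) : Prop where
  pos : 0 < S.1
  inj : Set.InjOn v (Set.Iio S.1)
  items : ∀ i ∈ S.2.1, (∀ p ∈ i.2.2.1, p.2 < S.1) ∧ ¬ SWin Countdown (itemPos v i n)
  atoms : ∀ a ∈ S.2.2, ∃ t : Fin a.1.1.1 → ℕ, a.1.2 = List.ofFn t ∧ (∀ i, t i < S.1) ∧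
    ¬ (FirstOrder.Language.Structure.RelMap a.1.1.2 (fun i => v (t i)) ↔ a.2 = true)

/-- Losing with clock `n + 1` implies losing with clock `n`, so lowering the clock at every
expansion, even when no jump is made, is harmless. -/
theorem Refutes.push {n m m' : ℕ} {v v' : ℕ → A} {i : Item L} {q : List (Item L)}
    {at' : List (Atom L)} (h : Refutes (n + 1) v (m, i :: q, at')) (hm : m ≤ m')
    (hv : ∀ j < m, v' j = v j) (hinj : Set.InjOn v' (Set.Iio m')) {r : List (Item L)}
    (hr : ∀ i ∈ r, (∀ p ∈ i.2.2.1, p.2 < m') ∧ ¬ SWin Countdown (itemPos v' i (n + 1))) :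
    Refutes n v' (m', q ++ r, at') where
  pos := h.pos.trans_le hm
  inj := hinj
  items j hj := by
    rcases List.mem_append.1 hj with hj | hj
    · obtain ⟨h1, h2⟩ := h.items j (List.mem_cons_of_mem _ hj)
      refine ⟨fun p hp => (h1 p hp).trans_le hm, fun hw => h2 ?_⟩
      rw [itemPos_congr h.pos hv h1] at hw
      exact hw.mono_clock n.le_succ
    · exact ⟨(hr j hj).1, fun hw => (hr j hj).2 (hw.mono_clock n.le_succ)⟩
  atoms a ha := by
    obtain ⟨t, h1, h2, h3⟩ := h.atoms a ha
    refine ⟨t, h1, fun i => (h2 i).trans_le hm, ?_⟩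
    simpa only [hv _ (h2 _)] using h3

theorem Refutes.push_same {n m : ℕ} {v : ℕ → A} {i : Item L} {q : List (Item L)}
    {at' : List (Atom L)} (h : Refutes (n + 1) v (m, i :: q, at')) {r : List (Item L)}
    (hr : ∀ i ∈ r, (∀ p ∈ i.2.2.1, p.2 < m) ∧ ¬ SWin Countdown (itemPos v i (n + 1))) :
    Refutes n v (m, q ++ r, at') :=
  h.push le_rfl (fun _ _ => rfl) h.inj hr

/-- The bad element `a` either is already the value of a parameter, whose branch is taken, or
becomes the value of `m`. In the second case injectivity persists because `a` is new. -/
theorem Refutes.push_fresh {n m : ℕ} {v : ℕ → A} {i : Item L} {q : List (Item L)}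
    {at' : List (Atom L)} (h : Refutes (n + 1) v (m, i :: q, at')) {ψ : Formula L} {st : Stack L}
    {e : List (ℕ × ℕ)} {x : ℕ} {b : Bool} (he : ∀ p ∈ e, p.2 < m) {a : A}
    (ha : ¬ SWin Countdown ⟨ψ, st, Function.update (fun y => v (envVal e y)) x a, b, n + 1⟩) :
    ∃ S ∈ (List.range (m + 1)).map fun j =>
      ((max m (j + 1), q ++ [(ψ, st, (x, j) :: e, b)], at') : Node L), ∃ v' : ℕ → A, Refutes n v' S := by
  by_cases hj : ∃ j < m, v j = a
  · obtain ⟨j, hj, rfl⟩ := hj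
    refine ⟨_, List.mem_map_of_mem (List.mem_range.2 (hj.trans m.lt_succ_self)), v, ?_⟩
    rw [max_eq_left (show j + 1 ≤ m by omega)]
    refine h.push_same ?_
    simp only [List.mem_singleton, forall_eq, itemPos_cons]
    exact ⟨List.forall_mem_cons.2 ⟨hj, he⟩, ha⟩
  · push Not at hj
    have hv : ∀ j < m, Function.update v m a j = v j := fun j hj =>
      Function.update_of_ne hj.ne _ _
    refine ⟨_, List.mem_map_of_mem (List.mem_range.2 m.lt_succ_self), Function.update v m a, ?_⟩
    rw [max_eq_right m.le_succ]
    refine h.push m.le_succ hv ?_ ?_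
    · intro j hj' k hk' hjk
      simp only [Set.mem_Iio] at hj' hk'
      rcases Nat.lt_succ_iff_lt_or_eq.1 hj' with h1 | rfl <;>
        rcases Nat.lt_succ_iff_lt_or_eq.1 hk' with h2 | rfl
      · rw [hv j h1, hv k h2] at hjk
        exact h.inj h1 h2 hjk
      · rw [hv j h1, Function.update_self] at hjk
        exact absurd hjk (hj j h1)
      · rw [hv k h2, Function.update_self] at hjk
        exact absurd hjk.symm (hj k h2)
      · rfl
    · simp only [List.mem_singleton, forall_eq]
      refine ⟨List.forall_mem_cons.2 ⟨m.lt_succ_self, fun p hp => (he p hp).trans m.lt_succ_self⟩, ?_⟩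
      rw [itemPos_cons, Function.update_self]
      have : (fun y => Function.update v m a (envVal e y)) = fun y => v (envVal e y) :=
        funext fun y => hv _ (envVal_lt h.pos he y)
      rwa [this]

/-- The expansion rules are the negated clauses of the game, so Abelard's good reply selects a
successor. Only a jump really consumes the tick. -/
theorem Refutes.exists_expand [Nonempty A] {n : ℕ} {v : ℕ → A} {S : Node L}
    (h : Refutes (n + 1) v S) : ∃ S' ∈ expand S, ∃ v' : ℕ → A, Refutes n v' S' := by
  obtain ⟨m, q, at'⟩ := S
  cases q with
  | nil =>
    exact ⟨_, List.mem_singleton_self _, v, h.pos, h.inj, by simp, h.atoms⟩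
  | cons i q =>
    obtain ⟨ψ, st, e, b⟩ := i
    obtain ⟨he, hw⟩ := h.items _ List.mem_cons_self
    have hdrop : Refutes n v (m, q, at') := by
      simpa using h.push_same (r := []) (by simp)
    simp only [expand, expandItem]
    simp only [itemPos] at hw he
    cases ψ with
    | bot =>
      rw [sWin_bot] at hw
      dsimp only
      rw [if_pos (by simpa using hw)]
      exact ⟨_, List.mem_singleton_self _, v, hdrop⟩
    | eq x y =>
      rw [sWin_eq] at hw
      have hi : v (envVal e x) = v (envVal e y) ↔ envVal e x = envVal e y :=
        ⟨fun hh => h.inj (envVal_lt h.pos he x) (envVal_lt h.pos he y) hh, fun hh => by rw [hh]⟩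
      rw [hi] at hw
      dsimp only
      rw [if_neg hw]
      exact ⟨_, List.mem_singleton_self _, v, hdrop⟩
    | @rel k R t =>
      rw [sWin_rel] at hw
      dsimp only
      rw [if_neg]
      · refine ⟨_, List.mem_singleton_self _, v, hdrop.pos, hdrop.inj, hdrop.items, ?_⟩
        intro a ha
        rcases List.mem_cons.1 ha with rfl | ha
        · exact ⟨fun i => envVal e (t i), rfl, fun i => envVal_lt h.pos he _, hw⟩
        · exact hdrop.atoms a ha
      · intro hmem
        obtain ⟨t', h1, h2, h3⟩ := h.atoms _ hmem
        have h1 : (fun i => envVal e (t i)) = t' := List.ofFn_injective h1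
        subst h1
        refine h3 ?_
        cases b <;> simpa using hw
    | neg ψ =>
      rw [sWin_neg] at hw
      refine ⟨_, List.mem_singleton_self _, v, h.push_same ?_⟩
      exact List.forall_mem_singleton.2 ⟨he, hw⟩
    | and ψ χ =>
      rw [sWin_and] at hw
      cases b
      · simp only [Bool.false_eq_true, if_false, not_or] at hw ⊢
        refine ⟨_, List.mem_singleton_self _, v, h.push_same ?_⟩
        simp only [List.mem_cons, List.not_mem_nil, or_false, forall_eq_or_imp, forall_eq]
        exact ⟨⟨he, hw.1⟩, he, hw.2⟩
      · simp only [if_true, not_and_or] at hw ⊢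
        rcases hw with hw | hw
        · refine ⟨_, List.mem_cons_self, v, h.push_same ?_⟩
          exact List.forall_mem_singleton.2 ⟨he, hw⟩
        · refine ⟨_, List.mem_cons_of_mem _ List.mem_cons_self, v, h.push_same ?_⟩
          exact List.forall_mem_singleton.2 ⟨he, hw⟩
    | or ψ χ =>
      rw [sWin_or] at hw
      cases b
      · simp only [Bool.false_eq_true, if_false, not_and_or] at hw ⊢
        rcases hw with hw | hw
        · refine ⟨_, List.mem_cons_self, v, h.push_same ?_⟩
          exact List.forall_mem_singleton.2 ⟨he, hw⟩
        · refine ⟨_, List.mem_cons_of_mem _ List.mem_cons_self, v, h.push_same ?_⟩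
          exact List.forall_mem_singleton.2 ⟨he, hw⟩
      · simp only [if_true, not_or] at hw ⊢
        refine ⟨_, List.mem_singleton_self _, v, h.push_same ?_⟩
        simp only [List.mem_cons, List.not_mem_nil, or_false, forall_eq_or_imp, forall_eq]
        exact ⟨⟨he, hw.1⟩, he, hw.2⟩
    | all x ψ =>
      have hw₀ := hw
      rw [sWin_all] at hw
      cases b
      · simp only [Bool.false_eq_true, if_false, not_exists] at hw ⊢
        refine ⟨_, List.mem_singleton_self _, v, h.push_same ?_⟩
        refine List.forall_mem_cons.2 ⟨⟨he, hw₀⟩, ?_⟩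
        simp only [List.mem_map, List.mem_range, forall_exists_index, and_imp]
        rintro _ j hj rfl
        rw [itemPos_cons]
        exact ⟨List.forall_mem_cons.2 ⟨hj, he⟩, hw _⟩
      · simp only [if_true, not_forall] at hw ⊢
        obtain ⟨a, ha⟩ := hw
        exact h.push_fresh he ha
    | ex x ψ =>
      have hw₀ := hw
      rw [sWin_ex] at hw
      cases b
      · simp only [Bool.false_eq_true, if_false, not_forall] at hw ⊢
        obtain ⟨a, ha⟩ := hw
        exact h.push_fresh he ha
      · simp only [if_true, not_exists] at hw ⊢
        refine ⟨_, List.mem_singleton_self _, v, h.push_same ?_⟩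
        refine List.forall_mem_cons.2 ⟨⟨he, hw₀⟩, ?_⟩
        simp only [List.mem_map, List.mem_range, forall_exists_index, and_imp]
        rintro _ j hj rfl
        rw [itemPos_cons]
        exact ⟨List.forall_mem_cons.2 ⟨hj, he⟩, hw _⟩
    | label l ψ =>
      rw [sWin_label] at hw
      refine ⟨_, List.mem_singleton_self _, v, h.push_same ?_⟩
      exact List.forall_mem_singleton.2 ⟨he, hw⟩
    | claim l =>
      rw [sWin_claim] at hw
      dsimp only
      cases hr : Stack.ref l st with
      | none =>
        refine ⟨_, List.mem_singleton_self _, v, ?_⟩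
        simpa using hdrop
      | some r =>
        refine ⟨_, List.mem_singleton_self _, v, ?_⟩
        -- The jump takes clock `n + 1` to exactly `n`, so this item cannot go through
        -- `Refutes.push_same`, which asks for a loss at `n + 1`.
        have hw : ¬ SWin Countdown
            (⟨.label l r.1, r.2, fun x => v (envVal e x), b, n⟩ : SPos L A ℕ) :=
          fun hw' => hw ⟨r.1, r.2, hr, n, rfl, hw'⟩
        refine ⟨h.pos, h.inj, fun j hj => ?_, h.atoms⟩
        rcases List.mem_append.1 hj with hj | hj
        · exact hdrop.items j hj
        · simp only [Option.map_some, Option.toList_some, List.mem_singleton] at hj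
          subst hj
          exact ⟨he, hw⟩

theorem Refutes.expandAll_ne_nil [Nonempty A] {n : ℕ} : ∀ {v : ℕ → A} {S : Node L}
    {l : List (Node L)}, Refutes n v S → S ∈ l → expandAll n l ≠ [] := by
  induction n with
  | zero => exact fun _ hS => List.ne_nil_of_mem hS
  | succ n ih =>
    intro v S l h hS
    obtain ⟨S', hS', v', h'⟩ := h.exists_expand
    rw [expandAll_succ]
    exact ih h' (List.mem_flatMap.2 ⟨S, hS, hS'⟩)

/-- A loss with clock `n` would refute the root and hence leave a refuted node at depth `n`. The
universal closure makes one tableau serve all assignments. -/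
theorem sWin_of_expandAll [Nonempty A] {N n : ℕ} {φ : Formula L} (hφ : φ.VarsLT N)
    (h : expandAll n [rootNode N φ] = []) (s : ℕ → A) :
    SWin Countdown ⟨φ, [], s, true, n⟩ := by
  -- The empty environment sends every variable to parameter 0, which yields a constant assignment;
  -- `s 0` merely serves as its value.
  have h1 : SWin Countdown ⟨φ.closeVars N, [], fun _ => s 0, true, n⟩ := by
    by_contra hn
    refine Refutes.expandAll_ne_nil (v := fun _ : ℕ => s 0) ?_ List.mem_cons_self h
    refine ⟨Nat.one_pos, ?_, ?_, by simp [rootNode]⟩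
    · intro i hi j hj _
      simp only [rootNode, Set.mem_Iio, Nat.lt_one_iff] at hi hj
      rw [hi, hj]
    · simpa [rootNode, itemPos] using hn
  exact (SWin.of_closeVars (s := s) N _ h1).congr_assign hφ fun x hx => by simp [hx]

end Soundness

/-! ### Completeness of the tableau -/

/-- This is König's lemma: a node has finitely many successors, so if all of them close, their
depths have a common bound and the node closes too. -/
theorem exists_open_branch {S : Node L} (h : ∀ n, expandAll n [S] ≠ []) :
    ∃ σ : ℕ → Node L, σ 0 = S ∧ ∀ k, σ (k + 1) ∈ expand (σ k) := by
  classical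
  have hnext : ∀ S : {S : Node L // ∀ n, expandAll n [S] ≠ []},
      ∃ S' : {S : Node L // ∀ n, expandAll n [S] ≠ []}, S'.1 ∈ expand S.1 := by
    rintro ⟨S, hS⟩
    by_contra! hc
    have hclose : ∀ S' ∈ expand S, ∃ n, expandAll n [S'] = [] := by
      intro S' hS'
      by_contra! hn
      exact hc ⟨S', hn⟩ hS'
    choose! f hf using hclose
    -- The sum of the depths is a convenient upper bound for each of them.
    refine hS (((expand S).map f).sum + 1) ?_
    rw [expandAll_succ, List.flatMap_singleton]
    exact expandAll_eq_nil fun S' hS' => expandAll_eq_nil_mono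
      (List.single_le_sum (by simp) _ (List.mem_map_of_mem hS')) (hf S' hS')
  choose next hspec using hnext
  let τ : ℕ → {S : Node L // ∀ n, expandAll n [S] ≠ []} := fun k =>
    Nat.rec ⟨S, h⟩ (fun _ x => next x) k
  exact ⟨fun k => (τ k).1, rfl, fun k => hspec (τ k)⟩

/-- No atom is claimed to be both true and false, and the values of the variables are parameters
in use. -/
structure Node.WellFormed (S : Node L) : Prop where
  pos : 0 < S.1
  items : ∀ i ∈ S.2.1, ∀ p ∈ i.2.2.1, p.2 < S.1
  atoms : ∀ a, (a, true) ∈ S.2.2 → (a, false) ∉ S.2.2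

theorem Node.WellFormed.push {m m' : ℕ} {i : Item L} {q r : List (Item L)} {at' : List (Atom L)}
    (h : Node.WellFormed (m, i :: q, at')) (hm : m ≤ m')
    (hr : ∀ i ∈ r, ∀ p ∈ i.2.2.1, p.2 < m') : Node.WellFormed (m', q ++ r, at') where
  pos := h.pos.trans_le hm
  items j hj p hp := by
    rcases List.mem_append.1 hj with hj | hj
    · exact (h.items j (List.mem_cons_of_mem _ hj) p hp).trans_le hm
    · exact hr j hj p hp
  atoms := h.atoms

/-- What is common to all successors of a node. -/
theorem Node.WellFormed.expandItem {m : ℕ} {i : Item L} {q : List (Item L)} {at' : List (Atom L)}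
    (h : Node.WellFormed (m, i :: q, at')) {S' : Node L} (hS' : S' ∈ expandItem m q at' i) :
    S'.WellFormed ∧ m ≤ S'.1 ∧ (∃ r, S'.2.1 = q ++ r) ∧ at' ⊆ S'.2.2 := by
  have hpush : ∀ {m' r}, m ≤ m' → (∀ i ∈ r, ∀ p ∈ i.2.2.1, p.2 < m') →
      S' = (m', q ++ r, at') →
      S'.WellFormed ∧ m ≤ S'.1 ∧ (∃ r, S'.2.1 = q ++ r) ∧ at' ⊆ S'.2.2 := by
    rintro m' r hm hr rfl
    exact ⟨h.push hm hr, hm, ⟨r, rfl⟩, List.Subset.refl _⟩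
  have hdrop : S' = (m, q, at') →
      S'.WellFormed ∧ m ≤ S'.1 ∧ (∃ r, S'.2.1 = q ++ r) ∧ at' ⊆ S'.2.2 :=
    fun hS => hpush (r := []) le_rfl (by simp) (by simpa using hS)
  obtain ⟨ψ, st, e, b⟩ := i
  have he : ∀ p ∈ e, p.2 < m := h.items _ List.mem_cons_self
  have hfresh : ∀ {x : ℕ} {ψ : Formula L}, S' ∈ ((List.range (m + 1)).map fun j =>
      ((max m (j + 1), q ++ [(ψ, st, (x, j) :: e, b)], at') : Node L)) →
      S'.WellFormed ∧ m ≤ S'.1 ∧ (∃ r, S'.2.1 = q ++ r) ∧ at' ⊆ S'.2.2 := by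
    intro x ψ hS'
    obtain ⟨j, -, rfl⟩ := List.mem_map.1 hS'
    refine hpush (le_max_left m (j + 1)) ?_ rfl
    refine List.forall_mem_singleton.2 (List.forall_mem_cons.2 ⟨?_, fun p hp => ?_⟩)
    · exact lt_max_of_lt_right j.lt_succ_self
    · exact lt_max_of_lt_left (he p hp)
  have hinst : ∀ {x : ℕ} {ψ χ : Formula L}, S' = (m, q ++ ((χ, st, e, b) ::
        (List.range m).map fun j => (ψ, st, (x, j) :: e, b)), at') →
      S'.WellFormed ∧ m ≤ S'.1 ∧ (∃ r, S'.2.1 = q ++ r) ∧ at' ⊆ S'.2.2 := by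
    intro x ψ χ hS'
    refine hpush le_rfl (List.forall_mem_cons.2 ⟨he, fun i hi => ?_⟩) hS'
    obtain ⟨j, hj, rfl⟩ := List.mem_map.1 hi
    exact List.forall_mem_cons.2 ⟨List.mem_range.1 hj, he⟩
  have hone : ∀ {ψ : Formula L} {st : Stack L} {b : Bool}, S' = (m, q ++ [(ψ, st, e, b)], at') →
      S'.WellFormed ∧ m ≤ S'.1 ∧ (∃ r, S'.2.1 = q ++ r) ∧ at' ⊆ S'.2.2 :=
    fun hS => hpush le_rfl (List.forall_mem_singleton.2 he) hS
  have htwo : ∀ {ψ χ : Formula L}, S' = (m, q ++ [(ψ, st, e, b), (χ, st, e, b)], at') →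
      S'.WellFormed ∧ m ≤ S'.1 ∧ (∃ r, S'.2.1 = q ++ r) ∧ at' ⊆ S'.2.2 :=
    fun hS => hpush le_rfl (List.forall_mem_cons.2 ⟨he, List.forall_mem_singleton.2 he⟩) hS
  cases ψ with
  | bot =>
    cases b
    · simp [SCL.expandItem] at hS'
    · exact hdrop (by simpa [SCL.expandItem] using hS')
  | eq x y =>
    simp only [SCL.expandItem] at hS'
    split_ifs at hS'
    · simp at hS'
    · exact hdrop (List.mem_singleton.1 hS')
  | rel R t =>
    simp only [SCL.expandItem] at hS'
    split_ifs at hS' with hmem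
    · simp at hS'
    · obtain rfl := List.mem_singleton.1 hS'
      refine ⟨⟨h.pos, fun j hj => h.items j (List.mem_cons_of_mem _ hj), ?_⟩, le_rfl, ⟨[], by simp⟩,
        List.subset_cons_self _ _⟩
      intro a ha hf
      rcases List.mem_cons.1 ha with ha' | ha' <;> rcases List.mem_cons.1 hf with hf' | hf'
      · cases ha'; cases hf'
      · cases ha'; exact hmem hf'
      · cases hf'; exact hmem ha'
      · exact h.atoms a ha' hf'
  | neg ψ => exact hone (List.mem_singleton.1 hS')
  | and ψ χ =>
    cases b
    · exact htwo (List.mem_singleton.1 hS')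
    · have hS' : S' ∈ [(m, q ++ [(ψ, st, e, true)], at'), (m, q ++ [(χ, st, e, true)], at')] := hS'
      rcases List.mem_cons.1 hS' with hS' | hS'
      · exact hone hS'
      · exact hone (List.mem_singleton.1 hS')
  | or ψ χ =>
    cases b
    · have hS' : S' ∈ [(m, q ++ [(ψ, st, e, false)], at'), (m, q ++ [(χ, st, e, false)], at')] := hS'
      rcases List.mem_cons.1 hS' with hS' | hS'
      · exact hone hS'
      · exact hone (List.mem_singleton.1 hS')
    · exact htwo (List.mem_singleton.1 hS')
  | all x ψ =>
    cases b
    · exact hinst (List.mem_singleton.1 hS')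
    · exact hfresh hS'
  | ex x ψ =>
    cases b
    · exact hfresh hS'
    · exact hinst (List.mem_singleton.1 hS')
  | label l ψ => exact hone (List.mem_singleton.1 hS')
  | claim l =>
    refine hpush le_rfl (fun i hi => ?_) (List.mem_singleton.1 hS')
    obtain ⟨r, -, rfl⟩ := Option.map_eq_some_iff.1 (Option.mem_toList.1 hi)
    exact he

section Branch

variable {σ : ℕ → Node L}

theorem branch_step (hσ : ∀ k, σ (k + 1) ∈ expand (σ k)) {k : ℕ} (h : (σ k).WellFormed) :
    (σ (k + 1)).WellFormed ∧ (σ k).1 ≤ (σ (k + 1)).1 ∧ (σ k).2.2 ⊆ (σ (k + 1)).2.2 ∧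
      ∃ r, (σ (k + 1)).2.1 = (σ k).2.1.tail ++ r := by
  have hk := hσ k
  generalize σ k = S at h hk ⊢
  obtain ⟨m, q, at'⟩ := S
  cases q with
  | nil =>
    have hk : σ (k + 1) = (m, [], at') := List.mem_singleton.1 hk
    rw [hk]
    exact ⟨h, le_rfl, List.Subset.refl _, [], rfl⟩
  | cons i q =>
    obtain ⟨h1, h2, h3, h4⟩ := h.expandItem hk
    exact ⟨h1, h2, h4, h3⟩

variable (hσ : ∀ k, σ (k + 1) ∈ expand (σ k)) (h0 : (σ 0).WellFormed)
include hσ h0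

theorem branch_wellFormed (k : ℕ) : (σ k).WellFormed := by
  induction k with
  | zero => exact h0
  | succ k ih => exact (branch_step hσ ih).1

theorem branch_param_mono : Monotone fun k => (σ k).1 :=
  monotone_nat_of_le_succ fun k => (branch_step hσ (branch_wellFormed hσ h0 k)).2.1

theorem branch_atoms_mono {k k' : ℕ} (h : k ≤ k') : (σ k).2.2 ⊆ (σ k').2.2 := by
  induction h with
  | refl => exact List.Subset.refl _
  | step _ ih => exact List.Subset.trans ih (branch_step hσ (branch_wellFormed hσ h0 _)).2.2.1

/-- Every item is processed at some time. -/
theorem branch_processed {k : ℕ} {i : Item L} (hi : i ∈ (σ k).2.1) :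
    ∃ k' ≥ k, ∃ q, (σ k').2.1 = i :: q ∧ σ (k' + 1) ∈ expandItem (σ k').1 q (σ k').2.2 i := by
  obtain ⟨l₁, l₂, hl⟩ := List.append_of_mem hi
  -- New items only join at the end of the queue, so the number of items ahead of `i` drops at each
  -- step.
  have key : ∀ (n k : ℕ) (l₁ l₂ : List (Item L)), l₁.length = n → (σ k).2.1 = l₁ ++ i :: l₂ →
      ∃ k' ≥ k, ∃ q, (σ k').2.1 = i :: q := by
    intro n
    induction n with
    | zero =>
      intro k l₁ l₂ hn hl
      rw [List.length_eq_zero_iff.1 hn] at hl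
      exact ⟨k, le_rfl, l₂, hl⟩
    | succ n ih =>
      intro k l₁ l₂ hn hl
      obtain ⟨-, -, -, r, hr⟩ := branch_step hσ (branch_wellFormed hσ h0 k)
      cases l₁ with
      | nil => simp at hn
      | cons j l₁ =>
        rw [hl, List.cons_append, List.tail_cons, List.append_assoc, List.cons_append] at hr
        obtain ⟨k', hk', hq⟩ := ih (k + 1) l₁ _ (by simpa using hn) hr
        exact ⟨k', by omega, hq⟩
  obtain ⟨k', hk', q, hq⟩ := key _ k l₁ l₂ rfl hl
  refine ⟨k', hk', q, hq, ?_⟩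
  have := hσ k'
  generalize σ k' = S at hq this ⊢
  obtain ⟨m, q', at'⟩ := S
  obtain rfl : q' = i :: q := hq
  exact this

/-- Every item that is renewed when it is processed is processed infinitely often. -/
theorem branch_processed_again {k : ℕ} {i : Item L} (hi : i ∈ (σ k).2.1)
    (hren : ∀ m q at', ∀ S' ∈ expandItem m q at' i, i ∈ S'.2.1) (K : ℕ) :
    ∃ k' ≥ K, ∃ q, (σ k').2.1 = i :: q ∧ σ (k' + 1) ∈ expandItem (σ k').1 q (σ k').2.2 i := by
  have : ∃ k' ≥ K, i ∈ (σ k').2.1 := by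
    induction K with
    | zero => exact ⟨k, Nat.zero_le k, hi⟩
    | succ K ih =>
      obtain ⟨k', hk', hi'⟩ := ih
      obtain ⟨k'', hk'', q, -, hS⟩ := branch_processed hσ h0 hi'
      exact ⟨k'' + 1, by omega, hren _ _ _ _ hS⟩
  obtain ⟨k', hk', hi'⟩ := this
  obtain ⟨k'', hk'', h⟩ := branch_processed hσ h0 hi'
  exact ⟨k'', by omega, h⟩

/-- An infinite branch yields a structure in which all claims of the branch are true. -/
theorem exists_structure_of_branch : ∃ (A : Type w) (_ : L.Structure A) (ι : ℕ → A),
    ∀ k, ∀ i ∈ (σ k).2.1, ¬ SWin NoClock (itemPos ι i ()) := by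
  classical
  have hz : ∃ k, 0 < (σ k).1 := ⟨0, h0.pos⟩
  -- The domain consists of the parameters that ever come into use. It is countable, so lifting it
  -- places the countermodel in whichever universe validity is taken in.
  let A : Type w := ULift.{w} {j : ℕ // ∃ k, j < (σ k).1}
  let ι : ℕ → A := fun j => if h : ∃ k, j < (σ k).1 then ⟨⟨j, h⟩⟩ else ⟨⟨0, hz⟩⟩
  have hι : ∀ {j k : ℕ}, j < (σ k).1 → (ι j).down.1 = j := fun {j k} h => by
    have : ∃ k, j < (σ k).1 := ⟨k, h⟩
    simp only [ι, dif_pos this]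
  have hι' : ∀ a : A, ι a.down.1 = a := fun a => by
    have := a.down.2
    simp only [ι, dif_pos this]
    rfl
  -- An atom holds if some node claims it to be true, which is flagged by `false`. Function symbols
  -- do not occur in formulas, so their values are arbitrary.
  let inst : L.Structure A :=
    { funMap := fun _ _ => ι 0
      RelMap := fun {n} R t => ∃ k, (((⟨n, R⟩, List.ofFn fun i => (t i).down.1), false) : Atom L) ∈
        (σ k).2.2 }
  refine ⟨A, inst, ι, fun k i hi hw => ?_⟩
  have wf := branch_wellFormed hσ h0
  have pr : ∀ {k : ℕ} {i : Item L}, i ∈ (σ k).2.1 → ∃ k' ≥ k, ∃ q, (σ k').2.1 = i :: q ∧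
    σ (k' + 1) ∈ expandItem (σ k').1 q (σ k').2.2 i := branch_processed hσ h0
  have hmem : ∀ {S : Node L} {m : ℕ} {q r : List (Item L)} {at' : List (Atom L)} {i : Item L},
      S = (m, q ++ r, at') → i ∈ r → i ∈ S.2.1 := by
    rintro _ m q r at' i rfl hi
    exact List.mem_append_right _ hi
  -- Eloise's instances of a quantifier
  have hall : ∀ {k : ℕ} {χ ψ : Formula L} {st : Stack L} {e : List (ℕ × ℕ)} {b : Bool} {x : ℕ},
      (χ, st, e, b) ∈ (σ k).2.1 →
      (∀ m q at', SCL.expandItem m q at' (χ, st, e, b) = [(m, q ++ ((χ, st, e, b) ::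
        (List.range m).map fun j => (ψ, st, (x, j) :: e, b)), at')]) →
      ∀ a : A, ∃ k, ∃ i ∈ (σ k).2.1,
        (⟨ψ, st, Function.update (fun y => ι (envVal e y)) x a, b, ()⟩ : SPos L A Unit) =
          itemPos ι i () := by
    intro k χ ψ st e b x hi hexp a
    -- The parameter `a` is in use from stage `K` on; the renewed item is processed again after that
    -- and is then instantiated with `a`.
    obtain ⟨K, hK⟩ := a.down.2
    obtain ⟨k', hk', q, hq, hS⟩ := branch_processed_again hσ h0 hi (fun m q at' S' hS' => by
      rw [hexp] at hS'
      exact hmem (List.mem_singleton.1 hS') List.mem_cons_self) K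
    rw [hexp] at hS
    refine ⟨k' + 1, (ψ, st, (x, a.down.1) :: e, b), hmem (List.mem_singleton.1 hS)
      (List.mem_cons_of_mem _ ?_), ?_⟩
    · exact List.mem_map.2 ⟨_, List.mem_range.2
        (hK.trans_le (branch_param_mono hσ h0 hk')), rfl⟩
    · rw [itemPos_cons, hι']
  -- Abelard's choice at a quantifier
  have hex : ∀ {k : ℕ} {χ ψ : Formula L} {st : Stack L} {e : List (ℕ × ℕ)} {b : Bool} {x : ℕ},
      (χ, st, e, b) ∈ (σ k).2.1 →
      (∀ m q at', SCL.expandItem m q at' (χ, st, e, b) = (List.range (m + 1)).map fun j =>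
        (max m (j + 1), q ++ [(ψ, st, (x, j) :: e, b)], at')) →
      ∃ a : A, ∃ k, ∃ i ∈ (σ k).2.1,
        (⟨ψ, st, Function.update (fun y => ι (envVal e y)) x a, b, ()⟩ : SPos L A Unit) =
          itemPos ι i () := by
    intro k χ ψ st e b x hi hexp
    obtain ⟨k', hk', q, hq, hS⟩ := pr hi
    rw [hexp] at hS
    obtain ⟨j, -, hj⟩ := List.mem_map.1 hS
    exact ⟨ι j, k' + 1, _, hmem hj.symm (List.mem_singleton_self _), (itemPos_cons ..).symm⟩
  -- The positions named by items of the branch are a trap: closed under Eloise's moves, containing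
  -- a reply for Abelard, and with no dead end won by Eloise.
  refine EWin.notMem_of_trap (fun p => ∃ k, ∃ i ∈ (σ k).2.1, p = itemPos ι i ()) ?_ ?_ ?_ hw
    ⟨k, i, hi, rfl⟩
  · rintro _ ⟨k, i, hi, rfl⟩ hd hw
    have hw' : SWin NoClock (itemPos ι i ()) := .dead hd hw
    obtain ⟨k', hk', q, hq, hS⟩ := pr hi
    obtain ⟨ψ, st, e, b⟩ := i
    have hlt : ∀ x, envVal e x < (σ k).1 := fun x =>
      envVal_lt (wf k).pos ((wf k).items _ hi) x
    cases ψ with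
    | bot =>
      obtain rfl : b = false := sWin_bot.1 hw'
      simp [SCL.expandItem] at hS
    | eq x y =>
      have h1 := sWin_eq.1 hw'
      simp only at h1
      have h2 : ι (envVal e x) = ι (envVal e y) ↔ envVal e x = envVal e y := by
        refine ⟨fun h => ?_, fun h => by rw [h]⟩
        rw [← hι (hlt x), ← hι (hlt y), h]
      rw [h2] at h1
      simp only [SCL.expandItem] at hS
      rw [if_pos h1] at hS
      simp at hS
    | @rel n R t =>
      have h1 := sWin_rel.1 hw'
      simp only at h1
      have h2 : (fun i => (ι (envVal e (t i))).down.1) = fun i => envVal e (t i) :=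
        funext fun i => hι (hlt _)
      have h3 : FirstOrder.Language.Structure.RelMap R (fun i => ι (envVal e (t i))) ↔
          ∃ k, (((⟨n, R⟩, List.ofFn fun i => envVal e (t i)), false) : Atom L) ∈ (σ k).2.2 := by
        rw [← h2]
        exact Iff.rfl
      rw [h3] at h1
      simp only [SCL.expandItem] at hS
      split_ifs at hS with hc
      · simp at hS
      · have hS := List.mem_singleton.1 hS
        have h4 : (((⟨n, R⟩, List.ofFn fun i => envVal e (t i)), b) : Atom L) ∈
            (σ (k' + 1)).2.2 := by rw [hS]; exact List.mem_cons_self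
        cases b
        · exact absurd (h1.1 ⟨_, h4⟩) (by simp)
        -- The two opposite claims may appear at different stages. Atoms are never discarded, so
        -- both are present at the later stage and clash.
        · obtain ⟨k'', h5⟩ := h1.2 rfl
          exact (wf (max (k' + 1) k'')).atoms _
            (branch_atoms_mono hσ h0 (le_max_left _ _) h4)
            (branch_atoms_mono hσ h0 (le_max_right _ _) h5)
    | _ => simp [winnerAt, itemPos] at hw
  · rintro _ ⟨k, i, hi, rfl⟩ ht p hp
    obtain ⟨k', hk', q, hq, hS⟩ := pr hi
    obtain ⟨ψ, st, e, b⟩ := i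
    cases ψ with
    | bot | eq | rel => exact hp.elim
    | neg ψ =>
      obtain rfl := hp
      exact ⟨k' + 1, (ψ, st, e, !b), hmem (List.mem_singleton.1 hS) (List.mem_singleton_self _), rfl⟩
    | and ψ χ =>
      cases b
      · obtain rfl | rfl := hp
        · exact ⟨k' + 1, (ψ, st, e, false), hmem (List.mem_singleton.1 hS) List.mem_cons_self, rfl⟩
        · exact ⟨k' + 1, (χ, st, e, false), hmem (List.mem_singleton.1 hS)
            (List.mem_cons_of_mem _ List.mem_cons_self), rfl⟩
      · cases ht
    | or ψ χ =>
      cases b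
      · cases ht
      · obtain rfl | rfl := hp
        · exact ⟨k' + 1, (ψ, st, e, true), hmem (List.mem_singleton.1 hS) List.mem_cons_self, rfl⟩
        · exact ⟨k' + 1, (χ, st, e, true), hmem (List.mem_singleton.1 hS)
            (List.mem_cons_of_mem _ List.mem_cons_self), rfl⟩
    | all x ψ =>
      cases b
      · obtain ⟨a, rfl⟩ := hp
        exact hall hi (fun _ _ _ => rfl) a
      · cases ht
    | ex x ψ =>
      cases b
      · cases ht
      · obtain ⟨a, rfl⟩ := hp
        exact hall hi (fun _ _ _ => rfl) a
    | label l ψ =>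
      obtain rfl := hp
      exact ⟨k' + 1, (ψ, (l, ψ) :: st, e, b), hmem (List.mem_singleton.1 hS)
        (List.mem_singleton_self _), rfl⟩
    | claim l =>
      obtain ⟨χ, st', hr, c', -, rfl⟩ := hp
      refine ⟨k' + 1, (.label l χ, st', e, b), hmem (List.mem_singleton.1 hS) ?_, rfl⟩
      simp only at hr
      rw [hr]
      exact List.mem_singleton_self _
  · rintro _ ⟨k, i, hi, rfl⟩ ht -
    obtain ⟨k', hk', q, hq, hS⟩ := pr hi
    obtain ⟨ψ, st, e, b⟩ := i
    cases ψ with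
    | bot | eq | rel | neg | label | claim => cases b <;> cases ht
    | and ψ χ =>
      cases b
      · cases ht
      · have hS : σ (k' + 1) ∈ [((σ k').1, q ++ [(ψ, st, e, true)], (σ k').2.2),
          ((σ k').1, q ++ [(χ, st, e, true)], (σ k').2.2)] := hS
        rcases List.mem_cons.1 hS with hS | hS
        · exact ⟨_, .inl rfl, k' + 1, (ψ, st, e, true), hmem hS (List.mem_singleton_self _), rfl⟩
        · exact ⟨_, .inr rfl, k' + 1, (χ, st, e, true),
            hmem (List.mem_singleton.1 hS) (List.mem_singleton_self _), rfl⟩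
    | or ψ χ =>
      cases b
      · have hS : σ (k' + 1) ∈ [((σ k').1, q ++ [(ψ, st, e, false)], (σ k').2.2),
          ((σ k').1, q ++ [(χ, st, e, false)], (σ k').2.2)] := hS
        rcases List.mem_cons.1 hS with hS | hS
        · exact ⟨_, .inl rfl, k' + 1, (ψ, st, e, false), hmem hS (List.mem_singleton_self _), rfl⟩
        · exact ⟨_, .inr rfl, k' + 1, (χ, st, e, false),
            hmem (List.mem_singleton.1 hS) (List.mem_singleton_self _), rfl⟩
      · cases ht
    | all x ψ =>
      cases b
      · cases ht
      · obtain ⟨a, h⟩ := hex hi (fun _ _ _ => rfl)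
        exact ⟨_, ⟨a, rfl⟩, h⟩
    | ex x ψ =>
      cases b
      · obtain ⟨a, h⟩ := hex hi (fun _ _ _ => rfl)
        exact ⟨_, ⟨a, rfl⟩, h⟩
      · cases ht

end Branch

/-! ### Characterisations of validity -/

/-- The tableau of a valid formula is finite. -/
theorem exists_expandAll_of_valid {φ : Formula L} (h : Valid.{u, v, w} φ) (N : ℕ) :
    ∃ n, expandAll n [rootNode N φ] = [] := by
  by_contra! hn
  obtain ⟨σ, hσ0, hσ⟩ := exists_open_branch hn
  have h0 : (σ 0).WellFormed := by
    rw [hσ0]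
    exact ⟨Nat.one_pos, by simp [rootNode], by simp [rootNode]⟩
  obtain ⟨A, inst, ι, hA⟩ := exists_structure_of_branch.{u, v, w} hσ h0
  have : Nonempty A := ⟨ι 0⟩
  refine hA 0 (φ.closeVars N, [], [], true) ?_ ?_
  · rw [hσ0]
    exact List.mem_singleton_self _
  · exact SWin.closeVars (fun s => truth_iff.1 (h A s)) N _

theorem valid_of_foValid {φ : Formula L} {n : ℕ} (h : FOValid.{u, v, w} (approximant φ n)) :
    Valid.{u, v, w} φ :=
  fun A _ _ s => truth_of_realize_approximant (h A s)

theorem foValid_of_expandAll {φ : Formula L} {N n : ℕ} (hN : φ.VarsLT N)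
    (h : expandAll n [rootNode N φ] = []) : FOValid.{u, v, w} (approximant φ n) :=
  fun _ _ _ s => realize_approximant (sWin_of_expandAll hN h s)

/-- This form, an existential statement about a computable process, is the one used for
enumerability; approximants serve only in the proof of its converse direction. -/
theorem valid_iff_exists_expandAll {φ : Formula L} {N : ℕ} (hN : φ.VarsLT N) :
    Valid.{u, v, w} φ ↔ ∃ n, expandAll n [rootNode N φ] = [] :=
  ⟨fun h => exists_expandAll_of_valid h N, fun ⟨_, h⟩ => valid_of_foValid (foValid_of_expandAll hN h)⟩

theorem valid_iff_exists_foValid (φ : Formula L) :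
    Valid.{u, v, w} φ ↔ ∃ n, FOValid.{u, v, w} (approximant φ n) := by
  refine ⟨fun h => ?_, fun ⟨n, h⟩ => valid_of_foValid h⟩
  obtain ⟨N, hN⟩ := φ.exists_varsLT
  obtain ⟨n, hn⟩ := exists_expandAll_of_valid h N
  exact ⟨n, foValid_of_expandAll hN hn⟩

/-- The closing depth bounds the jumps that Eloise needs, uniformly in all structures, so she can
answer any number of Abelard with one at least that large. -/
theorem bndValid_iff_valid (φ : Formula L) : BndValid.{u, v, w} φ ↔ Valid.{u, v, w} φ := by
  refine ⟨fun h A _ _ s => (h A s).truth, fun h A _ _ s => ?_⟩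
  obtain ⟨N, hN⟩ := φ.exists_varsLT
  obtain ⟨n, hn⟩ := exists_expandAll_of_valid h N
  exact bndTruth_of_forall n fun m hm => (sWin_of_expandAll hN hn s).mono_clock hm

end SCL

namespace SCL

/-! ### The tableau on codes -/

/-- Codes of items over `natVocabulary`. -/
abbrev CItem := ℕ × List (ℕ × ℕ) × List (ℕ × ℕ) × Bool

/-- Codes of atoms over `natVocabulary`. -/
abbrev CAtom := ((ℕ × ℕ) × List ℕ) × Bool

/-- Codes of tableau nodes over `natVocabulary`. -/
abbrev CNode := ℕ × List CItem × List CAtom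

/-- The code of a stack. -/
def codeStack (st : Stack natVocabulary) : List (ℕ × ℕ) := st.map fun p => (p.1, p.2.code)

/-- The code of an item. -/
def codeItem (i : Item natVocabulary) : CItem := (i.1.code, codeStack i.2.1, i.2.2)

/-- The code of an atom. -/
def codeAtom (a : Atom natVocabulary) : CAtom := (((a.1.1.1, a.1.1.2), a.1.2), a.2)

/-- Branches close by a membership test on atoms, and coding must not create clashes. -/
theorem codeAtom_injective : Function.Injective codeAtom := by
  intro a a' h
  have h1 : a.1.1 = a'.1.1 := by
    obtain ⟨⟨⟨k, R⟩, t⟩, b⟩ := a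
    obtain ⟨⟨⟨k', R'⟩, t'⟩, b'⟩ := a'
    have hk : k = k' := congrArg (fun x : CAtom => x.1.1.1) h
    have hR : R = R' := congrArg (fun x : CAtom => x.1.1.2) h
    subst hk
    exact congrArg (Sigma.mk k) hR
  exact Prod.ext (Prod.ext h1 (congrArg (fun x : CAtom => x.1.2) h)) (congrArg (fun x : CAtom => x.2) h)

/-- The code of a node. -/
def codeNode (S : Node natVocabulary) : CNode := (S.1, S.2.1.map codeItem, S.2.2.map codeAtom)

/-- `Stack.ref` on codes. -/
def refCode (l : ℕ) : List (ℕ × ℕ) → Option (ℕ × List (ℕ × ℕ))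
  | [] => none
  | p :: st => if p.1 = l then some (p.2, st) else refCode l st

theorem refCode_codeStack (l : ℕ) (st : Stack natVocabulary) :
    refCode l (codeStack st) = (st.ref l).map fun r => (r.1.code, codeStack r.2) := by
  induction st with
  | nil => rfl
  | cons p st ih =>
    obtain ⟨l', χ⟩ := p
    by_cases h : l' = l
    · simp [codeStack, refCode, Stack.ref, h]
    · simpa [codeStack, refCode, Stack.ref, h] using ih

/-- The node that remains when an item is replaced by other items. -/
def pushCode (N : CNode) (r : List CItem) : CNode := (N.1, N.2.1 ++ r, N.2.2)

/-- The successors at a quantifier of Abelard. -/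
def freshCode (N : CNode) (i : CItem) : List CNode :=
  (List.range (N.1 + 1)).map fun j => (max N.1 (j + 1), N.2.1 ++
    [(i.1.unpair.2.unpair.2, i.2.1, (i.1.unpair.2.unpair.1, j) :: i.2.2.1, i.2.2.2)], N.2.2)

/-- The successors at a quantifier of Eloise. -/
def instCode (N : CNode) (i : CItem) : List CNode :=
  [pushCode N (i :: (List.range N.1).map fun j =>
    (i.1.unpair.2.unpair.2, i.2.1, (i.1.unpair.2.unpair.1, j) :: i.2.2.1, i.2.2.2))]

/-- The atom of an item whose formula is a relational atom. -/
def relCode (i : CItem) : (ℕ × ℕ) × List ℕ :=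
  ((i.1.unpair.2.unpair.1, i.1.unpair.2.unpair.2.unpair.1),
    ((Encodable.decode (α := List ℕ) i.1.unpair.2.unpair.2.unpair.2).getD []).map (envVal i.2.2.1))

/-- Both items of a connective. -/
def bothCode (i : CItem) : List CItem :=
  [(i.1.unpair.2.unpair.1, i.2), (i.1.unpair.2.unpair.2, i.2)]

/-- `expandItem` on codes. -/
def expandItemCode (N : CNode) (i : CItem) : List CNode :=
  if i.1.unpair.1 = 0 then if i.2.2.2 = true then [N] else []
  else if i.1.unpair.1 = 1 then
    if decide (envVal i.2.2.1 i.1.unpair.2.unpair.1 = envVal i.2.2.1 i.1.unpair.2.unpair.2) =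
      i.2.2.2 then [] else [N]
  else if i.1.unpair.1 = 2 then
    if (relCode i, !i.2.2.2) ∈ N.2.2 then [] else [(N.1, N.2.1, (relCode i, i.2.2.2) :: N.2.2)]
  else if i.1.unpair.1 = 3 then [pushCode N [(i.1.unpair.2, i.2.1, i.2.2.1, !i.2.2.2)]]
  else if i.1.unpair.1 = 4 then
    if i.2.2.2 = true then (bothCode i).map fun j => pushCode N [j] else [pushCode N (bothCode i)]
  else if i.1.unpair.1 = 5 then
    if i.2.2.2 = true then [pushCode N (bothCode i)] else (bothCode i).map fun j => pushCode N [j]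
  else if i.1.unpair.1 = 6 then if i.2.2.2 = true then freshCode N i else instCode N i
  else if i.1.unpair.1 = 7 then if i.2.2.2 = true then instCode N i else freshCode N i
  else if i.1.unpair.1 = 8 then
    [pushCode N [(i.1.unpair.2.unpair.2, i.1.unpair.2.unpair :: i.2.1, i.2.2)]]
  else [pushCode N ((refCode i.1.unpair.2 i.2.1).map fun r =>
    (Nat.pair 8 (Nat.pair i.1.unpair.2 r.1), r.2, i.2.2)).toList]

/-- `expand` on codes. -/
def expandCode (N : CNode) : List CNode :=
  match N.2.1 with
  | [] => [N]
  | i :: q => expandItemCode (N.1, q, N.2.2) i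

/-- `expandAll` on codes. -/
def expandAllCode (n : ℕ) (l : List CNode) : List CNode :=
  (fun l => List.flatMap expandCode l)^[n] l

/-- `Formula.closeVars` on codes. -/
def closeVarsCode (c : ℕ) (N : ℕ) : ℕ :=
  Nat.rec c (fun n d => Nat.pair 6 (Nat.pair n d)) N

/-- `rootNode` on codes. -/
def rootNodeCode (N c : ℕ) : CNode := (1, [(closeVarsCode c N, [], [], true)], [])

theorem codeNode_push (m : ℕ) (q r : List (Item natVocabulary)) (a : List (Atom natVocabulary)) :
    codeNode (m, q ++ r, a) = pushCode (codeNode (m, q, a)) (r.map codeItem) := by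
  simp [codeNode, pushCode]

/-- Stated with `R : ℕ`, because the relation symbols of `natVocabulary` are numbers only after
unfolding a definition. -/
theorem expandItemCode_rel (N : CNode) {k : ℕ} (R : ℕ) (t : Fin k → ℕ) (st e : List (ℕ × ℕ))
    (b : Bool) : expandItemCode N (Nat.pair 2 (Nat.pair k (Nat.pair R
        (Encodable.encode (List.ofFn t)))), st, e, b) =
      if (((k, R), List.ofFn fun i => envVal e (t i)), !b) ∈ N.2.2 then []
      else [(N.1, N.2.1, (((k, R), List.ofFn fun i => envVal e (t i)), b) :: N.2.2)] := by
  simp [expandItemCode, relCode, Function.comp_def]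

theorem expandItemCode_codeItem (m : ℕ) (q : List (Item natVocabulary))
    (a : List (Atom natVocabulary)) (i : Item natVocabulary) :
    expandItemCode (codeNode (m, q, a)) (codeItem i) = (expandItem m q a i).map codeNode := by
  obtain ⟨ψ, st, e, b⟩ := i
  cases ψ with
  | bot => cases b <;> simp [expandItemCode, codeItem, Formula.code, expandItem]
  | eq x y =>
    simp only [expandItemCode, codeItem, Formula.code, expandItem, Nat.unpair_pair]
    by_cases h : envVal e x = envVal e y <;> cases b <;> simp [h]
  | @rel k R t =>
    refine (expandItemCode_rel _ R t _ e b).trans ?_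
    have hmem : (((k, R), List.ofFn fun i => envVal e (t i)), !b) ∈ a.map codeAtom ↔
        (((⟨k, R⟩, List.ofFn fun i => envVal e (t i)), !b) : Atom natVocabulary) ∈ a :=
      List.mem_map_of_injective codeAtom_injective (a := ((⟨k, R⟩, _), !b))
    simp only [expandItem]
    by_cases h : (((⟨k, R⟩, List.ofFn fun i => envVal e (t i)), !b) : Atom natVocabulary) ∈ a
    · rw [if_pos h]
      exact if_pos (hmem.2 h)
    · rw [if_neg h]
      exact if_neg fun h' => h (hmem.1 h')
  | neg ψ => simp [expandItemCode, codeItem, Formula.code, expandItem, codeNode_push]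
  | and ψ χ | or ψ χ =>
    cases b <;>
      simp [expandItemCode, codeItem, Formula.code, expandItem, codeNode_push, bothCode]
  | all x ψ | ex x ψ =>
    cases b <;> simp [expandItemCode, codeItem, Formula.code, expandItem, freshCode,
      instCode, Function.comp_def, codeNode_push] <;> simp [codeNode, pushCode]
  | label l ψ =>
    simp [expandItemCode, codeItem, Formula.code, expandItem, codeNode_push, codeStack]
  | claim l =>
    simp only [expandItemCode, codeItem, Formula.code, expandItem, Nat.unpair_pair,
      refCode_codeStack, List.map_cons, List.map_nil, codeNode_push]
    cases st.ref l <;> simp [codeItem, Formula.code]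

theorem expandCode_codeNode (S : Node natVocabulary) :
    expandCode (codeNode S) = (expand S).map codeNode := by
  obtain ⟨m, q, a⟩ := S
  cases q with
  | nil => rfl
  | cons i q => exact expandItemCode_codeItem m q a i

theorem expandAllCode_map (n : ℕ) : ∀ l : List (Node natVocabulary),
    expandAllCode n (l.map codeNode) = (expandAll n l).map codeNode := by
  induction n with
  | zero => exact fun _ => rfl
  | succ n ih =>
    intro l
    change expandAllCode n ((l.map codeNode).flatMap expandCode) = (expandAll n (l.flatMap expand)).map _
    rw [← ih, List.flatMap_map, List.map_flatMap]
    simp only [expandCode_codeNode]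

theorem code_closeVars (φ : Formula natVocabulary) (N : ℕ) :
    (φ.closeVars N).code = closeVarsCode φ.code N := by
  induction N with
  | zero => rfl
  | succ N ih => simp [Formula.closeVars, Formula.code, closeVarsCode, ih]

theorem codeNode_rootNode (N : ℕ) (φ : Formula natVocabulary) :
    codeNode (rootNode N φ) = rootNodeCode N φ.code := by
  simp [codeNode, rootNode, rootNodeCode, codeItem, codeStack, code_closeVars]

theorem le_encode_of_mem {x : ℕ} : ∀ {l : List ℕ}, x ∈ l → x ≤ Encodable.encode l
  | y :: l, h => by
    rw [Encodable.encode_list_cons]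
    rcases List.mem_cons.1 h with rfl | h
    · exact (Nat.left_le_pair _ _).trans (Nat.le_succ _)
    · exact (le_encode_of_mem h).trans ((Nat.right_le_pair _ _).trans (Nat.le_succ _))

/-- Pairing dominates its arguments, so the code itself gives a computable bound for the universal
closure. -/
theorem Formula.varsLT_code (φ : Formula natVocabulary) : φ.VarsLT (φ.code + 1) := by
  have hl : ∀ {x a b : ℕ}, x ≤ a → x ≤ Nat.pair a b := fun h => h.trans (Nat.left_le_pair _ _)
  have hr : ∀ {x a b : ℕ}, x ≤ b → x ≤ Nat.pair a b := fun h => h.trans (Nat.right_le_pair _ _)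
  induction φ with
  | bot | claim => trivial
  | eq x y => exact ⟨Nat.lt_succ_of_le (hr (hl le_rfl)), Nat.lt_succ_of_le (hr (hr le_rfl))⟩
  | rel R t =>
    exact fun i => Nat.lt_succ_of_le (hr (hr (hr (le_encode_of_mem (List.mem_ofFn.2 ⟨i, rfl⟩)))))
  | neg φ ih => exact ih.mono (Nat.succ_le_succ (hr le_rfl))
  | and φ ψ ih₁ ih₂ | or φ ψ ih₁ ih₂ =>
    exact ⟨ih₁.mono (Nat.succ_le_succ (hr (hl le_rfl))), ih₂.mono (Nat.succ_le_succ (hr (hr le_rfl)))⟩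
  | all x φ ih | ex x φ ih =>
    exact ⟨Nat.lt_succ_of_le (hr (hl le_rfl)), ih.mono (Nat.succ_le_succ (hr (hr le_rfl)))⟩
  | label l φ ih => exact ih.mono (Nat.succ_le_succ (hr (hr le_rfl)))

theorem valid_iff_expandAllCode (φ : Formula natVocabulary) : Valid.{0, 0, w} φ ↔
    ∃ n, expandAllCode n [rootNodeCode (φ.code + 1) φ.code] = [] := by
  rw [valid_iff_exists_expandAll φ.varsLT_code]
  refine exists_congr fun n => ?_
  rw [← codeNode_rootNode, ← List.map_singleton (f := codeNode), expandAllCode_map,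
    List.map_eq_nil_iff]

/-! ### Primitive recursiveness of the tableau -/

section Primrec

open Primrec

theorem _root_.PrimrecPred.list_mem {α β : Type*} [Primcodable α] [Primcodable β] {f : α → β}
    {g : α → List β} (hf : Primrec f) (hg : Primrec g) : PrimrecPred fun a => f a ∈ g a :=
  ((PrimrecRel.exists_mem_list Primrec.eq).comp hg hf).of_eq fun a => by simp

theorem primrec_envVal : Primrec₂ envVal :=
  option_getD.comp₂ (listLookup.comp₂ Primrec₂.right Primrec₂.left) (Primrec₂.const 0)

/-- The recursion also needs the remaining stack and not just the recursive value; `list_rec`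
supplies both. -/
theorem primrec_refCode : Primrec₂ refCode := by
  have h : Primrec₂ fun (a : ℕ × List (ℕ × ℕ))
      (x : (ℕ × ℕ) × List (ℕ × ℕ) × Option (ℕ × List (ℕ × ℕ))) =>
      if x.1.1 = a.1 then some (x.1.2, x.2.1) else x.2.2 :=
    ite (Primrec.eq.comp (fst.comp (fst.comp snd)) (fst.comp fst))
      (option_some.comp ((snd.comp (fst.comp snd)).pair (fst.comp (snd.comp snd))))
      (snd.comp (snd.comp snd))
  refine (list_rec (snd : Primrec (Prod.snd : ℕ × List (ℕ × ℕ) → _)) (const none) h).of_eq ?_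
  rintro ⟨l, st⟩
  induction st with
  | nil => rfl
  | cons p st ih =>
    simp only at ih
    simp only [refCode, ih]

theorem primrec_list_singleton {α : Type*} [Primcodable α] : Primrec fun a : α => [a] :=
  list_cons.comp Primrec.id (const [])

theorem primrec_pushCode : Primrec₂ pushCode :=
  (fst.comp fst).pair ((list_append.comp (fst.comp (snd.comp fst)) snd).pair
    (snd.comp (snd.comp fst)))

theorem primrec_arg : Primrec fun i : CItem => i.1.unpair.2 := snd.comp (unpair.comp fst)

theorem primrec_arg_left : Primrec fun i : CItem => i.1.unpair.2.unpair.1 :=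
  fst.comp (unpair.comp primrec_arg)

theorem primrec_arg_right : Primrec fun i : CItem => i.1.unpair.2.unpair.2 :=
  snd.comp (unpair.comp primrec_arg)

theorem primrec_bothCode : Primrec bothCode :=
  list_cons.comp (primrec_arg_left.pair snd)
    (primrec_list_singleton.comp (primrec_arg_right.pair snd))

theorem primrec_env : Primrec fun i : CItem => i.2.2.1 := fst.comp (snd.comp snd)

theorem primrec_relCode : Primrec relCode :=
  (primrec_arg_left.pair (fst.comp (unpair.comp primrec_arg_right))).pair
    (list_map (option_getD.comp (Primrec.decode.comp (snd.comp (unpair.comp primrec_arg_right)))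
      (const [])) (primrec_envVal.comp (primrec_env.comp fst) snd))

theorem primrec_instance : Primrec₂ fun (i : CItem) (j : ℕ) =>
    ((i.1.unpair.2.unpair.2, i.2.1, (i.1.unpair.2.unpair.1, j) :: i.2.2.1, i.2.2.2) : CItem) :=
  (primrec_arg_right.comp fst).pair ((fst.comp (snd.comp fst)).pair
    ((list_cons.comp ((primrec_arg_left.comp fst).pair snd) (primrec_env.comp fst)).pair
      (snd.comp (snd.comp (snd.comp fst)))))

theorem primrec_freshCode : Primrec₂ freshCode :=
  list_map (list_range.comp (succ.comp (fst.comp fst)))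
    ((nat_max.comp (fst.comp (fst.comp fst)) (succ.comp snd)).pair
      ((list_append.comp (fst.comp (snd.comp (fst.comp fst)))
        (primrec_list_singleton.comp (primrec_instance.comp (snd.comp fst) snd))).pair
        (snd.comp (snd.comp (fst.comp fst)))))

theorem primrec_instCode : Primrec₂ instCode :=
  primrec_list_singleton.comp (primrec_pushCode.comp fst (list_cons.comp snd
    (list_map (list_range.comp (fst.comp fst)) (primrec_instance.comp (snd.comp fst) snd))))

theorem primrec_expandItemCode : Primrec₂ expandItemCode := by
  have tag : ∀ k, PrimrecPred fun p : CNode × CItem => p.2.1.unpair.1 = k := fun k =>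
    Primrec.eq.comp (fst.comp (unpair.comp (fst.comp snd))) (const k)
  have hb : Primrec fun p : CNode × CItem => p.2.2.2.2 := snd.comp (snd.comp (snd.comp snd))
  have sign : PrimrecPred fun p : CNode × CItem => p.2.2.2.2 = true := Primrec.eq.comp hb (const true)
  have hN : Primrec fun p : CNode × CItem => [p.1] := primrec_list_singleton.comp fst
  have one : ∀ {f : CNode × CItem → List CItem}, Primrec f →
      Primrec fun p : CNode × CItem => [pushCode p.1 (f p)] := fun hf =>
    primrec_list_singleton.comp (primrec_pushCode.comp fst hf)
  have split : Primrec fun p : CNode × CItem => (bothCode p.2).map fun j => pushCode p.1 [j] :=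
    list_map (primrec_bothCode.comp snd)
      (primrec_pushCode.comp (fst.comp fst) (primrec_list_singleton.comp snd))
  have rel : Primrec fun p : CNode × CItem => relCode p.2 := primrec_relCode.comp snd
  refine ite (tag 0) (ite sign hN (const [])) ?_
  refine ite (tag 1) (ite ?_ (const []) hN) ?_
  · exact Primrec.eq.comp (Primrec.eq.decide.comp
      (primrec_envVal.comp (primrec_env.comp snd) (primrec_arg_left.comp snd))
      (primrec_envVal.comp (primrec_env.comp snd) (primrec_arg_right.comp snd))) hb
  refine ite (tag 2) (ite (.list_mem (rel.pair (Primrec.not.comp hb)) (snd.comp (snd.comp fst)))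
    (const []) (primrec_list_singleton.comp ((fst.comp fst).pair ((fst.comp (snd.comp fst)).pair
      (list_cons.comp (rel.pair hb) (snd.comp (snd.comp fst))))))) ?_
  refine ite (tag 3) (one (primrec_list_singleton.comp ((primrec_arg.comp snd).pair
    ((fst.comp (snd.comp snd)).pair ((primrec_env.comp snd).pair (Primrec.not.comp hb)))))) ?_
  refine ite (tag 4) (ite sign split (one (primrec_bothCode.comp snd))) ?_
  refine ite (tag 5) (ite sign (one (primrec_bothCode.comp snd)) split) ?_
  refine ite (tag 6) (ite sign primrec_freshCode primrec_instCode) ?_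
  refine ite (tag 7) (ite sign primrec_instCode primrec_freshCode) ?_
  refine ite (tag 8) (one (primrec_list_singleton.comp ((primrec_arg_right.comp snd).pair
    ((list_cons.comp (unpair.comp (primrec_arg.comp snd)) (fst.comp (snd.comp snd))).pair
      (snd.comp (snd.comp snd)))))) ?_
  refine one (optionToList.comp (option_map
    (primrec_refCode.comp (primrec_arg.comp snd) (fst.comp (snd.comp snd))) ?_))
  exact (Primrec₂.natPair.comp (const 8) (Primrec₂.natPair.comp
    (primrec_arg.comp (snd.comp fst)) (fst.comp snd))).pair
    ((snd.comp snd).pair (snd.comp (snd.comp (snd.comp fst))))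

theorem primrec_expandCode : Primrec expandCode := by
  refine (list_casesOn (fst.comp snd : Primrec fun N : CNode => N.2.1) primrec_list_singleton
    (h := fun N x => expandItemCode (N.1, x.2, N.2.2) x.1) ?_).of_eq ?_
  · exact primrec_expandItemCode.comp ((fst.comp fst).pair ((snd.comp snd).pair
      (snd.comp (snd.comp fst)))) (fst.comp snd)
  · rintro ⟨m, q, a⟩
    cases q <;> rfl

theorem primrec_expandAllCode : Primrec₂ expandAllCode :=
  nat_iterate fst snd (list_flatMap snd (primrec_expandCode.comp snd))

theorem primrec_rootNodeCode : Primrec₂ rootNodeCode := by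
  have h : Primrec₂ closeVarsCode :=
    nat_rec Primrec.id (Primrec₂.natPair.comp (const 6)
      (Primrec₂.natPair.comp (fst.comp snd) (snd.comp snd)) :
      Primrec fun p : ℕ × ℕ × ℕ => Nat.pair 6 (Nat.pair p.2.1 p.2.2)).to₂
  exact (const 1).pair ((primrec_list_singleton.comp ((h.comp snd fst).pair
    (const ([], [], true)))).pair (const []))

end Primrec

/-! ### Recognising the codes of formulas and sentences -/

/-- The list of the free variables of a formula. -/
def Formula.freeVarList {L : FirstOrder.Language.{u, v}} : Formula L → List ℕ
  | bot => []
  | eq x y => [x, y]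
  | rel _ t => List.ofFn t
  | neg φ => φ.freeVarList
  | and φ ψ => φ.freeVarList ++ ψ.freeVarList
  | or φ ψ => φ.freeVarList ++ ψ.freeVarList
  | all x φ => φ.freeVarList.filter (· ≠ x)
  | ex x φ => φ.freeVarList.filter (· ≠ x)
  | label _ φ => φ.freeVarList
  | claim _ => []

theorem Formula.mem_freeVarList {L : FirstOrder.Language.{u, v}} (φ : Formula L) (y : ℕ) :
    y ∈ φ.freeVarList ↔ y ∈ φ.freeVars := by
  induction φ with
  | rel R t => simp [freeVarList, freeVars, List.mem_ofFn]
  | all x φ ih | ex x φ ih =>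
    simp only [freeVarList, freeVars, List.mem_filter, Finset.mem_erase, ih, decide_eq_true_eq]
    tauto
  | _ => simp_all [freeVarList, freeVars]

theorem Formula.isSentence_iff {L : FirstOrder.Language.{u, v}} (φ : Formula L) :
    φ.IsSentence ↔ φ.freeVarList = [] := by
  rw [IsSentence, Finset.eq_empty_iff_forall_notMem, List.eq_nil_iff_forall_not_mem]
  simp only [mem_freeVarList]

/-- The free variables of the formula whose code is the length of `l`, if there is one, where `l`
gives the results for the smaller numbers. -/
def freeVarsStep (l : List (Option (List ℕ))) : Option (List ℕ) :=
  if l.length.unpair.1 = 0 then if l.length.unpair.2 = 0 then some [] else none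
  else if l.length.unpair.1 = 1 then
    some [l.length.unpair.2.unpair.1, l.length.unpair.2.unpair.2]
  else if l.length.unpair.1 = 2 then
    (Encodable.decode (α := List ℕ) l.length.unpair.2.unpair.2.unpair.2).bind fun t =>
      -- The arity must fit, and re-encoding ensures that the number really is the code of the list.
      if t.length = l.length.unpair.2.unpair.1 ∧
        Encodable.encode t = l.length.unpair.2.unpair.2.unpair.2 then some t else none
  else if l.length.unpair.1 = 3 then l.getD l.length.unpair.2 none
  else if l.length.unpair.1 = 4 ∨ l.length.unpair.1 = 5 then
    (l.getD l.length.unpair.2.unpair.1 none).bind fun s =>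
      (l.getD l.length.unpair.2.unpair.2 none).map fun t => s ++ t
  else if l.length.unpair.1 = 6 ∨ l.length.unpair.1 = 7 then
    (l.getD l.length.unpair.2.unpair.2 none).map fun s =>
      s.filter fun y => y ≠ l.length.unpair.2.unpair.1
  else if l.length.unpair.1 = 8 then l.getD l.length.unpair.2.unpair.2 none
  else if l.length.unpair.1 = 9 then some []
  else none

/-- The results of `freeVarsStep` for the numbers below `n`. -/
def freeVarsTable (n : ℕ) : List (Option (List ℕ)) :=
  Nat.rec [] (fun _ l => l ++ [freeVarsStep l]) n

/-- The free variables of the formula with the given code, if there is one. -/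
def codeFreeVars (c : ℕ) : Option (List ℕ) := freeVarsStep (freeVarsTable c)

theorem freeVarsTable_eq (n : ℕ) : freeVarsTable n = (List.range n).map codeFreeVars := by
  induction n with
  | zero => rfl
  | succ n ih =>
    rw [List.range_succ, List.map_append, ← ih]
    rfl

theorem codeFreeVars_eq (c : ℕ) : codeFreeVars c = freeVarsStep ((List.range c).map codeFreeVars) := by
  rw [← freeVarsTable_eq]
  rfl

theorem getD_codeFreeVars {c d : ℕ} (h : d < c) :
    ((List.range c).map codeFreeVars).getD d none = codeFreeVars d := by
  simp [List.getD_eq_getElem?_getD, h]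

/-- Immediate subformulas have smaller codes because every tag except that of `bot` is positive;
this justifies the course-of-values recursion. -/
theorem lt_pair {t d e : ℕ} (ht : 0 < t) (h : d ≤ e) : d < Nat.pair t e := by
  refine h.trans_lt ?_
  unfold Nat.pair
  split_ifs with h2
  · nlinarith
  · nlinarith

theorem codeFreeVars_code (φ : Formula natVocabulary) :
    codeFreeVars φ.code = some φ.freeVarList := by
  induction φ with
  | bot | eq | claim =>
    rw [codeFreeVars_eq]
    simp [freeVarsStep, Formula.code, Formula.freeVarList]
  | @rel k R t =>
    have : ∀ R : ℕ, codeFreeVars (Nat.pair 2 (Nat.pair k (Nat.pair R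
        (Encodable.encode (List.ofFn t))))) = some (List.ofFn t) := by
      intro R
      rw [codeFreeVars_eq]
      simp [freeVarsStep]
    exact this R
  | neg φ ih =>
    rw [codeFreeVars_eq]
    simp only [freeVarsStep, List.length_map, List.length_range, Formula.code, Nat.unpair_pair]
    rw [getD_codeFreeVars (lt_pair (by norm_num) le_rfl), ih]
    rfl
  | and φ ψ ih₁ ih₂ | or φ ψ ih₁ ih₂ =>
    rw [codeFreeVars_eq]
    simp only [freeVarsStep, List.length_map, List.length_range, Formula.code, Nat.unpair_pair]
    rw [getD_codeFreeVars (lt_pair (by norm_num) (Nat.left_le_pair _ _)), ih₁,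
      getD_codeFreeVars (lt_pair (by norm_num) (Nat.right_le_pair _ _)), ih₂]
    rfl
  | all x φ ih | ex x φ ih =>
    rw [codeFreeVars_eq]
    simp only [freeVarsStep, List.length_map, List.length_range, Formula.code, Nat.unpair_pair]
    rw [getD_codeFreeVars (lt_pair (by norm_num) (Nat.right_le_pair _ _)), ih]
    rfl
  | label l φ ih =>
    rw [codeFreeVars_eq]
    simp only [freeVarsStep, List.length_map, List.length_range, Formula.code, Nat.unpair_pair]
    rw [getD_codeFreeVars (lt_pair (by norm_num) (Nat.right_le_pair _ _)), ih]
    rfl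

/-- With `codeFreeVars_code` this makes one primitive recursive function both recognise codes and
decide sentencehood. -/
theorem exists_code_of_codeFreeVars (c : ℕ) : ∀ s, codeFreeVars c = some s →
    ∃ φ : Formula natVocabulary, φ.code = c := by
  induction c using Nat.strong_induction_on with
  | _ c ih =>
  intro s hs
  obtain ⟨t, g, rfl⟩ : ∃ t g, c = Nat.pair t g := ⟨_, _, (Nat.pair_unpair c).symm⟩
  obtain ⟨x, y, rfl⟩ : ∃ x y, g = Nat.pair x y := ⟨_, _, (Nat.pair_unpair g).symm⟩
  have hlt : 0 < t → Nat.pair x y < Nat.pair t (Nat.pair x y) := fun h => lt_pair h le_rfl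
  have hltx : 0 < t → x < Nat.pair t (Nat.pair x y) := fun h => lt_pair h (Nat.left_le_pair _ _)
  have hlty : 0 < t → y < Nat.pair t (Nat.pair x y) := fun h => lt_pair h (Nat.right_le_pair _ _)
  rw [codeFreeVars_eq] at hs
  simp only [freeVarsStep, List.length_map, List.length_range, Nat.unpair_pair] at hs
  split_ifs at hs with h0 h0' h1 h2 h3 h45 h67 h8 h9
  · exact ⟨.bot, by rw [h0, h0']; rfl⟩
  · exact ⟨.eq x y, by rw [h1]; rfl⟩
  · obtain ⟨t', -, ht'⟩ := Option.bind_eq_some_iff.1 hs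
    split_ifs at ht' with h
    refine ⟨.rel (k := x) (show natVocabulary.Relations x from y.unpair.1)
      (fun i => t'.get (i.cast h.1.symm)), ?_⟩
    have hofn : List.ofFn (fun i : Fin x => t'.get (i.cast h.1.symm)) = t' := by
      obtain ⟨h1, -⟩ := h
      subst h1
      exact List.ofFn_get t'
    rw [Formula.code, hofn, h.2, h2]
    exact congrArg (fun z => Nat.pair 2 (Nat.pair x z)) (Nat.pair_unpair y)
  · subst h3
    rw [getD_codeFreeVars (hlt (by norm_num))] at hs
    obtain ⟨φ, hφ⟩ := ih _ (hlt (by norm_num)) _ hs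
    exact ⟨.neg φ, by rw [Formula.code, hφ]⟩
  · have ht : 0 < t := by omega
    rw [getD_codeFreeVars (hltx ht), getD_codeFreeVars (hlty ht)] at hs
    obtain ⟨s₁, hs₁, hs⟩ := Option.bind_eq_some_iff.1 hs
    obtain ⟨s₂, hs₂, -⟩ := Option.map_eq_some_iff.1 hs
    obtain ⟨φ, hφ⟩ := ih _ (hltx ht) _ hs₁
    obtain ⟨ψ, hψ⟩ := ih _ (hlty ht) _ hs₂
    rcases h45 with rfl | rfl
    · exact ⟨.and φ ψ, by rw [Formula.code, hφ, hψ]⟩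
    · exact ⟨.or φ ψ, by rw [Formula.code, hφ, hψ]⟩
  · have ht : 0 < t := by omega
    rw [getD_codeFreeVars (hlty ht)] at hs
    obtain ⟨s₂, hs₂, -⟩ := Option.map_eq_some_iff.1 hs
    obtain ⟨φ, hφ⟩ := ih _ (hlty ht) _ hs₂
    rcases h67 with rfl | rfl
    · exact ⟨.all x φ, by rw [Formula.code, hφ]⟩
    · exact ⟨.ex x φ, by rw [Formula.code, hφ]⟩
  · subst h8
    rw [getD_codeFreeVars (hlty (by norm_num))] at hs
    obtain ⟨φ, hφ⟩ := ih _ (hlty (by norm_num)) _ hs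
    exact ⟨.label x φ, by rw [Formula.code, hφ]⟩
  · exact ⟨.claim (Nat.pair x y), by rw [h9]; rfl⟩

/-! ### Recursive enumerability -/

section Primrec

open Primrec

theorem primrec_codeFreeVars : Primrec codeFreeVars := by
  have u : ∀ {α : Type} [Primcodable α] {f : α → ℕ}, Primrec f →
      Primrec (fun a => (f a).unpair.1) ∧ Primrec (fun a => (f a).unpair.2) := fun hf =>
    ⟨fst.comp (unpair.comp hf), snd.comp (unpair.comp hf)⟩
  have hg : Primrec fun l : List (Option (List ℕ)) => l.length.unpair.2 := (u list_length).2
  have tag : ∀ k, PrimrecPred fun l : List (Option (List ℕ)) => l.length.unpair.1 = k := fun k =>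
    Primrec.eq.comp (u list_length).1 (const k)
  have get : ∀ {f : List (Option (List ℕ)) → ℕ}, Primrec f →
      Primrec fun l : List (Option (List ℕ)) => l.getD (f l) none := fun hf =>
    (list_getD none).comp Primrec.id hf
  have hstep : Primrec freeVarsStep := by
    refine ite (tag 0) (ite (Primrec.eq.comp hg (const 0)) (const _) (const _)) ?_
    refine ite (tag 1) (option_some.comp (list_cons.comp (u hg).1
      (list_cons.comp (u hg).2 (const [])))) ?_
    refine ite (tag 2) (option_bind (Primrec.decode.comp (u (u hg).2).2) ?_) ?_
    · exact ite (PrimrecPred.and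
        (Primrec.eq.comp (list_length.comp snd) ((u hg).1.comp fst))
        (Primrec.eq.comp (Primrec.encode.comp snd) ((u (u hg).2).2.comp fst)))
        (option_some.comp snd) (const none)
    refine ite (tag 3) (get hg) ?_
    refine ite ((tag 4).or (tag 5)) (option_bind (get (u hg).1) (option_map
      ((get (u hg).2).comp fst) (list_append.comp (snd.comp fst) snd))) ?_
    refine ite ((tag 6).or (tag 7)) (option_map (get (u hg).2) ?_) ?_
    · exact (PrimrecRel.listFilter (R := fun y x : ℕ => y ≠ x)
        (PrimrecPred.not Primrec.eq)).comp snd ((u hg).1.comp fst)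
    exact ite (tag 8) (get (u hg).2) (ite (tag 9) (const _) (const _))
  have htable : Primrec freeVarsTable :=
    nat_rec₁ [] (list_append.comp snd (list_cons.comp (hstep.comp snd) (const [])))
  exact hstep.comp htable

/-- Such a predicate is the domain of the unbounded search for `n`. -/
theorem rePred_of_exists {p : ℕ → Prop} {r : ℕ → ℕ → Prop} (hr : PrimrecRel r)
    (h : ∀ c, p c ↔ ∃ n, r c n) : REPred p := by
  classical
  have h1 : Partrec fun c => Nat.rfind fun n => (decide (r c n) : Part Bool) :=
    Partrec.rfind (Computable₂.partrec₂ (Primrec₂.to_comp hr.decide))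
  refine h1.dom_re.of_eq fun c => ?_
  rw [h c]
  refine Nat.rfind_dom.trans ⟨fun ⟨n, hn, _⟩ => ⟨n, by simpa using hn⟩, fun ⟨n, hn⟩ =>
    ⟨n, by simpa using hn, fun _ => trivial⟩⟩

theorem primrecRel_closed : PrimrecRel fun c n : ℕ =>
    expandAllCode n [rootNodeCode (c + 1) c] = [] :=
  Primrec.eq.comp (primrec_expandAllCode.comp snd (primrec_list_singleton.comp
    (primrec_rootNodeCode.comp (succ.comp fst) fst))) (const [])

theorem rePred_valid : REPred fun c : ℕ => ∃ φ : Formula natVocabulary,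
    φ.code = c ∧ Valid.{0, 0, w} φ := by
  -- Numbers that are not codes have to be excluded explicitly, since the coded tableau may close on
  -- them as well.
  refine rePred_of_exists (r := fun c n => codeFreeVars c ≠ none ∧
    expandAllCode n [rootNodeCode (c + 1) c] = []) ?_ fun c => ?_
  · exact PrimrecPred.and
      (PrimrecPred.not (Primrec.eq.comp (primrec_codeFreeVars.comp fst) (const none)))
      primrecRel_closed
  · constructor
    · rintro ⟨φ, rfl, h⟩
      obtain ⟨n, hn⟩ := (valid_iff_expandAllCode φ).1 h
      exact ⟨n, by simp [codeFreeVars_code], hn⟩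
    · rintro ⟨n, h, hn⟩
      obtain ⟨s, hs⟩ := Option.ne_none_iff_exists'.1 h
      obtain ⟨φ, rfl⟩ := exists_code_of_codeFreeVars c s hs
      exact ⟨φ, rfl, (valid_iff_expandAllCode φ).2 ⟨n, hn⟩⟩

theorem rePred_valid_sentence : REPred fun c : ℕ => ∃ φ : Formula natVocabulary,
    φ.code = c ∧ φ.IsSentence ∧ Valid.{0, 0, w} φ := by
  refine rePred_of_exists (r := fun c n => codeFreeVars c = some [] ∧
    expandAllCode n [rootNodeCode (c + 1) c] = []) ?_ fun c => ?_
  · exact PrimrecPred.and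
      (Primrec.eq.comp (primrec_codeFreeVars.comp fst) (const (some [])))
      primrecRel_closed
  · constructor
    · rintro ⟨φ, rfl, hs, h⟩
      obtain ⟨n, hn⟩ := (valid_iff_expandAllCode φ).1 h
      exact ⟨n, by rw [codeFreeVars_code, φ.isSentence_iff.1 hs], hn⟩
    · rintro ⟨n, h, hn⟩
      obtain ⟨φ, rfl⟩ := exists_code_of_codeFreeVars c _ h
      rw [codeFreeVars_code, Option.some_inj] at h
      exact ⟨φ, rfl, φ.isSentence_iff.2 h, (valid_iff_expandAllCode φ).2 ⟨n, hn⟩⟩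

end Primrec

end SCL

theorem theorem4p6 :
    (∀ (L : FirstOrder.Language.{u, v}) [L.IsRelational] (φ : SCL.Formula L),
      (SCL.Valid.{u, v, w} φ ↔ ∃ n : ℕ, SCL.FOValid.{u, v, w} (SCL.approximant φ n)) ∧
      (SCL.BndValid.{u, v, w} φ ↔ SCL.Valid.{u, v, w} φ)) ∧
    REPred (fun c : ℕ => ∃ φ : SCL.Formula SCL.natVocabulary,
      φ.code = c ∧ SCL.Valid.{0, 0, w} φ) ∧
    REPred (fun c : ℕ => ∃ φ : SCL.Formula SCL.natVocabulary,
      φ.code = c ∧ φ.IsSentence ∧ SCL.Valid.{0, 0, w} φ) :=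
  ⟨fun _ _ φ => ⟨SCL.valid_iff_exists_foValid φ, SCL.bndValid_iff_valid φ⟩,
    SCL.rePred_valid, SCL.rePred_valid_sentence⟩
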